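/- **Setting.** Let $M$ be a connected Riemann surface. A real oriented 3-plane in $\mathbb{C}^3$ is special Lagrangian if it lies in the $SU_3$-orbit $SL$ of $e_1\wedge e_2\wedge e_3$, and a cone is special Lagrangian if its Gauss map takes values in $SL$ away from the vertex. Put $$FL_1=\{(v,V)\in S^5\times SL: v\in V\},\qquad \pi_1(v,V)=v,\qquad \pi_2(v,V)=V,$$ let $R\in SO_3$ be the rotation about the $e_1$-axis through the angle $\pi/3$ and let $\hat\sigma(g)=R\,(g^{-1})^{t}R^{-1}$ on $SU_3$. Let $\hat{\mathfrak g}_j\subset\mathfrak{sl}_3(\mathbb{C})$ be the eigenspace of the induced complex-linear map $X\mapsto -RX^tR^{-1}$ for the eigenvalue $e^{ij\pi/3}$, let $\mathfrak p\subset\mathfrak{su}_3$ be the real form of $\bigoplus_{j\ne0}\hat{\mathfrak g}_j$, and identify $T_{gK_1}(SU_3/K_1)$ with $\mathrm{Ad}\,g\cdot\mathfrak p$ by $\xi\mapsto\frac{d}{dt}e^{t\xi}gK_1|_{t=0}$. A map $\psi:M\to SU_3/K_1$ is *primitive* if it is a smooth immersion and $d\psi(\partial/\partial z)\in \mathrm{Ad}\,g\cdot\hat{\mathfrak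 g}_1$ at points with $\psi=gK_1$, for every local complex coordinate $z$. It is *harmonic* for an invariant metric if it is a critical point of the Dirichlet energy under compactly supported smooth variations within coordinate charts. **Proposition.** 1. $\hat\sigma$ is an outer automorphism of $SU_3$ of order six with fixed point group $K_1=\{g\in SO_3: ge_1=e_1\}\cong SO_2$. The group $SU_3$ acts transitively on $FL_1$, and $K_1$ is the isotropy group of $(e_1,e_1\wedge e_2\wedge e_3)$, so that $FL_1\cong SU_3/K_1$ is a 6-symmetric space. 2. Let $f:M\to S^5$ be a smooth immersion, conformal for the Riemann surface structure of $M$ (an oriented immersed surface always carries the one induced by $f$), such that the cone $(r,p)\mapsto r f(p)$, $r>0$, is special Lagrangian, and let $\gamma_M$ be the Gauss map of $f$, so that $f\wedge\gamma_M=f\wedge f_x\wedge f_y$ for local coordinates $z=x+iy$. Then $\psi_1=(f,f\wedge\gamma_M)$ is a map into $FL_1$ which is primitive, and which is harmonic for every $SU_3$-invariant Riemannian metric on $FL_1$ given by an inner product on $\mathfrak p$ that is also $\hat\sigma$-invariant (for instance the one induced by $-\mathrm{tr}(XY)$). 3. Conversely, let $\psi:M\to FL_1$ be any primitive map and let $f=\pi_1\circ\psi:M\to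 S^5$. Then $f$ is smooth, weakly conformal, Legendrian (the contact form of $S^5$ vanishes on the image of $df$) and harmonic as a map into $S^5$. At every point where $df\neq0$, $f$ is an immersion with vanishing mean curvature in $S^5$, and the cone $(r,p)\mapsto rf(p)$, $r>0$, is immersed and special Lagrangian with Gauss map $\pi_2\circ\psi$. Moreover, either $f$ is constant, or the set of points where $df=0$ has no accumulation point in $M$; away from this set $f$ is thus a minimal Legendrian immersion, and $\pi_2\circ\psi$ is the Gauss map of the immersed special Lagrangian cone over it. -/

import Mathlib

open Matrix
open scoped ContDiff

attribute [local instance] Matrix.linftyOpNormedRing Matrix.linftyOpNormedAlgebra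

noncomputable section

namespace SLCone

/-! ### Oriented real 3-planes, special Lagrangian planes, the flag space -/

/-- Complex 3-space with its standard Hermitian norm. -/
abbrev C3 : Type := EuclideanSpace ℂ (Fin 3)

/-- Complex 3 by 3 matrices. -/
abbrev Mat : Type := Matrix (Fin 3) (Fin 3) ℂ

/-- The group `SU_3`. -/
abbrev SU3 : Type := Matrix.specialUnitaryGroup (Fin 3) ℂ

/-- Two real-independent triples in `ℂ³` are equivalent if they differ by a real matrix of
positive determinant, that is, if they are oriented bases of the same oriented real 3-plane. -/
instance frameSetoid : Setoid {v : Fin 3 → C3 // LinearIndependent ℝ v} where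
  r v w := ∃ A : Matrix (Fin 3) (Fin 3) ℝ, 0 < A.det ∧ ∀ j, w.1 j = ∑ i, A i j • v.1 i
  iseqv := by
    refine ⟨fun v => ⟨1, by simp, fun j => ?_⟩, ?_, ?_⟩
    · simp [Matrix.one_apply, ite_smul]
    · rintro v w ⟨A, hA, h⟩
      refine ⟨A⁻¹, ?_, fun j => ?_⟩
      · rw [Matrix.det_nonsing_inv, Ring.inverse_eq_inv']
        exact inv_pos.2 hA
      · have hu : IsUnit A.det := (ne_of_gt hA).isUnit
        simp_rw [h, Finset.smul_sum, smul_smul]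
        rw [Finset.sum_comm]
        simp_rw [← Finset.sum_smul]
        have : ∀ i, ∑ k, A⁻¹ k j * A i k = (1 : Matrix (Fin 3) (Fin 3) ℝ) i j := by
          intro i
          rw [← Matrix.mul_nonsing_inv A hu, Matrix.mul_apply]
          exact Finset.sum_congr rfl fun k _ => mul_comm _ _
        simp [this, Matrix.one_apply, ite_smul]
    · rintro u v w ⟨A, hA, h⟩ ⟨B, hB, h2⟩
      refine ⟨A * B, by rw [Matrix.det_mul]; positivity, fun j => ?_⟩
      simp_rw [h2, h, Finset.smul_sum, smul_smul]
      rw [Finset.sum_comm]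
      simp_rw [← Finset.sum_smul, Matrix.mul_apply]
      refine Finset.sum_congr rfl fun i _ => ?_
      congr 1
      exact Finset.sum_congr rfl fun k _ => mul_comm _ _

/-- Oriented real 3-planes in `ℂ³`. -/
def OrientedPlane : Type := Quotient frameSetoid

/-- `V.IsWedge v` means `V = v₀ ∧ v₁ ∧ v₂`: the triple is real-linearly independent and is an
oriented basis of `V`. -/
def OrientedPlane.IsWedge (V : OrientedPlane) (v : Fin 3 → C3) : Prop :=
  ∃ h : LinearIndependent ℝ v, V = Quotient.mk frameSetoid ⟨v, h⟩

/-- The vector `x` lies in the plane `V`. -/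
def OrientedPlane.Contains (V : OrientedPlane) (x : C3) : Prop :=
  ∃ v, V.IsWedge v ∧ x ∈ Submodule.span ℝ (Set.range v)

/-- The `j`-th column `g e_j` of a matrix. -/
def col (g : Mat) (j : Fin 3) : C3 := WithLp.toLp 2 fun i => g i j

/-- The special Lagrangian planes: the `SU_3`-orbit of `e₁ ∧ e₂ ∧ e₃`. -/
def SL : Set OrientedPlane := {V | ∃ g : SU3, V.IsWedge (col g)}

/-- The flag space of pairs `(v, V)` with `v` in `S⁵`, `V` special Lagrangian and `v ∈ V`. -/
def FL1 : Type := {q : C3 × OrientedPlane // ‖q.1‖ = 1 ∧ q.2 ∈ SL ∧ q.2.Contains q.1}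

/-- The projection of `FL1` to `S⁵ ⊂ ℂ³`. -/
def FL1.toSphere (q : FL1) : C3 := q.1.1

/-- The projection of `FL1` to the oriented 3-planes, with values in `SL`. -/
def FL1.toPlane (q : FL1) : OrientedPlane := q.1.2

theorem SU3.star_mul (g : SU3) : (star (g : Mat)) * (g : Mat) = 1 :=
  (Matrix.mem_unitaryGroup_iff'.1 (Matrix.mem_specialUnitaryGroup_iff.1 g.2).1)

theorem SU3.inv_coe (g : SU3) : ((g⁻¹ : SU3) : Mat) = star (g : Mat) := rfl

theorem SU3.inv_mul (g : SU3) : ((g⁻¹ : SU3) : Mat) * (g : Mat) = 1 := SU3.star_mul g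

theorem SU3.mul_inv (g : SU3) : (g : Mat) * ((g⁻¹ : SU3) : Mat) = 1 :=
  mul_eq_one_comm.1 (SU3.inv_mul g)

theorem col_linearIndependent (g : SU3) : LinearIndependent ℝ (col g) := by
  rw [Fintype.linearIndependent_iff]
  intro c hc
  have h1 : (g : Mat) *ᵥ (fun j => (c j : ℂ)) = 0 := by
    ext i
    have := congrArg (fun x : C3 => x i) hc
    simpa [col, Matrix.mulVec, dotProduct, mul_comm] using this
  have h2 : (fun j => (c j : ℂ)) = 0 := by
    have := congrArg (fun x => star (g : Mat) *ᵥ x) h1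
    simpa [Matrix.mulVec_mulVec, SU3.star_mul g] using this
  intro i
  have h3 : (c i : ℂ) = 0 := congrFun h2 i
  exact_mod_cast h3

theorem norm_col (g : SU3) (j : Fin 3) : ‖col g j‖ = 1 := by
  have h := congrFun (congrFun (SU3.star_mul g) j) j
  rw [Matrix.mul_apply] at h
  have h2 : (‖col g j‖ ^ 2 : ℝ) = 1 := by
    rw [EuclideanSpace.norm_sq_eq]
    have : ((∑ i, ‖(col g j) i‖ ^ 2 : ℝ) : ℂ) = 1 := by
      push_cast
      rw [Matrix.one_apply_eq] at h
      rw [← h]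
      refine Finset.sum_congr rfl fun i _ => ?_
      rw [Matrix.star_apply, ← Complex.conj_mul']
      rfl
    exact_mod_cast this
  nlinarith [norm_nonneg (col g j)]

/-- The orbit map `g ↦ (g e₁, g (e₁ ∧ e₂ ∧ e₃))` from `SU_3` to `FL1`. -/
def orbit (g : SU3) : FL1 :=
  ⟨(col g 0, Quotient.mk frameSetoid ⟨col g, col_linearIndependent g⟩), norm_col g 0,
    ⟨g, col_linearIndependent g, rfl⟩,
    ⟨col g, ⟨col_linearIndependent g, rfl⟩, Submodule.subset_span ⟨0, rfl⟩⟩⟩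

/-! ### The 6-symmetric structure -/

/-- The isotropy group: real matrices in `SU_3` fixing `e₁`. -/
def K1 : Set SU3 := {g | (∀ i j, ((g : Mat) i j).im = 0) ∧ col g 0 = EuclideanSpace.single 0 1}

/-- The rotation about the `e₁` axis through the angle `π / 3`, as a matrix. -/
def rotMat : Mat :=
  !![1, 0, 0;
     0, (Real.cos (Real.pi / 3) : ℂ), -(Real.sin (Real.pi / 3) : ℂ);
     0, (Real.sin (Real.pi / 3) : ℂ), (Real.cos (Real.pi / 3) : ℂ)]

theorem rotMat_mem : rotMat ∈ Matrix.specialUnitaryGroup (Fin 3) ℂ := by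
  have h : (Real.cos (Real.pi / 3) : ℂ) ^ 2 + (Real.sin (Real.pi / 3) : ℂ) ^ 2 = 1 := by
    exact_mod_cast Real.cos_sq_add_sin_sq _
  rw [Matrix.mem_specialUnitaryGroup_iff, Matrix.mem_unitaryGroup_iff]
  constructor
  · ext i j
    fin_cases i <;> fin_cases j <;>
      simp [rotMat, Matrix.mul_apply, Fin.sum_univ_three, Matrix.star_apply, -Complex.ofReal_cos,
        -Complex.ofReal_sin, -Real.cos_pi_div_three, -Real.sin_pi_div_three] <;>
      first | linear_combination h | ring
  · simp [rotMat, Matrix.det_fin_three, -Complex.ofReal_cos,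
        -Complex.ofReal_sin, -Real.cos_pi_div_three, -Real.sin_pi_div_three]
    linear_combination h

/-- The rotation `R`, as an element of `SU_3`. -/
def R : SU3 := ⟨rotMat, rotMat_mem⟩

/-- The automorphism `g ↦ (g⁻¹)ᵗ` of `SU_3`. -/
def contragredient : MulAut SU3 where
  toFun g := ⟨((g⁻¹ : SU3) : Mat)ᵀ, by
    have h := Matrix.mem_specialUnitaryGroup_iff.1 (g⁻¹ : SU3).2
    rw [Matrix.mem_specialUnitaryGroup_iff, Matrix.det_transpose]
    exact ⟨Matrix.transpose_mem_unitaryGroup_iff.2 h.1, h.2⟩⟩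
  invFun g := ⟨((g⁻¹ : SU3) : Mat)ᵀ, by
    have h := Matrix.mem_specialUnitaryGroup_iff.1 (g⁻¹ : SU3).2
    rw [Matrix.mem_specialUnitaryGroup_iff, Matrix.det_transpose]
    exact ⟨Matrix.transpose_mem_unitaryGroup_iff.2 h.1, h.2⟩⟩
  left_inv g := by
    ext i j
    simp [SU3.inv_coe]
  right_inv g := by
    ext i j
    simp [SU3.inv_coe]
  map_mul' g h := by
    apply Subtype.ext
    change (star ((g : Mat) * (h : Mat)))ᵀ = (star (g : Mat))ᵀ * (star (h : Mat))ᵀ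
    rw [StarMul.star_mul, Matrix.transpose_mul]

/-- The automorphism `σ̂(g) = R (g⁻¹)ᵗ R⁻¹` of `SU_3`. -/
def sigmaHat : MulAut SU3 := MulAut.conj R * contragredient

/-- The complex-linear automorphism `X ↦ - R Xᵗ R⁻¹` which `σ̂` induces on the complexified Lie
algebra `sl_3(ℂ)`. -/
def sigmaLie : Mat →ₗ[ℂ] Mat where
  toFun X := -((R : Mat) * Xᵀ * ((R⁻¹ : SU3) : Mat))
  map_add' X Y := by
    simp only [Matrix.transpose_add, Matrix.mul_add, Matrix.add_mul, neg_add]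
  map_smul' c X := by
    simp only [Matrix.transpose_smul, Matrix.mul_smul, Matrix.smul_mul, RingHom.id_apply, smul_neg]

/-- The eigenspace `ĝ_j` of `σ̂` in `sl_3(ℂ)`, for the eigenvalue `exp(iπ/3)^j`. -/
def gHat (j : ℕ) : Submodule ℂ Mat where
  carrier := {X | X.trace = 0 ∧
    sigmaLie X = Complex.exp (Complex.I * (Real.pi / 3 : ℝ)) ^ j • X}
  add_mem' := by
    rintro X Y ⟨h1, h2⟩ ⟨h3, h4⟩
    exact ⟨by rw [Matrix.trace_add, h1, h3, add_zero], by rw [map_add, h2, h4, smul_add]⟩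
  zero_mem' := ⟨by simp, by simp⟩
  smul_mem' := by
    rintro c X ⟨h1, h2⟩
    exact ⟨by rw [Matrix.trace_smul, h1, smul_zero], by rw [map_smul, h2, smul_comm]⟩

/-- The projection of `sl_3(ℂ)` onto the sum of the `ĝ_j`, `j ≠ 0`, along `ĝ_0`. -/
def projP (X : Mat) : Mat := X - (1 / 6 : ℂ) • ∑ k ∈ Finset.range 6, (sigmaLie ^ k) X

/-- The reductive complement `𝔭` of the isotropy algebra in `su_3`. -/
def pHat : Set Mat := {X | star X = -X ∧ X.trace = 0 ∧ projP X = X}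

/-- The adjoint action `X ↦ g X g⁻¹`. -/
def Ad (g : SU3) (X : Mat) : Mat := (g : Mat) * X * ((g⁻¹ : SU3) : Mat)

/-! ### Smooth maps into the flag space and their differentials -/

section Smooth

variable {E : Type*} [NormedAddCommGroup E] [NormedSpace ℝ E]

/-- `F` is a smooth frame of `u` around `x`: a smooth map to `SU_3` with `u = F · (e₁, e₁∧e₂∧e₃)`
near `x`. -/
def IsFrameAt (u : E → FL1) (F : E → SU3) (x : E) : Prop :=
  ∃ U : Set E, IsOpen U ∧ x ∈ U ∧ ContDiffOn ℝ ∞ (fun y => (F y : Mat)) U ∧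
    ∀ y ∈ U, orbit (F y) = u y

/-- Smoothness on an open set of a map into `FL1 ≅ SU_3 / K_1`: smooth local frames exist. -/
def SmoothOn (u : E → FL1) (s : Set E) : Prop := ∀ x ∈ s, ∃ F, IsFrameAt u F x

/-- The `𝔭`-component of the left-invariant form `F⁻¹ dF`. -/
def frameForm (F : E → SU3) (x X : E) : Mat :=
  projP ((((F x)⁻¹ : SU3) : Mat) * fderiv ℝ (fun y => (F y : Mat)) x X)

open Classical in
/-- The differential of a smooth map `u` into `FL1`. The tangent space at `q = g K_1` is
identified with `[𝔭]_q = Ad g · 𝔭` by `ξ ↦ d/dt (exp(tξ) · q)`, so that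
`du(X) = Ad F · (F⁻¹ dF(X))_𝔭` for any smooth frame `F` of `u`; by `differential_eq` the choice
of the frame does not matter. -/
def differential (u : E → FL1) (x X : E) : Mat :=
  if h : ∃ F, IsFrameAt u F x then Ad (h.choose x) (frameForm h.choose x X) else 0

end Smooth

/-! ### The definitions do not depend on the frames -/

theorem projP_fixed {Z : Mat} (h : sigmaLie Z = Z) : projP Z = 0 := by
  have hk : ∀ k : ℕ, (sigmaLie ^ k) Z = Z := by
    intro k
    induction k with
    | zero => simp
    | succ n ih => rw [pow_succ, Module.End.mul_apply, h, ih]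
  simp only [projP, hk, Finset.sum_const, Finset.card_range]
  module

/-- Elements of `K_1` satisfy `k R kᵗ = R`. -/
theorem K1.mul_R {k : SU3} (hk : k ∈ K1) : (k : Mat) * (R : Mat) * (k : Mat)ᵀ = (R : Mat) := by
  obtain ⟨hre, he⟩ := hk
  have hstar : star (k : Mat) = (k : Mat)ᵀ := by
    ext i j
    rw [Matrix.star_apply, Matrix.transpose_apply]
    exact Complex.conj_eq_iff_im.2 (hre j i)
  have hu := SU3.star_mul k
  have hu' : (k : Mat) * (k : Mat)ᵀ = 1 := by
    rw [← hstar]; exact SU3.mul_inv k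
  rw [hstar] at hu
  have hd := (Matrix.mem_specialUnitaryGroup_iff.1 k.2).2
  have c : ∀ i, (k : Mat) i 0 = (EuclideanSpace.single 0 1 : C3) i := fun i =>
    congrArg (fun x : C3 => x i) he
  have c0 := c 0
  have c1 := c 1
  have c2 := c 2
  simp at c0 c1 c2
  generalize (k : Mat) = m at *
  have e := fun i j => congrFun (congrFun hu i) j
  have e' := fun i j => congrFun (congrFun hu' i) j
  have e01 := e 0 1
  have e02 := e 0 2
  have e11 := e' 1 1
  have e22 := e' 2 2
  have e12 := e' 1 2
  simp [Matrix.mul_apply, Fin.sum_univ_three, c0, c1, c2] at e01 e02 e11 e22 e12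
  simp [Matrix.det_fin_three, c0, c1, c2] at hd
  have a : m 1 1 = m 2 2 := by
    linear_combination (-m 1 1) * e22 + m 2 1 * e12 + m 2 2 * hd
  have b : m 1 2 = -m 2 1 := by
    linear_combination (-m 1 2) * e22 + m 2 2 * e12 - m 2 1 * hd
  change m * rotMat * mᵀ = rotMat
  ext i j
  fin_cases i <;> fin_cases j <;>
    simp [rotMat, Matrix.mul_apply, Fin.sum_univ_three, c0, c1, c2, e01, e02, a, b,
      -Complex.ofReal_cos, -Complex.ofReal_sin, -Real.cos_pi_div_three,
      -Real.sin_pi_div_three] <;>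
    first
      | linear_combination (Real.cos (Real.pi / 3) : ℂ) * e22
      | linear_combination (Real.sin (Real.pi / 3) : ℂ) * e22
      | linear_combination (-(Real.sin (Real.pi / 3) : ℂ)) * e22

theorem K1.R_mul_transpose {k : SU3} (hk : k ∈ K1) :
    (R : Mat) * (k : Mat)ᵀ = ((k⁻¹ : SU3) : Mat) * (R : Mat) := by
  have h := congrArg (fun X => ((k⁻¹ : SU3) : Mat) * X) (K1.mul_R hk)
  simpa only [← Matrix.mul_assoc, SU3.inv_mul, Matrix.one_mul] using h

theorem K1.transpose_mul_R {k : SU3} (hk : k ∈ K1) :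
    ((k⁻¹ : SU3) : Mat)ᵀ * ((R⁻¹ : SU3) : Mat) = ((R⁻¹ : SU3) : Mat) * (k : Mat) := by
  have h1 : (k : Mat)ᵀ * ((k⁻¹ : SU3) : Mat)ᵀ = 1 := by
    rw [← Matrix.transpose_mul, SU3.inv_mul, Matrix.transpose_one]
  have h2 : ((R⁻¹ : SU3) : Mat) * (k : Mat) * ((R : Mat) * (k : Mat)ᵀ) = 1 := by
    rw [K1.R_mul_transpose hk]
    calc ((R⁻¹ : SU3) : Mat) * (k : Mat) * (((k⁻¹ : SU3) : Mat) * (R : Mat))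
        = ((R⁻¹ : SU3) : Mat) * ((k : Mat) * ((k⁻¹ : SU3) : Mat)) * (R : Mat) := by
          simp only [Matrix.mul_assoc]
      _ = 1 := by rw [SU3.mul_inv, Matrix.mul_one, SU3.inv_mul]
  calc ((k⁻¹ : SU3) : Mat)ᵀ * ((R⁻¹ : SU3) : Mat)
      = (((R⁻¹ : SU3) : Mat) * (k : Mat) * ((R : Mat) * (k : Mat)ᵀ)) *
          ((k⁻¹ : SU3) : Mat)ᵀ * ((R⁻¹ : SU3) : Mat) := by rw [h2, Matrix.one_mul]
    _ = ((R⁻¹ : SU3) : Mat) * (k : Mat) * ((R : Mat) * ((k : Mat)ᵀ * ((k⁻¹ : SU3) : Mat)ᵀ) *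
          ((R⁻¹ : SU3) : Mat)) := by simp only [Matrix.mul_assoc]
    _ = ((R⁻¹ : SU3) : Mat) * (k : Mat) := by
          rw [h1, Matrix.mul_one, SU3.mul_inv, Matrix.mul_one]

theorem K1.inv_mem {k : SU3} (hk : k ∈ K1) : k⁻¹ ∈ K1 := by
  obtain ⟨hre, he⟩ := hk
  have c : ∀ i, (k : Mat) i 0 = (EuclideanSpace.single 0 1 : C3) i := fun i =>
    congrArg (fun x : C3 => x i) he
  refine ⟨fun i j => ?_, ?_⟩
  · rw [SU3.inv_coe, Matrix.star_apply]
    simp [hre]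
  · have h : ((k⁻¹ : SU3) : Mat) *ᵥ (fun i => (k : Mat) i 0) = fun i => (1 : Mat) i 0 := by
      rw [← SU3.inv_mul k]
      rfl
    have h0 : (fun i => (k : Mat) i 0) = Pi.single 0 1 := by
      funext i
      rw [c i]
      fin_cases i <;> simp
    rw [h0, Matrix.mulVec_single_one] at h
    ext i
    have := congrFun h i
    change ((k⁻¹ : SU3) : Mat) i 0 = _
    refine this.trans ?_
    fin_cases i <;> simp [Matrix.one_apply]

theorem sigmaLie_Ad {k : SU3} (hk : k ∈ K1) (X : Mat) :
    sigmaLie (Ad k X) = Ad k (sigmaLie X) := by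
  have h1 := K1.R_mul_transpose (K1.inv_mem hk)
  have h2 := K1.transpose_mul_R (K1.inv_mem hk)
  rw [inv_inv] at h1 h2
  change -((R : Mat) * ((k : Mat) * X * ((k⁻¹ : SU3) : Mat))ᵀ * ((R⁻¹ : SU3) : Mat)) =
    (k : Mat) * (-((R : Mat) * Xᵀ * ((R⁻¹ : SU3) : Mat))) * ((k⁻¹ : SU3) : Mat)
  rw [Matrix.transpose_mul, Matrix.transpose_mul, Matrix.mul_neg, Matrix.neg_mul]
  congr 1
  calc (R : Mat) * (((k⁻¹ : SU3) : Mat)ᵀ * (Xᵀ * (k : Mat)ᵀ)) * ((R⁻¹ : SU3) : Mat)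
      = ((R : Mat) * ((k⁻¹ : SU3) : Mat)ᵀ) * Xᵀ * ((k : Mat)ᵀ * ((R⁻¹ : SU3) : Mat)) := by
        simp only [Matrix.mul_assoc]
    _ = _ := by rw [h1, h2]; simp only [Matrix.mul_assoc]

theorem Ad_mul (g h : SU3) (X : Mat) : Ad (g * h) X = Ad g (Ad h X) := by
  have h1 : (((g * h)⁻¹ : SU3) : Mat) = ((h⁻¹ : SU3) : Mat) * ((g⁻¹ : SU3) : Mat) := by
    rw [_root_.mul_inv_rev]
    rfl
  simp only [Ad, h1, Submonoid.coe_mul, Matrix.mul_assoc]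

theorem projP_Ad {k : SU3} (hk : k ∈ K1) (X : Mat) : projP (Ad k X) = Ad k (projP X) := by
  have hp : ∀ n : ℕ, (sigmaLie ^ n) (Ad k X) = Ad k ((sigmaLie ^ n) X) := by
    intro n
    induction n with
    | zero => simp
    | succ n ih => rw [pow_succ', Module.End.mul_apply, ih, sigmaLie_Ad hk, Module.End.mul_apply]
  simp only [projP, hp]
  simp only [Ad, Matrix.mul_sub, Matrix.sub_mul, Matrix.mul_smul, Matrix.smul_mul,
    Matrix.mul_sum, Matrix.sum_mul]

theorem projP_sub (X Y : Mat) : projP (X - Y) = projP X - projP Y := by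
  simp only [projP, map_sub, Finset.sum_sub_distrib, smul_sub]
  abel

theorem sigmaLie_fixed {Z : Mat} (h : Z * (R : Mat) + (R : Mat) * Zᵀ = 0) : sigmaLie Z = Z := by
  change -((R : Mat) * Zᵀ * ((R⁻¹ : SU3) : Mat)) = Z
  rw [eq_neg_of_add_eq_zero_right h, Matrix.neg_mul, neg_neg, Matrix.mul_assoc, SU3.mul_inv,
    Matrix.mul_one]

theorem orbit_eq {g h : SU3} (e : orbit g = orbit h) : g⁻¹ * h ∈ K1 := by
  have e1 : col g 0 = col h 0 := congrArg (fun q : FL1 => q.1.1) e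
  have e2 := Quotient.exact (congrArg (fun q : FL1 => q.1.2) e)
  obtain ⟨A, -, hA⟩ := e2
  have h3 : (h : Mat) = (g : Mat) * A.map (fun x : ℝ => (x : ℂ)) := by
    ext i j
    have := congrArg (fun x : C3 => x i) (hA j)
    simpa [col, Matrix.mul_apply, mul_comm] using this
  have h4 : ((g⁻¹ * h : SU3) : Mat) = A.map (fun x : ℝ => (x : ℂ)) := by
    change ((g⁻¹ : SU3) : Mat) * (h : Mat) = _
    rw [h3, ← Matrix.mul_assoc, SU3.inv_mul, Matrix.one_mul]
  refine ⟨fun i j => by rw [h4]; simp, ?_⟩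
  ext i
  have h5 : ((g⁻¹ * h : SU3) : Mat) i 0 = (1 : Mat) i 0 := by
    rw [← SU3.inv_mul g]
    change (((g⁻¹ : SU3) : Mat) * (h : Mat)) i 0 = _
    rw [Matrix.mul_apply, Matrix.mul_apply]
    refine Finset.sum_congr rfl fun l _ => ?_
    congr 1
    exact congrArg (fun x : C3 => x l) e1.symm
  change ((g⁻¹ * h : SU3) : Mat) i 0 = _
  rw [h5]
  simp [Matrix.one_apply]

section WellDefined

variable {E : Type*} [NormedAddCommGroup E] [NormedSpace ℝ E]

theorem frame_independent {u : E → FL1} {F G : E → SU3} {x : E} (hF : IsFrameAt u F x)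
    (hG : IsFrameAt u G x) (X : E) :
    Ad (F x) (frameForm F x X) = Ad (G x) (frameForm G x X) := by
  obtain ⟨U, hU, hxU, hFs, hFo⟩ := hF
  obtain ⟨W, hW, hxW, hGs, hGo⟩ := hG
  have hFd : HasFDerivAt (fun y => (F y : Mat)) (fderiv ℝ (fun y => (F y : Mat)) x) x :=
    ((hFs.contDiffAt (hU.mem_nhds hxU)).differentiableAt (by simp)).hasFDerivAt
  have hGd : HasFDerivAt (fun y => (G y : Mat)) (fderiv ℝ (fun y => (G y : Mat)) x) x :=
    ((hGs.contDiffAt (hW.mem_nhds hxW)).differentiableAt (by simp)).hasFDerivAt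
  set dF := fderiv ℝ (fun y => (F y : Mat)) x with hdF
  set dG := fderiv ℝ (fun y => (G y : Mat)) x with hdG
  have hk : ∀ y ∈ U ∩ W, (F y)⁻¹ * G y ∈ K1 := fun y hy =>
    orbit_eq ((hFo y hy.1).trans (hGo y hy.2).symm)
  have hk0 := hk x ⟨hxU, hxW⟩
  set k : SU3 := (F x)⁻¹ * G x with hkdef
  have hGx : G x = F x * k := by rw [hkdef, mul_inv_cancel_left]
  -- the relation satisfied by the frames, in a form without inverses
  have hrel : ∀ y ∈ U ∩ W, (G y : Mat) * (R : Mat) * (G y : Mat)ᵀ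
      = (F y : Mat) * (R : Mat) * (F y : Mat)ᵀ := by
    intro y hy
    have h1 := K1.mul_R (hk y hy)
    have h2 : (G y : Mat) = (F y : Mat) * (((F y)⁻¹ * G y : SU3) : Mat) := by
      rw [← Submonoid.coe_mul, mul_inv_cancel_left]
    rw [h2, Matrix.transpose_mul]
    calc (F y : Mat) * (((F y)⁻¹ * G y : SU3) : Mat) * (R : Mat) *
          ((((F y)⁻¹ * G y : SU3) : Mat)ᵀ * (F y : Mat)ᵀ)
        = (F y : Mat) * ((((F y)⁻¹ * G y : SU3) : Mat) * (R : Mat) *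
          (((F y)⁻¹ * G y : SU3) : Mat)ᵀ) * (F y : Mat)ᵀ := by simp only [Matrix.mul_assoc]
      _ = _ := by rw [h1]
  let T : Mat →L[ℝ] Mat := (Matrix.transposeLinearEquiv (Fin 3) (Fin 3) ℝ ℂ).toLinearMap.toContinuousLinearMap
  have hFT : HasFDerivAt (fun y => (F y : Mat)ᵀ) (T.comp dF) x := T.hasFDerivAt.comp x hFd
  have hGT : HasFDerivAt (fun y => (G y : Mat)ᵀ) (T.comp dG) x := T.hasFDerivAt.comp x hGd
  have h1 := (hFd.mul_const' (R : Mat)).mul' hFT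
  have h2 := (hGd.mul_const' (R : Mat)).mul' hGT
  have hev : (fun y => (F y : Mat) * (R : Mat) * (F y : Mat)ᵀ) =ᶠ[nhds x]
      fun y => (G y : Mat) * (R : Mat) * (G y : Mat)ᵀ := by
    filter_upwards [(hU.inter hW).mem_nhds ⟨hxU, hxW⟩] with y hy using (hrel y hy).symm
  have h3 := DFunLike.congr_fun (h1.unique (h2.congr_of_eventuallyEq hev)) X
  have h4 : (F x : Mat) * (R : Mat) * (dF X)ᵀ + dF X * (R : Mat) * (F x : Mat)ᵀ =
      (G x : Mat) * (R : Mat) * (dG X)ᵀ + dG X * (R : Mat) * (G x : Mat)ᵀ := h3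
  have hR1 := K1.R_mul_transpose hk0
  have hR2 := K1.R_mul_transpose (K1.inv_mem hk0)
  rw [inv_inv] at hR2
  set Fi : Mat := (((F x)⁻¹ : SU3) : Mat) with hFi
  have hFF : Fi * (F x : Mat) = 1 := SU3.inv_mul _
  have hFT' : (F x : Mat)ᵀ * Fiᵀ = 1 := by
    rw [← Matrix.transpose_mul, hFF, Matrix.transpose_one]
  have hGF : Fi * (G x : Mat) = (k : Mat) := rfl
  have hGT' : (G x : Mat)ᵀ * Fiᵀ = (k : Mat)ᵀ := by
    rw [← Matrix.transpose_mul, hGF]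
  have h5 : (R : Mat) * (Fi * dF X)ᵀ + Fi * dF X * (R : Mat) =
      (k : Mat) * (R : Mat) * (Fi * dG X)ᵀ + Fi * dG X * (R : Mat) * (k : Mat)ᵀ := by
    have h6 := congrArg (fun Y => Fi * Y * Fiᵀ) h4
    simp only [Matrix.mul_add, Matrix.add_mul] at h6
    calc (R : Mat) * (Fi * dF X)ᵀ + Fi * dF X * (R : Mat)
        = (Fi * (F x : Mat)) * (R : Mat) * ((dF X)ᵀ * Fiᵀ) +
          Fi * dF X * (R : Mat) * ((F x : Mat)ᵀ * Fiᵀ) := by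
            rw [hFF, hFT', Matrix.transpose_mul, Matrix.one_mul, Matrix.mul_one]
      _ = (Fi * (G x : Mat)) * (R : Mat) * ((dG X)ᵀ * Fiᵀ) +
          Fi * dG X * (R : Mat) * ((G x : Mat)ᵀ * Fiᵀ) := by
            simpa only [Matrix.mul_assoc] using h6
      _ = _ := by rw [hGF, hGT', Matrix.transpose_mul]
  have hZ : sigmaLie (Fi * dF X - Fi * dG X * ((k⁻¹ : SU3) : Mat)) =
      Fi * dF X - Fi * dG X * ((k⁻¹ : SU3) : Mat) := by
    apply sigmaLie_fixed
    have e1 : Fi * dG X * ((k⁻¹ : SU3) : Mat) * (R : Mat) = Fi * dG X * (R : Mat) * (k : Mat)ᵀ := by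
      rw [Matrix.mul_assoc, ← hR1, Matrix.mul_assoc (Fi * dG X)]
    have e2 : (R : Mat) * (Fi * dG X * ((k⁻¹ : SU3) : Mat))ᵀ =
        (k : Mat) * (R : Mat) * (Fi * dG X)ᵀ := by
      rw [Matrix.transpose_mul, ← Matrix.mul_assoc, hR2]
    rw [Matrix.transpose_sub, Matrix.mul_sub, Matrix.sub_mul, e1, e2,
      sub_add_sub_comm, add_comm (Fi * dF X * (R : Mat)), h5,
      add_comm (Fi * dG X * (R : Mat) * (k : Mat)ᵀ), sub_self]
  have hP := projP_fixed hZ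
  rw [projP_sub, sub_eq_zero] at hP
  have hAd : Fi * dG X * ((k⁻¹ : SU3) : Mat) = Ad k ((((G x)⁻¹ : SU3) : Mat) * dG X) := by
    have e3 : (k : Mat) * (((G x)⁻¹ : SU3) : Mat) = Fi := by
      rw [← hGF, Matrix.mul_assoc, SU3.mul_inv, Matrix.mul_one]
    simp only [Ad, ← Matrix.mul_assoc, e3]
  rw [hAd, projP_Ad hk0] at hP
  change Ad (F x) (projP (Fi * dF X)) = Ad (G x) (projP ((((G x)⁻¹ : SU3) : Mat) * dG X))
  rw [hP, ← Ad_mul, ← hGx]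

theorem differential_eq {u : E → FL1} {F : E → SU3} {x : E} (hF : IsFrameAt u F x) (X : E) :
    differential u x X = Ad (F x) (frameForm F x X) := by
  have h : ∃ F, IsFrameAt u F x := ⟨F, hF⟩
  rw [differential, dif_pos h]
  exact frame_independent h.choose_spec hF X

end WellDefined

/-! ### The eigenbundles and the invariant metrics -/

/-- The fibre `[ĝ_j]_q = Ad g · ĝ_j`, `q = g K_1`, of the complexified tangent bundle. -/
def gBundle (j : ℕ) (q : FL1) : Set Mat := {ξ | ∃ g : SU3, orbit g = q ∧ ∃ Y ∈ gHat j, ξ = Ad g Y}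

/-- An inner product on `𝔭` which is invariant under `Ad K_1`, thus an `SU_3`-invariant Riemannian
metric on `FL1`, and which is moreover invariant under `σ̂`, so that the real parts of the
eigenbundles are mutually orthogonal. Only the values of `form` on `𝔭` matter. -/
structure InvariantMetric where
  form : Mat →ₗ[ℝ] Mat →ₗ[ℝ] ℝ
  symm : ∀ X ∈ pHat, ∀ Y ∈ pHat, form X Y = form Y X
  pos : ∀ X ∈ pHat, X ≠ 0 → 0 < form X X
  ad_invariant : ∀ k ∈ K1, ∀ X ∈ pHat, ∀ Y ∈ pHat, form (Ad k X) (Ad k Y) = form X Y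
  sigma_invariant : ∀ X ∈ pHat, ∀ Y ∈ pHat, form (sigmaLie X) (sigmaLie Y) = form X Y

/-- The metric at `q = g K_1`: transport of tangent vectors in `Ad g · 𝔭` to `𝔭`. -/
def InvariantMetric.inner (B : InvariantMetric) (q : FL1) (ξ η : Mat) : ℝ :=
  B.form (Ad (Function.invFun orbit q)⁻¹ ξ) (Ad (Function.invFun orbit q)⁻¹ η)

theorem InvariantMetric.inner_eq (B : InvariantMetric) (g : SU3) {X Y : Mat} (hX : X ∈ pHat)
    (hY : Y ∈ pHat) : B.inner (orbit g) (Ad g X) (Ad g Y) = B.form X Y := by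
  have h1 : orbit (Function.invFun orbit (orbit g)) = orbit g := Function.invFun_eq ⟨g, rfl⟩
  have h2 := orbit_eq h1
  rw [InvariantMetric.inner, ← Ad_mul, ← Ad_mul]
  exact B.ad_invariant _ h2 X hX Y hY

/-- The standard example: the metric induced by the bi-invariant metric `- tr (X Y)`. -/
def normalMetric : InvariantMetric where
  form := LinearMap.mk₂ ℝ (fun X Y : Mat => -(Matrix.trace (X * Y)).re)
    (by intro X Y Z; simp [Matrix.add_mul]; ring)
    (by intro c X Y; simp)
    (by intro X Y Z; simp [Matrix.mul_add]; ring)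
    (by intro c X Y; simp)
  symm X _ Y _ := by
    simp only [LinearMap.mk₂_apply]
    rw [Matrix.trace_mul_comm]
  pos X hX h0 := by
    have h1 : X = -star X := by rw [hX.1, neg_neg]
    simp only [LinearMap.mk₂_apply]
    have h2 : -(Matrix.trace (X * X)).re = ∑ i, ∑ j, ‖X i j‖ ^ 2 := by
      have : X * X = -(X * star X) := by rw [hX.1]; simp
      rw [this, Matrix.trace_neg, Complex.neg_re, neg_neg, Matrix.trace, Complex.re_sum]
      refine Finset.sum_congr rfl fun i _ => ?_
      rw [Matrix.diag_apply, Matrix.mul_apply, Complex.re_sum]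
      refine Finset.sum_congr rfl fun j _ => ?_
      rw [Matrix.star_apply, ← Complex.normSq_eq_norm_sq]
      change (X i j * (starRingEnd ℂ) (X i j)).re = _
      rw [Complex.mul_conj, Complex.ofReal_re]
    rw [h2]
    obtain ⟨i, j, hij⟩ : ∃ i j, X i j ≠ 0 := by
      by_contra! h
      exact h0 (Matrix.ext h)
    refine Finset.sum_pos' (fun _ _ => Finset.sum_nonneg fun _ _ => sq_nonneg _)
      ⟨i, Finset.mem_univ _, Finset.sum_pos' (fun _ _ => sq_nonneg _)
        ⟨j, Finset.mem_univ _, by positivity⟩⟩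
  ad_invariant k _ X _ Y _ := by
    simp only [LinearMap.mk₂_apply, Ad]
    have : (k : Mat) * X * ((k⁻¹ : SU3) : Mat) * ((k : Mat) * Y * ((k⁻¹ : SU3) : Mat)) =
        (k : Mat) * (X * Y) * ((k⁻¹ : SU3) : Mat) := by
      calc _ = (k : Mat) * X * (((k⁻¹ : SU3) : Mat) * (k : Mat)) * Y * ((k⁻¹ : SU3) : Mat) := by
            simp only [Matrix.mul_assoc]
        _ = _ := by rw [SU3.inv_mul, Matrix.mul_one]; simp only [Matrix.mul_assoc]
    rw [this, Matrix.trace_mul_comm, ← Matrix.mul_assoc, SU3.inv_mul, Matrix.one_mul]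
  sigma_invariant X _ Y _ := by
    simp only [LinearMap.mk₂_apply]
    have : sigmaLie X * sigmaLie Y = (R : Mat) * (Xᵀ * Yᵀ) * ((R⁻¹ : SU3) : Mat) := by
      change -((R : Mat) * Xᵀ * ((R⁻¹ : SU3) : Mat)) * -((R : Mat) * Yᵀ * ((R⁻¹ : SU3) : Mat)) = _
      rw [neg_mul_neg]
      calc _ = (R : Mat) * Xᵀ * (((R⁻¹ : SU3) : Mat) * (R : Mat)) * Yᵀ * ((R⁻¹ : SU3) : Mat) := by
            simp only [Matrix.mul_assoc]
        _ = _ := by rw [SU3.inv_mul, Matrix.mul_one]; simp only [Matrix.mul_assoc]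
    rw [this, Matrix.trace_mul_comm, ← Matrix.mul_assoc, SU3.inv_mul, Matrix.one_mul,
      ← Matrix.transpose_mul, Matrix.trace_transpose, Matrix.trace_mul_comm]

/-! ### Harmonic and primitive maps on plane domains -/

/-- The energy density of a map from a domain of `ℂ`, in the coordinate `x + iy`. -/
def energyDensity (B : InvariantMetric) (u : ℂ → FL1) (z : ℂ) : ℝ :=
  (B.inner (u z) (differential u z 1) (differential u z 1) +
    B.inner (u z) (differential u z Complex.I) (differential u z Complex.I)) / 2

/-- Harmonicity on an open set `Ω ⊂ ℂ`: the map is smooth and critical for the Dirichlet energy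
under all smooth variations with compact support in `Ω`. -/
def HarmonicOn (B : InvariantMetric) (u : ℂ → FL1) (Ω : Set ℂ) : Prop :=
  SmoothOn u Ω ∧
  ∀ (Ψ : ℝ → ℂ → FL1) (K : Set ℂ), IsCompact K → K ⊆ Ω →
    SmoothOn (fun p : ℝ × ℂ => Ψ p.1 p.2) (Set.univ ×ˢ Ω) →
    (∀ z ∈ Ω, Ψ 0 z = u z) → (∀ t, ∀ z ∈ Ω \ K, Ψ t z = u z) →
    HasDerivAt (fun t => ∫ z in K, energyDensity B (Ψ t) z) 0 0

/-- A primitive map on an open set `Ω ⊂ ℂ`: a smooth immersion whose `(1,0)`-differential, that is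
`du(∂/∂z) = (du(∂/∂x) - i du(∂/∂y)) / 2`, takes values in `[ĝ_1]`. -/
def PrimitiveOn (u : ℂ → FL1) (Ω : Set ℂ) : Prop :=
  SmoothOn u Ω ∧ ∀ z ∈ Ω, Function.Injective (differential u z) ∧
    (1 / 2 : ℂ) • (differential u z 1 - Complex.I • differential u z Complex.I) ∈ gBundle 1 (u z)

/-! ### Surfaces in the 5-sphere and their cones, in a coordinate `x + iy` -/

/-- The partial derivative `∂/∂x`. -/
def dx (f : ℂ → C3) (z : ℂ) : C3 := fderiv ℝ f z 1

/-- The partial derivative `∂/∂y`. -/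
def dy (f : ℂ → C3) (z : ℂ) : C3 := fderiv ℝ f z Complex.I

/-- The real inner product of `ℂ³`. -/
def rdot (v w : C3) : ℝ := (inner ℂ v w).re

/-- `f` is an immersion at `z`. -/
def ImmersionAt (f : ℂ → C3) (z : ℂ) : Prop := LinearIndependent ℝ ![dx f z, dy f z]

/-- `f` is weakly conformal at `z`: `df` is conformal or zero. -/
def WeaklyConformalAt (f : ℂ → C3) (z : ℂ) : Prop :=
  rdot (dx f z) (dx f z) = rdot (dy f z) (dy f z) ∧ rdot (dx f z) (dy f z) = 0

/-- The contact form `X ↦ Re ⟨i f, X⟩` of `S⁵` vanishes on the image of `df`. -/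
def LegendrianAt (f : ℂ → C3) (z : ℂ) : Prop :=
  rdot (Complex.I • f z) (dx f z) = 0 ∧ rdot (Complex.I • f z) (dy f z) = 0

/-- The tension field of the map `f` into `S⁵` vanishes at `z`: the Laplacian of `f` is normal
to the sphere. -/
def SphereHarmonicAt (f : ℂ → C3) (z : ℂ) : Prop :=
  dx (dx f) z + dy (dy f) z ∈ Submodule.span ℝ {f z}

/-- The mean curvature vector in `S⁵` of the immersion `f` vanishes at `z`: the trace
`g²² f_xx - 2 g¹² f_xy + g¹¹ f_yy` of the Hessian with respect to the induced metric (up to the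
factor `det g`) has no component orthogonal to the radial and the tangential directions. -/
def ZeroMeanCurvatureAt (f : ℂ → C3) (z : ℂ) : Prop :=
  rdot (dy f z) (dy f z) • dx (dx f) z - (2 * rdot (dx f z) (dy f z)) • dx (dy f) z
    + rdot (dx f z) (dx f z) • dy (dy f) z ∈ Submodule.span ℝ {f z, dx f z, dy f z}

/-- The cone `(r, z) ↦ r f(z)` over the surface `f`. -/
def coneMap (f : ℂ → C3) : ℝ × ℂ → C3 := fun p => p.1 • f p.2

/-- `κ` is an immersion at `x` and `V` is the value of its Gauss map there: `V` is the oriented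
plane `κ_r ∧ κ_x ∧ κ_y`. -/
def IsGaussPlane (κ : ℝ × ℂ → C3) (x : ℝ × ℂ) (V : OrientedPlane) : Prop :=
  V.IsWedge ![fderiv ℝ κ x (1, 0), fderiv ℝ κ x (0, 1), fderiv ℝ κ x (0, Complex.I)]

/-! ### Riemann surfaces -/

section Surface

variable {M : Type*} [TopologicalSpace M] [ChartedSpace ℂ M]

/-- A property of maps on open subsets of `ℂ`, required in all complex charts of the surface. -/
def InCharts {β : Type*} (P : (ℂ → β) → Set ℂ → Prop) (f : M → β) : Prop :=
  ∀ φ ∈ atlas ℂ M, P (f ∘ φ.symm) φ.target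

/-- A primitive map from a Riemann surface. -/
def IsPrimitive (ψ : M → FL1) : Prop := InCharts PrimitiveOn ψ

/-- A harmonic map from a Riemann surface to `FL1` with the metric `B`. -/
def IsHarmonic (B : InvariantMetric) (ψ : M → FL1) : Prop := InCharts (HarmonicOn B) ψ

/-- A smooth conformal immersion of a Riemann surface in the unit sphere `S⁵`. -/
def IsConformalImmersion (f : M → C3) : Prop :=
  (∀ p, ‖f p‖ = 1) ∧ InCharts (fun u Ω => ContDiffOn ℝ ∞ u Ω ∧
    ∀ z ∈ Ω, ImmersionAt u z ∧ WeaklyConformalAt u z) f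

/-- The cone over `f`, without its vertex, is an immersed special Lagrangian 3-fold: its Gauss map
takes values in `SL`. -/
def IsSpecialLagrangianCone (f : M → C3) : Prop :=
  InCharts (fun u Ω => ∀ z ∈ Ω, ∀ r : ℝ, 0 < r → ∃ V ∈ SL, IsGaussPlane (coneMap u) (r, z) V) f

/-- `ψ` is the lift `(f, f ∧ γ)`, where `γ = f_x ∧ f_y` is the Gauss map of `f`. -/
def IsGaussLift (f : M → C3) (ψ : M → FL1) : Prop :=
  (∀ p, (ψ p).toSphere = f p) ∧ ∀ φ ∈ atlas ℂ M, ∀ z ∈ φ.target,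
    (ψ (φ.symm z)).toPlane.IsWedge
      ![f (φ.symm z), dx (f ∘ φ.symm) z, dy (f ∘ φ.symm) z]

/-- The points where the differential of `f` vanishes. -/
def criticalSet (f : M → C3) : Set M :=
  {p | ∃ φ ∈ atlas ℂ M, p ∈ φ.source ∧ fderiv ℝ (f ∘ φ.symm) (φ p) = 0}

end Surface

end SLCone

end

noncomputable section

namespace SLCone


/-! The whole proof is a computation with frames. A smooth map into the flag space is locally the
orbit of some `F` with values in `SU_3`, and `θ = F⁻¹dF` is an `su_3`-valued form satisfying the
Maurer-Cartan equation. In explicit matrices `ĝ_0` is the line of antisymmetric lower blocks and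
`ĝ_1` has two complex coordinates (`mem_gHat_one_iff`). For a primitive map, `θ(∂x)` and `θ(∂y)`
therefore share four real functions `a1, a2, b1, b2`, while `k` and `l` are the components of the
`K_1`-connection (`IsPrimPair`). With `α = a1 + i a2`, `β = b2 + i b1` and `c = l - ik`, the
Maurer-Cartan equation contains `(∂x + i∂y)α = cα` and `(∂x + i∂y)β = -2cβ` (`primPair_mc`).

The automorphism: `σ̂²` is conjugation by `R²`, which has order three, while `σ̂` inverts the centre
of `SU_3`. This gives both the order and outerness.

From cones to primitive maps: the frame `(f, f_x/r, f_y/r)` lies in `SU_3` because the cone is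
special Lagrangian and `f` is conformal. The first columns of its `θ` are real, so the imaginary
part of the Maurer-Cartan equation says that the second fundamental form is symmetric; trace zero in
`su_3` makes it trace-free. Together these are the condition of being primitive
(`primitiveOn_of_frame`).

Harmonicity: an invariant metric depends on four constants only (`InvariantMetric.exists_qform`). By
Maurer-Cartan, the first variation of the energy density is the divergence of `⟨θ, H⟩`, where `H` is
the variation field, plus a term which vanishes identically by `IsPrimPair.qform_div`. The
divergence integrates to zero.

Conversely, `f = F e₁` gives `f_x = a1 F e₂ + a2 F e₃` and `f_y = -a2 F e₂ + a1 F e₃`, and the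
pointwise claims can be read off. The differential of `f` vanishes exactly where `α` does. The
zero-order terms cancel in `α²β`, which is thus holomorphic, and `α`, `β` have no common zero since
the primitive map is an immersion. Either `α²β` has isolated zeros near a point, or it vanishes
identically there; then a ball is the disjoint union of the open sets `α ≠ 0` and `β ≠ 0`, one of
which must be empty. Connectedness of the surface makes this dichotomy global. -/

/-! ### The automorphism `σ̂`: order, outerness, fixed points -/

theorem SU3.ext_coe {g h : SU3} (e : (g : Mat) = (h : Mat)) : g = h := Subtype.ext e

theorem rotMat_eq : rotMat = !![1, 0, 0; 0, 1 / 2, -((Real.sqrt 3 / 2 : ℝ) : ℂ);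
    0, ((Real.sqrt 3 / 2 : ℝ) : ℂ), 1 / 2] := by
  simp only [rotMat, Real.cos_pi_div_three, Real.sin_pi_div_three]
  norm_num

theorem sqrt_three_half_sq : ((Real.sqrt 3 / 2 : ℝ) : ℂ) * ((Real.sqrt 3 / 2 : ℝ) : ℂ) = 3 / 4 := by
  have h : (Real.sqrt 3 / 2) * (Real.sqrt 3 / 2) = 3 / 4 := by
    have := Real.mul_self_sqrt (show (0 : ℝ) ≤ 3 by norm_num)
    linarith
  rw [← Complex.ofReal_mul, h]
  norm_num

theorem R_coe : (R : Mat) = rotMat := rfl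

theorem R_transpose_mul : (R : Mat)ᵀ * (R : Mat) = 1 := by
  have h := sqrt_three_half_sq
  rw [R_coe, rotMat_eq]
  generalize ((Real.sqrt 3 / 2 : ℝ) : ℂ) = s at *
  ext i j
  fin_cases i <;> fin_cases j <;> simp [Matrix.mul_apply, Fin.sum_univ_three] <;>
    first | ring1 | linear_combination h

theorem R_inv_coe : ((R⁻¹ : SU3) : Mat) = (R : Mat)ᵀ := by
  have h := congrArg (· * ((R⁻¹ : SU3) : Mat)) R_transpose_mul
  simp only [Matrix.mul_assoc, SU3.mul_inv, Matrix.mul_one, Matrix.one_mul] at h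
  exact h.symm

theorem sigmaHat_coe (g : SU3) :
    ((sigmaHat g : SU3) : Mat) = (R : Mat) * (star (g : Mat))ᵀ * (R : Mat)ᵀ := by
  rw [← R_inv_coe]
  rfl

theorem contragredient_contragredient (g : SU3) : contragredient (contragredient g) = g :=
  contragredient.left_inv g

theorem contragredient_R : contragredient R = R := by
  apply SU3.ext_coe
  change (((R⁻¹ : SU3) : Mat))ᵀ = _
  rw [R_inv_coe, Matrix.transpose_transpose]

theorem sigmaHat_apply (g : SU3) : sigmaHat g = R * contragredient g * R⁻¹ := rfl

/-- The contragredient is an involution, and it fixes `R` because `R` is real orthogonal; so the two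
transposes cancel and the square is inner. -/
theorem sigmaHat_sq : sigmaHat ^ 2 = MulAut.conj (R ^ 2) := by
  ext1 g
  change sigmaHat (sigmaHat g) = _
  rw [sigmaHat_apply, sigmaHat_apply, map_mul, map_mul, map_inv, contragredient_R,
    contragredient_contragredient, MulAut.conj_apply, pow_two]
  group

theorem R_sq_coe : ((R ^ 2 : SU3) : Mat) =
    !![1, 0, 0; 0, -(1 / 2), -((Real.sqrt 3 / 2 : ℝ) : ℂ);
      0, ((Real.sqrt 3 / 2 : ℝ) : ℂ), -(1 / 2)] := by
  have h := sqrt_three_half_sq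
  rw [pow_two]
  change (R : Mat) * (R : Mat) = _
  rw [R_coe, rotMat_eq]
  generalize ((Real.sqrt 3 / 2 : ℝ) : ℂ) = s at *
  ext i j
  fin_cases i <;> fin_cases j <;> simp [Matrix.mul_apply, Fin.sum_univ_three] <;>
    first | ring1 | linear_combination -h

theorem R_cube_coe : ((R ^ 3 : SU3) : Mat) = !![1, 0, 0; 0, -1, 0; 0, 0, -1] := by
  have h := sqrt_three_half_sq
  rw [pow_succ]
  change ((R ^ 2 : SU3) : Mat) * (R : Mat) = _
  rw [R_sq_coe, R_coe, rotMat_eq]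
  generalize ((Real.sqrt 3 / 2 : ℝ) : ℂ) = s at *
  ext i j
  fin_cases i <;> fin_cases j <;> simp [Matrix.mul_apply, Fin.sum_univ_three] <;>
    first | ring1 | linear_combination -h

theorem R_pow_six : R ^ 6 = 1 := by
  apply SU3.ext_coe
  rw [show 6 = 3 + 3 from rfl, pow_add]
  change ((R ^ 3 : SU3) : Mat) * ((R ^ 3 : SU3) : Mat) = 1
  rw [R_cube_coe]
  ext i j
  fin_cases i <;> fin_cases j <;> simp [Matrix.mul_apply, Fin.sum_univ_three]

theorem orderOf_sigmaHat_le : sigmaHat ^ 6 = 1 := by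
  rw [show 6 = 2 * 3 from rfl, pow_mul, sigmaHat_sq, ← map_pow, ← pow_mul, R_pow_six, map_one]

/-- The scalar `exp(2πi/3)` as an element of the centre of `SU_3`. -/
def centralElement : SU3 := ⟨Matrix.diagonal fun _ => ⟨-(1 / 2), Real.sqrt 3 / 2⟩, by
  have h : (Real.sqrt 3) * (Real.sqrt 3) = 3 := Real.mul_self_sqrt (by norm_num)
  rw [Matrix.mem_specialUnitaryGroup_iff, Matrix.mem_unitaryGroup_iff]
  constructor
  · rw [Matrix.star_eq_conjTranspose, Matrix.diagonal_conjTranspose, Matrix.diagonal_mul_diagonal,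
      ← Matrix.diagonal_one]
    congr 1
    funext i
    apply Complex.ext <;> simp <;> nlinarith
  · rw [Matrix.det_diagonal, Fin.prod_univ_three]
    generalize Real.sqrt 3 = s at h
    apply Complex.ext
    · simp
      linear_combination (3 / 8) * h
    · simp
      linear_combination (-s / 8) * h⟩

theorem centralElement_comm (g : SU3) : g * centralElement = centralElement * g := by
  apply SU3.ext_coe
  change (g : Mat) * Matrix.diagonal _ = Matrix.diagonal _ * (g : Mat)
  ext i j
  rw [Matrix.mul_diagonal, Matrix.diagonal_mul, mul_comm]

theorem contragredient_centralElement_ne : contragredient centralElement ≠ centralElement := by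
  intro h
  have h0 := congrArg (fun g : SU3 => ((g : Mat) 0 0).im) h
  have h1 : (((contragredient centralElement : SU3) : Mat) 0 0).im = -(Real.sqrt 3 / 2) := by
    change ((star (Matrix.diagonal fun _ => (⟨-(1 / 2), Real.sqrt 3 / 2⟩ : ℂ) : Mat))ᵀ 0 0).im = _
    simp [Matrix.star_apply]
  have h2 : ((centralElement : Mat) 0 0).im = Real.sqrt 3 / 2 := by
    change ((Matrix.diagonal fun _ => (⟨-(1 / 2), Real.sqrt 3 / 2⟩ : ℂ) : Mat) 0 0).im = _
    simp
  have h3 : (0 : ℝ) < Real.sqrt 3 := by positivity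
  simp only [h1, h2] at h0
  linarith

/-- Conjugation fixes the centre, while the contragredient inverts it, and a primitive cube root of
unity is not its own inverse. This one element shows that `σ̂` is outer and that its cube is not the
identity. -/
theorem sigmaHat_centralElement_ne : sigmaHat centralElement ≠ centralElement := by
  intro h1
  rw [sigmaHat_apply] at h1
  apply contragredient_centralElement_ne
  have h2 : contragredient centralElement = R⁻¹ * centralElement * R := by
    nth_rewrite 2 [← h1]; group
  rw [h2, mul_assoc, ← centralElement_comm, inv_mul_cancel_left]

theorem sigmaHat_ne_conj (h : SU3) : sigmaHat ≠ MulAut.conj h := by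
  intro e
  apply sigmaHat_centralElement_ne
  rw [e, MulAut.conj_apply, centralElement_comm, mul_inv_cancel_right]

theorem sigmaHat_sq_ne : sigmaHat ^ 2 ≠ 1 := by
  intro e
  have s3 : (0 : ℝ) < Real.sqrt 3 := by positivity
  -- A cyclic permutation of the coordinates moves the axis of `R²`, so it cannot commute with it.
  let k : SU3 := ⟨!![0, 0, 1; 1, 0, 0; 0, 1, 0], by
    rw [Matrix.mem_specialUnitaryGroup_iff, Matrix.mem_unitaryGroup_iff]
    constructor
    · ext i j
      fin_cases i <;> fin_cases j <;> simp [Matrix.mul_apply, Fin.sum_univ_three, Matrix.star_apply]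
    · simp [Matrix.det_fin_three]⟩
  have h1 := DFunLike.congr_fun e k
  rw [sigmaHat_sq, MulAut.conj_apply, MulAut.one_apply] at h1
  have h2 : R ^ 2 * k = k * R ^ 2 := by
    nth_rewrite 2 [← h1]
    rw [inv_mul_cancel_right]
  have h3 : ((R ^ 2 : SU3) : Mat) * (k : Mat) = (k : Mat) * ((R ^ 2 : SU3) : Mat) :=
    congrArg (fun g : SU3 => (g : Mat)) h2
  rw [R_sq_coe] at h3
  have h4 := congrFun (congrFun h3 0) 1
  simp [Matrix.mul_apply, Fin.sum_univ_three, k] at h4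
  have h5 : (Real.sqrt 3 : ℂ) ≠ 0 := by exact_mod_cast s3.ne'
  exact h5 (by linear_combination -2 * h4)

theorem sigmaHat_cube_ne : sigmaHat ^ 3 ≠ 1 := by
  intro e
  have h1 : sigmaHat ((sigmaHat ^ 2) centralElement) = centralElement := DFunLike.congr_fun e _
  rw [sigmaHat_sq, MulAut.conj_apply, centralElement_comm, mul_inv_cancel_right] at h1
  exact sigmaHat_centralElement_ne h1

theorem orderOf_sigmaHat : orderOf sigmaHat = 6 := by
  refine orderOf_eq_of_pow_and_pow_div_prime (by norm_num) orderOf_sigmaHat_le fun p hp hd => ?_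
  have h6 : p ∣ 2 * 3 := hd
  rcases (Nat.Prime.dvd_mul hp).1 h6 with h | h
  · rw [(Nat.prime_dvd_prime_iff_eq hp Nat.prime_two).1 h]
    exact sigmaHat_cube_ne
  · rw [(Nat.prime_dvd_prime_iff_eq hp Nat.prime_three).1 h]
    exact sigmaHat_sq_ne

/-- The fixed point equation is `R ḡ = g R`. Since `R` is real, conjugating gives `R g = ḡ R`, so
`g` commutes with `R²`, a rotation through `2π/3`. This forces a block form; the equation itself
then makes the lower block real, and unitarity with determinant one makes the corner equal to 1. -/
theorem sigmaHat_fixed_iff (g : SU3) : sigmaHat g = g ↔ g ∈ K1 := by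
  constructor
  · intro h
    have hmul : (R : Mat) * (star (g : Mat))ᵀ = (g : Mat) * (R : Mat) := by
      have h1 := congrArg (fun k : SU3 => (k : Mat) * (R : Mat)) h
      simp only [sigmaHat_coe] at h1
      rwa [Matrix.mul_assoc _ (R : Mat)ᵀ, R_transpose_mul, Matrix.mul_one] at h1
    have hbar : ((R : Mat).map (starRingEnd ℂ)) = (R : Mat) := by
      rw [R_coe, rotMat_eq]
      ext i j
      fin_cases i <;> fin_cases j <;> simp [-Complex.ofReal_div, Complex.conj_ofNat]
    have hmul2 : (R : Mat) * (g : Mat) = (star (g : Mat))ᵀ * (R : Mat) := by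
      have h2 := congrArg (fun X : Mat => X.map (starRingEnd ℂ)) hmul
      simp only [Matrix.map_mul, hbar] at h2
      have h3 : ((star (g : Mat))ᵀ).map (starRingEnd ℂ) = (g : Mat) := by
        ext i j
        simp [Matrix.star_apply]
      have h4 : (g : Mat).map (starRingEnd ℂ) = (star (g : Mat))ᵀ := by
        ext i j
        simp [Matrix.star_apply]
      rwa [h3, h4] at h2
    have hcomm : ((R ^ 2 : SU3) : Mat) * (g : Mat) = (g : Mat) * ((R ^ 2 : SU3) : Mat) := by
      rw [pow_two]
      change (R : Mat) * (R : Mat) * (g : Mat) = (g : Mat) * ((R : Mat) * (R : Mat))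
      rw [Matrix.mul_assoc, hmul2, ← Matrix.mul_assoc, hmul, Matrix.mul_assoc]
    rw [R_coe, rotMat_eq] at hmul
    rw [R_sq_coe] at hcomm
    have hd := (Matrix.mem_specialUnitaryGroup_iff.1 g.2).2
    have hu := SU3.mul_inv g
    rw [SU3.inv_coe] at hu
    have hs := sqrt_three_half_sq
    have hs0 : ((Real.sqrt 3 / 2 : ℝ) : ℂ) ≠ 0 := by
      have : (0 : ℝ) < Real.sqrt 3 := by positivity
      exact_mod_cast (by positivity : (Real.sqrt 3 / 2) ≠ 0)
    suffices H : ((g : Mat) 0 1 = 0 ∧ (g : Mat) 0 2 = 0 ∧ (g : Mat) 1 0 = 0 ∧ (g : Mat) 2 0 = 0 ∧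
        (g : Mat) 0 0 = 1) ∧ ∀ i j, (starRingEnd ℂ) ((g : Mat) i j) = (g : Mat) i j by
      refine ⟨fun i j => Complex.conj_eq_iff_im.1 (H.2 i j), ?_⟩
      ext i
      change (g : Mat) i 0 = _
      fin_cases i <;> simp [H.1]
    generalize (g : Mat) = m at *
    generalize ((Real.sqrt 3 / 2 : ℝ) : ℂ) = s at *
    have e := fun i j => congrFun (congrFun hcomm i) j
    have e01 := e 0 1
    have e02 := e 0 2
    have e10 := e 1 0
    have e20 := e 2 0
    have e11 := e 1 1
    have e12 := e 1 2
    simp [Matrix.mul_apply, Fin.sum_univ_three] at e01 e02 e10 e20 e11 e12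
    have m01 : m 0 1 = 0 := by
      linear_combination (1 / 2) * e01 + (s / 3) * e02 - (m 0 1 / 3) * hs
    have m02 : m 0 2 = 0 := by
      linear_combination (1 / 2) * e02 - (s / 3) * e01 - (m 0 2 / 3) * hs
    have m10 : m 1 0 = 0 := by
      linear_combination (-1 / 2) * e10 + (s / 3) * e20 - (m 1 0 / 3) * hs
    have m20 : m 2 0 = 0 := by
      linear_combination (-1 / 2) * e20 - (s / 3) * e10 - (m 2 0 / 3) * hs
    have m12 : m 1 2 = -m 2 1 := mul_left_cancel₀ hs0 (by linear_combination -e11)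
    have m22 : m 2 2 = m 1 1 := mul_left_cancel₀ hs0 (by linear_combination -e12)
    have f := fun i j => congrFun (congrFun hmul i) j
    have f00 := f 0 0
    have f11 := f 1 1
    have f21 := f 2 1
    simp [Matrix.mul_apply, Fin.sum_univ_three, Matrix.star_apply, m01, m02, m10, m20, m12, m22]
      at f00 f11 f21
    have r11 : (starRingEnd ℂ) (m 1 1) = m 1 1 := by
      -- The entries of `ḡ - g` in the lower block solve a linear system with coefficients
      -- `cos(π/3)` and `sin(π/3)`; `hs` inverts it.
      linear_combination (1 / 2) * f11 + s * f21 + (m 1 1 - (starRingEnd ℂ) (m 1 1)) * hs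
    have r21 : (starRingEnd ℂ) (m 2 1) = m 2 1 := by
      linear_combination (1 / 2) * f21 - s * f11 + (m 2 1 - (starRingEnd ℂ) (m 2 1)) * hs
    have u11 := congrFun (congrFun hu 1) 1
    simp [Matrix.mul_apply, Fin.sum_univ_three, Matrix.star_apply, m10, m12, r11, r21] at u11
    simp [Matrix.det_fin_three, m01, m02, m10, m20, m12, m22] at hd
    have m00 : m 0 0 = 1 := by linear_combination hd - m 0 0 * u11
    refine ⟨⟨m01, m02, m10, m20, m00⟩, fun i j => ?_⟩
    fin_cases i <;> fin_cases j <;> simp [m01, m02, m10, m20, m12, m22, m00, r11, r21]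
  · intro h
    apply SU3.ext_coe
    have h1 : star (g : Mat) = (g : Mat)ᵀ := by
      ext i j
      rw [Matrix.star_apply, Matrix.transpose_apply]
      exact Complex.conj_eq_iff_im.2 (h.1 j i)
    have h2 := K1.R_mul_transpose h
    rw [sigmaHat_coe, h1, Matrix.transpose_transpose, ← R_inv_coe]
    have h3 := K1.R_mul_transpose (K1.inv_mem h)
    rw [inv_inv, SU3.inv_coe, h1, Matrix.transpose_transpose] at h3
    rw [h3, Matrix.mul_assoc, SU3.mul_inv, Matrix.mul_one]


/-! ### Transitivity and isotropy on the flag space -/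

/-- A real matrix, viewed as a complex one. -/
def ofRealMat (A : Matrix (Fin 3) (Fin 3) ℝ) : Mat := A.map fun x : ℝ => (x : ℂ)

theorem ofRealMat_apply (A : Matrix (Fin 3) (Fin 3) ℝ) (i j : Fin 3) :
    ofRealMat A i j = (A i j : ℂ) := rfl

theorem ofRealMat_mul (A B : Matrix (Fin 3) (Fin 3) ℝ) :
    ofRealMat (A * B) = ofRealMat A * ofRealMat B := by
  ext i j
  simp [ofRealMat, Matrix.mul_apply]

theorem det_ofRealMat (A : Matrix (Fin 3) (Fin 3) ℝ) : (ofRealMat A).det = (A.det : ℂ) := by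
  simp [ofRealMat, Matrix.det_fin_three]

theorem star_ofRealMat (A : Matrix (Fin 3) (Fin 3) ℝ) : star (ofRealMat A) = ofRealMat Aᵀ := by
  ext i j
  simp [ofRealMat, Matrix.star_apply]

theorem ofRealMat_one : ofRealMat 1 = 1 := by
  ext i j
  simp [ofRealMat, Matrix.one_apply, apply_ite]

theorem col_apply (g : Mat) (i j : Fin 3) : col g j i = g i j := rfl

theorem col_mul_ofRealMat (g : Mat) (A : Matrix (Fin 3) (Fin 3) ℝ) (j : Fin 3) :
    col (g * ofRealMat A) j = ∑ i, A i j • col g i := by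
  ext l
  simp [col, Matrix.mul_apply, ofRealMat, mul_comm]

/-- The element of `SU_3` given by a real orthogonal matrix of determinant one. -/
def ofSO3 (A : Matrix (Fin 3) (Fin 3) ℝ) (hA : Aᵀ * A = 1) (hd : A.det = 1) : SU3 :=
  ⟨ofRealMat A, by
    rw [Matrix.mem_specialUnitaryGroup_iff, Matrix.mem_unitaryGroup_iff', star_ofRealMat,
      ← ofRealMat_mul, hA, ofRealMat_one, det_ofRealMat, hd]
    exact ⟨rfl, Complex.ofReal_one⟩⟩

theorem ofSO3_coe (A : Matrix (Fin 3) (Fin 3) ℝ) (hA : Aᵀ * A = 1) (hd : A.det = 1) :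
    (ofSO3 A hA hd : Mat) = ofRealMat A := rfl

theorem linearIndependent_of_mul {v w : Fin 3 → C3} (hv : LinearIndependent ℝ v)
    {A : Matrix (Fin 3) (Fin 3) ℝ} (hA : A.det ≠ 0) (h : ∀ j, w j = ∑ i, A i j • v i) :
    LinearIndependent ℝ w := by
  rw [Fintype.linearIndependent_iff] at hv ⊢
  intro c hc
  have h1 : ∑ i, (A *ᵥ c) i • v i = 0 := by
    rw [← hc]
    simp_rw [h, Finset.smul_sum, smul_smul]
    rw [Finset.sum_comm]
    simp_rw [← Finset.sum_smul]
    refine Finset.sum_congr rfl fun i _ => ?_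
    simp [Matrix.mulVec, dotProduct, mul_comm]
  have h2 : A *ᵥ c = 0 := funext (hv _ h1)
  exact congrFun (Matrix.eq_zero_of_mulVec_eq_zero hA h2)

theorem OrientedPlane.IsWedge.of_mul {V : OrientedPlane} {v w : Fin 3 → C3} (hV : V.IsWedge v)
    {A : Matrix (Fin 3) (Fin 3) ℝ} (hA : 0 < A.det) (h : ∀ j, w j = ∑ i, A i j • v i) :
    V.IsWedge w := by
  obtain ⟨hv, rfl⟩ := hV
  exact ⟨linearIndependent_of_mul hv hA.ne' h, Quotient.sound ⟨A, hA, h⟩⟩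

theorem OrientedPlane.IsWedge.exists_mul {V : OrientedPlane} {v w : Fin 3 → C3}
    (hv : V.IsWedge v) (hw : V.IsWedge w) :
    ∃ A : Matrix (Fin 3) (Fin 3) ℝ, 0 < A.det ∧ ∀ j, w j = ∑ i, A i j • v i := by
  obtain ⟨h1, rfl⟩ := hv
  obtain ⟨h2, h3⟩ := hw
  exact Quotient.exact h3

theorem OrientedPlane.IsWedge.unique {V W : OrientedPlane} {v : Fin 3 → C3}
    (hV : V.IsWedge v) (hW : W.IsWedge v) : V = W := by
  obtain ⟨_, rfl⟩ := hV
  obtain ⟨_, rfl⟩ := hW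
  rfl

theorem FL1.ext {p q : FL1} (h1 : p.toSphere = q.toSphere) (h2 : p.toPlane = q.toPlane) :
    p = q := Subtype.ext (Prod.ext h1 h2)

theorem orbit_toSphere (g : SU3) : (orbit g).toSphere = col g 0 := rfl

theorem orbit_isWedge (g : SU3) : (orbit g).toPlane.IsWedge (col g) :=
  ⟨col_linearIndependent g, rfl⟩

theorem orbit_eq_iff (g h : SU3) : orbit g = orbit h ↔ g⁻¹ * h ∈ K1 := by
  refine ⟨orbit_eq, fun hk => ?_⟩
  set k : SU3 := g⁻¹ * h with hkd
  have hg : h = g * k := by rw [hkd, mul_inv_cancel_left]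
  let A : Matrix (Fin 3) (Fin 3) ℝ := fun i j => ((k : Mat) i j).re
  have hA : (k : Mat) = ofRealMat A := by
    ext i j
    apply Complex.ext
    · rw [ofRealMat_apply, Complex.ofReal_re]
    · simp [ofRealMat_apply, hk.1]
  have hh : (h : Mat) = (g : Mat) * ofRealMat A := by
    rw [hg, ← hA]
    rfl
  have hdet : A.det = 1 := by
    have := (Matrix.mem_specialUnitaryGroup_iff.1 k.2).2
    rw [hA, det_ofRealMat] at this
    exact_mod_cast this
  have hcol : ∀ i, A i 0 = if i = 0 then 1 else 0 := by
    intro i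
    have h1 := congrArg (fun x : C3 => (x i).re) hk.2
    change A i 0 = _ at h1
    rw [h1]
    fin_cases i <;> simp
  have hj : ∀ j, col h j = ∑ i, A i j • col g i := by
    intro j
    rw [hh]
    exact col_mul_ofRealMat _ A j
  refine FL1.ext ?_ (((orbit_isWedge g).of_mul (by rw [hdet]; norm_num) hj).unique
    (orbit_isWedge h))
  rw [orbit_toSphere, orbit_toSphere, hj 0]
  simp [hcol]

/-- Away from the antipode of `e₁` the matrix is the rotation in the plane of `e₁` and the given
vector, with `t = 1 / (1 + x)`; at the antipode a half turn serves. -/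
theorem exists_SO3_col (x y z : ℝ) (h : x ^ 2 + y ^ 2 + z ^ 2 = 1) :
    ∃ A : Matrix (Fin 3) (Fin 3) ℝ, Aᵀ * A = 1 ∧ A.det = 1 ∧ A 0 0 = x ∧ A 1 0 = y ∧ A 2 0 = z := by
  by_cases hx : 1 + x = 0
  · have hx' : x = -1 := by linarith
    have hy : y = 0 := by nlinarith [sq_nonneg y, sq_nonneg z]
    have hz : z = 0 := by nlinarith [sq_nonneg y, sq_nonneg z]
    refine ⟨!![-1, 0, 0; 0, -1, 0; 0, 0, 1], ?_, ?_, by simp [hx'], by simp [hy], by simp [hz]⟩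
    · ext i j
      fin_cases i <;> fin_cases j <;> simp [Matrix.mul_apply, Fin.sum_univ_three]
    · simp [Matrix.det_fin_three]
  · obtain ⟨t, ht⟩ : ∃ t : ℝ, t * (1 + x) = 1 := ⟨(1 + x)⁻¹, inv_mul_cancel₀ hx⟩
    have hyz : t * (y ^ 2 + z ^ 2) = 1 - x := by
      have : y ^ 2 + z ^ 2 = (1 - x) * (1 + x) := by linarith
      rw [this]
      linear_combination (1 - x) * ht
    refine ⟨!![x, -y, -z; y, 1 - t * y ^ 2, -(t * y * z); z, -(t * y * z), 1 - t * z ^ 2],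
      ?_, ?_, rfl, rfl, rfl⟩
    · ext i j
      fin_cases i <;> fin_cases j <;> simp [Matrix.mul_apply, Fin.sum_univ_three]
      · linear_combination h
      · linear_combination (-y) * hyz
      · linear_combination (-z) * hyz
      · linear_combination (-y) * hyz
      · linear_combination y ^ 2 * t * hyz - y ^ 2 * ht
      · linear_combination y * z * t * hyz - y * z * ht
      · linear_combination (-z) * hyz
      · linear_combination y * z * t * hyz - y * z * ht
      · linear_combination z ^ 2 * t * hyz - z ^ 2 * ht
    · simp [Matrix.det_fin_three]
      linear_combination h + (-x) * hyz 

theorem norm_sum_smul_col (g : SU3) (r : Fin 3 → ℝ) :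
    ‖∑ i, r i • col g i‖ ^ 2 = ∑ i, r i ^ 2 := by
  have h : ∀ i j, inner ℂ (col g i) (col g j) = if i = j then (1 : ℂ) else 0 := by
    intro i j
    have := congrFun (congrFun (SU3.star_mul g) i) j
    rw [Matrix.mul_apply, Matrix.one_apply] at this
    rw [← this, PiLp.inner_apply]
    refine Finset.sum_congr rfl fun l _ => ?_
    rw [Matrix.star_apply]
    simp [col, mul_comm]
  have h2 : ∀ (i : Fin 3), r i • col g i = (r i : ℂ) • col g i := fun i => rfl
  have h1 := inner_self_eq_norm_sq_to_K (𝕜 := ℂ) (∑ i, r i • col g i)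
  simp_rw [h2] at h1 ⊢
  rw [sum_inner] at h1
  simp_rw [inner_sum, inner_smul_left, inner_smul_right, h] at h1
  simp at h1
  simp only [← pow_two] at h1
  exact_mod_cast h1.symm

/-- A unit vector of the plane has real coordinates of unit length in the columns of `g`.
Multiplying `g` on the right by a rotation with these coordinates as first column moves `e₁` to the
vector and keeps the oriented plane. -/
theorem orbit_surjective : Function.Surjective orbit := by
  intro q
  obtain ⟨hn, ⟨g, hg⟩, w, hw, hvw⟩ := q.2
  obtain ⟨A, -, hA⟩ := hg.exists_mul hw
  obtain ⟨c, hc⟩ := (Submodule.mem_span_range_iff_exists_fun ℝ).1 hvw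
  set r : Fin 3 → ℝ := A *ᵥ c with hr
  have hv : q.1.1 = ∑ i, r i • col g i := by
    rw [← hc]
    simp_rw [hA, Finset.smul_sum, smul_smul]
    rw [Finset.sum_comm]
    simp_rw [← Finset.sum_smul]
    refine Finset.sum_congr rfl fun i _ => ?_
    simp [hr, Matrix.mulVec, dotProduct, mul_comm]
  have hr1 : r 0 ^ 2 + r 1 ^ 2 + r 2 ^ 2 = 1 := by
    have := norm_sum_smul_col g r
    rw [← hv, hn, Fin.sum_univ_three] at this
    linarith
  obtain ⟨C, hC, hCd, h0, h1, h2⟩ := exists_SO3_col _ _ _ hr1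
  have hcol : ∀ j, col ((g * ofSO3 C hC hCd : SU3) : Mat) j = ∑ i, C i j • col g i := by
    intro j
    exact col_mul_ofRealMat _ C j
  refine ⟨g * ofSO3 C hC hCd, FL1.ext ?_ (((hg.of_mul (by rw [hCd]; norm_num) hcol).unique
    (orbit_isWedge _)).symm)⟩
  rw [orbit_toSphere, hcol]
  change _ = q.1.1
  rw [hv]
  simp [Fin.sum_univ_three, h0, h1, h2]


/-! ### The eigenspaces of `σ̂` in coordinates -/

theorem sigmaLie_eq (X : Mat) : sigmaLie X = -((R : Mat) * Xᵀ * (R : Mat)ᵀ) := by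
  rw [← R_inv_coe]
  rfl

/-- The imaginary number `sin (π / 3)` is written as `√3 / 2`. -/
theorem sigmaLie_entries (X : Mat) :
    let s : ℂ := ((Real.sqrt 3 / 2 : ℝ) : ℂ)
    sigmaLie X = !![-X 0 0, -(X 1 0 / 2 - s * X 2 0), -(s * X 1 0 + X 2 0 / 2);
      -(X 0 1 / 2 - s * X 0 2),
      -(X 1 1 / 4 - s * X 2 1 / 2 - s * X 1 2 / 2 + 3 / 4 * X 2 2),
      -(s * X 1 1 / 2 + X 2 1 / 4 - 3 / 4 * X 1 2 - s * X 2 2 / 2);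
      -(s * X 0 1 + X 0 2 / 2),
      -(s * X 1 1 / 2 - 3 / 4 * X 2 1 + X 1 2 / 4 - s * X 2 2 / 2),
      -(3 / 4 * X 1 1 + s * X 2 1 / 2 + s * X 1 2 / 2 + X 2 2 / 4)] := by
  intro s
  have hs : s * s = 3 / 4 := sqrt_three_half_sq
  rw [sigmaLie_eq, R_coe, rotMat_eq]
  change -(!![1, 0, 0; 0, 1 / 2, -s; 0, s, 1 / 2] * Xᵀ * (!![1, 0, 0; 0, 1 / 2, -s; 0, s, 1 / 2])ᵀ)
    = _
  clear_value s
  ext i j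
  simp only [Matrix.neg_apply, Matrix.mul_apply, Fin.sum_univ_three, Matrix.transpose_apply]
  fin_cases i <;> fin_cases j <;> simp
  · ring
  · ring
  · ring
  · linear_combination (-X 2 2) * hs
  · linear_combination X 1 2 * hs
  · ring
  · linear_combination X 2 1 * hs
  · linear_combination (-X 1 1) * hs

theorem sigmaLie_sq (X : Mat) : sigmaLie (sigmaLie X) =
    ((R ^ 2 : SU3) : Mat) * X * ((R ^ 2 : SU3) : Mat)ᵀ := by
  rw [sigmaLie_eq, sigmaLie_eq, pow_two]
  change _ = ((R : Mat) * (R : Mat)) * X * ((R : Mat) * (R : Mat))ᵀ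
  simp only [Matrix.transpose_mul, Matrix.transpose_neg, Matrix.transpose_transpose,
    Matrix.mul_neg, Matrix.neg_mul, neg_neg, Matrix.mul_assoc]

theorem sigmaLie_cube (X : Mat) : sigmaLie (sigmaLie (sigmaLie X)) =
    !![-X 0 0, X 1 0, X 2 0; X 0 1, -X 1 1, -X 2 1; X 0 2, -X 1 2, -X 2 2] := by
  have h3 : ((R ^ 3 : SU3) : Mat) = ((R ^ 2 : SU3) : Mat) * (R : Mat) := by
    rw [pow_succ R 2, Submonoid.coe_mul]
  have h : sigmaLie (sigmaLie (sigmaLie X)) =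
      -(((R ^ 3 : SU3) : Mat) * Xᵀ * ((R ^ 3 : SU3) : Mat)ᵀ) := by
    rw [sigmaLie_sq, sigmaLie_eq, h3]
    simp only [Matrix.transpose_mul, Matrix.mul_neg, Matrix.neg_mul, Matrix.mul_assoc]
  rw [h, R_cube_coe]
  ext i j
  simp only [Matrix.neg_apply, Matrix.mul_apply, Fin.sum_univ_three, Matrix.transpose_apply]
  fin_cases i <;> fin_cases j <;> simp

/-- The sum of the six powers of `σ` factors as `(1 + σ + σ²)(1 + σ³)`, and `1 + σ³` is sparse
because `R³ = diag(1, -1, -1)`. On its image `σ` turns `(p, q)` through `4π/3`, so that `1 + σ + σ²`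
kills this pair, and it fixes `k`. Only the antisymmetric part of the lower block is therefore
removed. -/
theorem projP_eq (X : Mat) : projP X = !![X 0 0, X 0 1, X 0 2;
    X 1 0, X 1 1, (X 1 2 + X 2 1) / 2; X 2 0, (X 1 2 + X 2 1) / 2, X 2 2] := by
  have hsum : ∑ k ∈ Finset.range 6, (sigmaLie ^ k) X =
      (X + sigmaLie (sigmaLie (sigmaLie X))) + sigmaLie (X + sigmaLie (sigmaLie (sigmaLie X))) +
        sigmaLie (sigmaLie (X + sigmaLie (sigmaLie (sigmaLie X)))) := by
    simp only [Finset.sum_range_succ, Finset.sum_range_zero, pow_succ, pow_zero, one_mul,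
      Module.End.mul_apply, Module.End.one_apply, map_add]
    abel
  have key : ∀ p q k : ℂ, sigmaLie !![0, p, q; p, 0, k; q, -k, 0] =
      let s : ℂ := ((Real.sqrt 3 / 2 : ℝ) : ℂ)
      !![0, -(p / 2 - s * q), -(s * p + q / 2); -(p / 2 - s * q), 0, k;
        -(s * p + q / 2), -k, 0] := by
    intro p q k
    rw [sigmaLie_entries]
    ext i j
    fin_cases i <;> fin_cases j <;> simp <;> ring
  have hY : X + sigmaLie (sigmaLie (sigmaLie X)) = !![0, X 0 1 + X 1 0, X 0 2 + X 2 0;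
      X 0 1 + X 1 0, 0, X 1 2 - X 2 1; X 0 2 + X 2 0, -(X 1 2 - X 2 1), 0] := by
    rw [sigmaLie_cube]
    ext i j
    fin_cases i <;> fin_cases j <;> simp <;> ring
  have hs := sqrt_three_half_sq
  rw [projP, hsum, hY, key]
  dsimp only
  rw [key]
  dsimp only
  generalize ((Real.sqrt 3 / 2 : ℝ) : ℂ) = s at *
  ext i j
  fin_cases i <;> fin_cases j <;> simp
  · linear_combination (-(X 0 1 + X 1 0)) * hs
  · linear_combination (-(X 0 2 + X 2 0)) * hs
  · linear_combination (-(X 0 1 + X 1 0)) * hs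
  · ring
  · linear_combination (-(X 0 2 + X 2 0)) * hs
  · ring

theorem exp_pi_div_three : Complex.exp (Complex.I * (Real.pi / 3 : ℝ)) =
    1 / 2 + ((Real.sqrt 3 / 2 : ℝ) : ℂ) * Complex.I := by
  rw [mul_comm, Complex.exp_mul_I, ← Complex.ofReal_cos, ← Complex.ofReal_sin,
    Real.cos_pi_div_three, Real.sin_pi_div_three]
  norm_num

/-- The general element of `ĝ_1`. -/
def g1Mat (a b : ℂ) : Mat := !![0, -a, Complex.I * a; a, b, Complex.I * b;
  -Complex.I * a, Complex.I * b, -b]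

theorem g1Mat_mem (a b : ℂ) : g1Mat a b ∈ gHat 1 := by
  constructor
  · simp [g1Mat, Matrix.trace_fin_three]
  · have hs := sqrt_three_half_sq
    rw [pow_one, exp_pi_div_three, sigmaLie_entries]
    have hI := Complex.I_mul_I
    generalize ((Real.sqrt 3 / 2 : ℝ) : ℂ) = s at *
    ext i j
    fin_cases i <;> fin_cases j <;> simp [g1Mat] <;>
      first
        | ring1
        | linear_combination (a * s) * hI
        | linear_combination (-a * s) * hI
        | linear_combination (b * s) * hI
        | linear_combination (-b * s) * hI

theorem mem_gHat_one_iff (X : Mat) : X ∈ gHat 1 ↔ ∃ a b, X = g1Mat a b := by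
  constructor
  · rintro ⟨-, h⟩
    have hs := sqrt_three_half_sq
    rw [pow_one, exp_pi_div_three, sigmaLie_entries] at h
    have hI := Complex.I_mul_I
    generalize ((Real.sqrt 3 / 2 : ℝ) : ℂ) = s at *
    have e := fun i j => congrFun (congrFun h i) j
    have e00 := e 0 0
    have e01 := e 0 1
    have e02 := e 0 2
    have e10 := e 1 0
    have e11 := e 1 1
    have e12 := e 1 2
    have e20 := e 2 0
    have e21 := e 2 1
    have e22 := e 2 2
    simp at e00 e01 e02 e10 e11 e12 e20 e21 e22
    clear h e
    have x00 : X 0 0 = 0 := by grind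
    have x01 : X 0 1 = -X 1 0 := by grind
    have x02 : X 0 2 = Complex.I * X 1 0 := by grind
    have x20 : X 2 0 = -Complex.I * X 1 0 := by grind
    have x12 : X 1 2 = Complex.I * X 1 1 := by grind
    have x21 : X 2 1 = Complex.I * X 1 1 := by grind
    have x22 : X 2 2 = -X 1 1 := by grind
    refine ⟨X 1 0, X 1 1, ?_⟩
    ext i j
    fin_cases i <;> fin_cases j <;> simp [g1Mat, x00, x01, x02, x20, x12, x21, x22]
  · rintro ⟨a, b, rfl⟩
    exact g1Mat_mem a b



/-! ### The invariant metrics on `𝔭` -/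

/-- The parametrization of `𝔭` by `ℝ⁷`. -/
def pMat (v : Fin 7 → ℝ) : Mat :=
  !![⟨0, -2 * v 6⟩, ⟨-v 0, v 2⟩, ⟨-v 1, v 3⟩;
    ⟨v 0, v 2⟩, ⟨0, v 6 + v 4⟩, ⟨0, v 5⟩;
    ⟨v 1, v 3⟩, ⟨0, v 5⟩, ⟨0, v 6 - v 4⟩]

theorem pMat_mem (v : Fin 7 → ℝ) : pMat v ∈ pHat := by
  refine ⟨?_, ?_, ?_⟩
  · ext i j
    fin_cases i <;> fin_cases j <;> apply Complex.ext <;> simp [pMat, Matrix.star_apply]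
  · apply Complex.ext <;> simp [pMat, Matrix.trace_fin_three]
    ring
  · rw [projP_eq]
    ext i j
    fin_cases i <;> fin_cases j <;> simp [pMat] 

theorem pMat_eq_sum (v : Fin 7 → ℝ) : pMat v = ∑ i, v i • pMat (Pi.single i 1) := by
  ext i j
  rw [Matrix.sum_apply]
  simp only [Matrix.smul_apply, Fin.sum_univ_seven]
  fin_cases i <;> fin_cases j <;> apply Complex.ext <;> simp [pMat] <;> ring

/-- The matrix of `𝔭` with the entries of `X`. -/
def pCoord (X : Mat) : Fin 7 → ℝ :=
  ![(X 1 0).re, (X 2 0).re, (X 1 0).im, (X 2 0).im, ((X 1 1).im - (X 2 2).im) / 2, (X 1 2).im,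
    -(X 0 0).im / 2]

/-- Entries of a skew-Hermitian matrix without trace. -/
theorem skew_entries {X : Mat} (h : star X = -X) (i j : Fin 3) :
    (X i j).re = -(X j i).re ∧ (X i j).im = (X j i).im := by
  have h1 := congrFun (congrFun h j) i
  rw [Matrix.star_apply, Matrix.neg_apply] at h1
  have h2 := congrArg Complex.re h1
  have h3 := congrArg Complex.im h1
  simp at h2 h3
  exact ⟨h2, h3⟩

theorem projP_eq_pMat {X : Mat} (h : star X = -X) (ht : X.trace = 0) :
    projP X = pMat (pCoord X) := by
  have e := skew_entries h
  have t := congrArg Complex.im ht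
  rw [Matrix.trace_fin_three] at t
  simp at t
  have e00 := e 0 0
  have e11 := e 1 1
  have e22 := e 2 2
  have e01 := e 0 1
  have e02 := e 0 2
  have e12 := e 1 2
  rw [projP_eq]
  ext i j
  fin_cases i <;> fin_cases j <;> apply Complex.ext <;> simp [pMat, pCoord] <;> linarith

/-- The quarter turn about the `e₁` axis. -/
def quarterTurn : SU3 := ofSO3 !![1, 0, 0; 0, 0, -1; 0, 1, 0]
  (by ext i j; fin_cases i <;> fin_cases j <;> simp [Matrix.mul_apply, Fin.sum_univ_three])
  (by simp [Matrix.det_fin_three])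

theorem quarterTurn_mem : quarterTurn ∈ K1 := by
  refine ⟨fun i j => ?_, ?_⟩
  · rw [quarterTurn, ofSO3_coe, ofRealMat_apply, Complex.ofReal_im]
  · ext i
    rw [col_apply, quarterTurn, ofSO3_coe, ofRealMat_apply]
    fin_cases i <;> simp

theorem Ad_quarterTurn (v : Fin 7 → ℝ) : Ad quarterTurn (pMat v) =
    pMat ![-v 1, v 0, -v 3, v 2, -v 4, -v 5, v 6] := by
  rw [Ad, SU3.inv_coe, quarterTurn, ofSO3_coe, star_ofRealMat]
  ext i j
  simp only [Matrix.mul_apply, Fin.sum_univ_three, ofRealMat_apply, Matrix.transpose_apply]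
  fin_cases i <;> fin_cases j <;> apply Complex.ext <;> simp [pMat] <;> ring

theorem sigmaLie_pMat (v : Fin 7 → ℝ) : sigmaLie (pMat v) =
    pMat ![v 0 / 2 - Real.sqrt 3 / 2 * v 1, Real.sqrt 3 / 2 * v 0 + v 1 / 2,
      -(v 2 / 2 - Real.sqrt 3 / 2 * v 3), -(Real.sqrt 3 / 2 * v 2 + v 3 / 2),
      v 4 / 2 + Real.sqrt 3 / 2 * v 5, v 5 / 2 - Real.sqrt 3 / 2 * v 4, -v 6] := by
  rw [sigmaLie_entries]
  generalize Real.sqrt 3 / 2 = s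
  ext i j
  fin_cases i <;> fin_cases j <;> apply Complex.ext <;> simp [pMat] <;> ring

/-- The `Ad K_1`- and `σ̂`-invariant forms on `𝔭`. -/
def qform (a b c d : ℝ) (X Y : Mat) : ℝ :=
  a * ((X 1 0).re * (Y 1 0).re + (X 2 0).re * (Y 2 0).re) +
  c * ((X 1 0).im * (Y 1 0).im + (X 2 0).im * (Y 2 0).im) +
  b * (((X 1 1).im - (X 2 2).im) * ((Y 1 1).im - (Y 2 2).im) / 4 + (X 1 2).im * (Y 1 2).im) +
  d * ((X 0 0).im * (Y 0 0).im)

/-- The coordinates of `𝔭` fall into the blocks (0,1), (2,3), (4,5) and (6). The quarter turn in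
`K_1` acts on them as a rotation through `π/2`, the same rotation, `-1` and `+1`. The first two
blocks are separated by `σ̂`, which has different eigenvalues there, and `σ̂` also turns the third
block, which leaves only multiples of the standard product on it. This single element of `K_1` and
`σ̂` are all the invariance that is needed. -/
theorem InvariantMetric.exists_qform (B : InvariantMetric) : ∃ a b c d : ℝ, ∀ X Y : Mat,
    star X = -X → X.trace = 0 → star Y = -Y → Y.trace = 0 →
    B.form (projP X) (projP Y) = qform a b c d X Y := by
  obtain ⟨G, hG⟩ : ∃ G : Fin 7 → Fin 7 → ℝ,
      ∀ i j, B.form (pMat (Pi.single i 1)) (pMat (Pi.single j 1)) = G i j := ⟨_, fun _ _ => rfl⟩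
  have hexp : ∀ v w, B.form (pMat v) (pMat w) = ∑ i, ∑ j, v i * w j * G i j := by
    intro v w
    rw [pMat_eq_sum v, pMat_eq_sum w, map_sum B.form, LinearMap.sum_apply]
    refine Finset.sum_congr rfl fun i _ => ?_
    rw [map_sum]
    refine Finset.sum_congr rfl fun j _ => ?_
    rw [map_smul, map_smul, LinearMap.smul_apply, hG, smul_eq_mul, smul_eq_mul]
    ring
  have hsymm : ∀ i j, G i j = G j i := by
    intro i j
    rw [← hG, ← hG]
    exact B.symm _ (pMat_mem _) _ (pMat_mem _)
  have hK := fun v w =>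
    B.ad_invariant _ quarterTurn_mem _ (pMat_mem v) _ (pMat_mem w)
  have hS := fun v w => B.sigma_invariant _ (pMat_mem v) _ (pMat_mem w)
  simp only [Ad_quarterTurn, sigmaLie_pMat, hexp] at hK hS
  clear hG
  have h3 : (Real.sqrt 3 / 2) * (Real.sqrt 3 / 2) = 3 / 4 := by
    have := Real.mul_self_sqrt (show (0 : ℝ) ≤ 3 by norm_num)
    linarith
  generalize Real.sqrt 3 / 2 = s at *
  -- The quarter turn permutes the basis of `𝔭` up to sign; the two vectors list the signs and the
  -- permutation.
  have k : ∀ i j : Fin 7, (![1, -1, 1, -1, -1, -1, 1] i : ℝ) * (![1, -1, 1, -1, -1, -1, 1] j) *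
      G (![1, 0, 3, 2, 4, 5, 6] i) (![1, 0, 3, 2, 4, 5, 6] j) = G i j := by
    intro i j
    have := hK (Pi.single i 1) (Pi.single j 1)
    fin_cases i <;> fin_cases j <;> simpa [Fin.sum_univ_seven] using this
  have s02 := hS ![1, 0, 0, 0, 0, 0, 0] ![0, 0, 1, 0, 0, 0, 0]
  have s03 := hS ![1, 0, 0, 0, 0, 0, 0] ![0, 0, 0, 1, 0, 0, 0]
  have s44 := hS ![0, 0, 0, 0, 1, 0, 0] ![0, 0, 0, 0, 1, 0, 0]
  have s45 := hS ![0, 0, 0, 0, 1, 0, 0] ![0, 0, 0, 0, 0, 1, 0]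
  simp [Fin.sum_univ_seven] at s02 s03 s44 s45
  have y45 := hsymm 4 5
  have e01 : G 1 1 = G 0 0 := by simpa using k 0 0
  have e23 : G 3 3 = G 2 2 := by simpa using k 2 2
  have k02 := k 0 2
  have k03 := k 0 3
  simp at k02 k03
  have e45 : G 5 5 = G 4 4 := by clear k; grind
  have z45 : G 4 5 = 0 := by clear k; grind
  have z02 : G 0 2 = 0 := by clear k; grind
  have z03 : G 0 3 = 0 := by clear k; grind
  have zK : ∀ i j : Fin 7, i < j → G i j = 0 := by
    intro i j hij
    have k1 := k i j
    have k2 := k (![1, 0, 3, 2, 4, 5, 6] i) (![1, 0, 3, 2, 4, 5, 6] j)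
    have y := hsymm i j
    clear hK hS hsymm hexp s02 s03 s44 s45
    fin_cases i <;> fin_cases j <;> simp at hij <;> simp at k1 k2 y ⊢ <;> linarith
  have zK : ∀ i j : Fin 7, i ≠ j → G i j = 0 := by
    intro i j hij
    rcases lt_or_gt_of_ne hij with h | h
    · exact zK i j h
    · rw [hsymm]
      exact zK j i h
  -- The last coordinate is `-Im X₀₀ / 2`, hence the factor 1/4.
  refine ⟨G 0 0, G 4 4, G 2 2, G 6 6 / 4, fun X Y hX hXt hY hYt => ?_⟩
  have hdiag : ∀ v w : Fin 7 → ℝ, ∑ i, ∑ j, v i * w j * G i j = ∑ i, v i * w i * G i i := by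
    intro v w
    refine Finset.sum_congr rfl fun i _ => ?_
    rw [Finset.sum_eq_single i]
    · intro j _ hj
      rw [zK i j (Ne.symm hj), mul_zero]
    · simp
  rw [projP_eq_pMat hX hXt, projP_eq_pMat hY hYt, hexp, hdiag, Fin.sum_univ_seven, e01, e23, e45]
  simp [pCoord, qform]
  ring


/-! ### The Maurer-Cartan form of a frame -/

section MaurerCartan

variable {E : Type*} [NormedAddCommGroup E] [NormedSpace ℝ E]

/-- The conjugate transpose as a continuous real-linear map. -/
def starCLM : Mat →L[ℝ] Mat :=
  (Matrix.conjTransposeLinearEquiv (Fin 3) (Fin 3) ℝ ℂ).toLinearMap.toContinuousLinearMap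

/-- A matrix entry as a continuous real-linear map. -/
def entryCLM (i j : Fin 3) : Mat →L[ℝ] ℂ :=
  (Matrix.entryLinearMap ℝ ℂ i j).toContinuousLinearMap

/-- The pull-back `F⁻¹ dF` of the Maurer-Cartan form of `SU_3`. -/
def mcForm (F : E → SU3) (x X : E) : Mat :=
  (((F x)⁻¹ : SU3) : Mat) * fderiv ℝ (fun y => (F y : Mat)) x X

variable {F : E → SU3} {U : Set E} {x : E}

theorem fderiv_eq_mul_mcForm (F : E → SU3) (x X : E) :
    fderiv ℝ (fun y => (F y : Mat)) x X = (F x : Mat) * mcForm F x X := by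
  rw [mcForm, ← Matrix.mul_assoc, SU3.mul_inv, Matrix.one_mul]

theorem frame_hasFDerivAt (hU : IsOpen U) (hF : ContDiffOn ℝ ∞ (fun y => (F y : Mat)) U)
    (hx : x ∈ U) :
    HasFDerivAt (fun y => (F y : Mat)) (fderiv ℝ (fun y => (F y : Mat)) x) x :=
  ((hF.contDiffAt (hU.mem_nhds hx)).differentiableAt (by simp)).hasFDerivAt

theorem star_mcForm (hU : IsOpen U) (hF : ContDiffOn ℝ ∞ (fun y => (F y : Mat)) U)
    (hx : x ∈ U) (X : E) : star (mcForm F x X) = -mcForm F x X := by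
  have h1 := frame_hasFDerivAt hU hF hx
  have h2 : HasFDerivAt (fun y => star (F y : Mat))
      (starCLM.comp (fderiv ℝ (fun y => (F y : Mat)) x)) x := starCLM.hasFDerivAt.comp x h1
  have h3 := h2.mul' h1
  have h4 : (fun y => star (F y : Mat) * (F y : Mat)) = fun _ => 1 :=
    funext fun y => SU3.star_mul (F y)
  have h5 : HasFDerivAt (fun y => star (F y : Mat) * (F y : Mat)) (0 : E →L[ℝ] Mat) x := by
    rw [h4]
    exact hasFDerivAt_const _ _
  have h6 := DFunLike.congr_fun (h3.unique h5) X
  have h7 : star (F x : Mat) * fderiv ℝ (fun y => (F y : Mat)) x X +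
      star (fderiv ℝ (fun y => (F y : Mat)) x X) * (F x : Mat) = 0 := h6
  rw [eq_neg_iff_add_eq_zero, mcForm, SU3.inv_coe, StarMul.star_mul, star_star, add_comm]
  exact h7

/-- The trace is the derivative at `t = 0` of the determinant of `F(x)⁻¹ F(x + tX)`, which is
constantly one; the matrix itself is the identity at `t = 0`. -/
theorem trace_mcForm (hU : IsOpen U) (hF : ContDiffOn ℝ ∞ (fun y => (F y : Mat)) U)
    (hx : x ∈ U) (X : E) : (mcForm F x X).trace = 0 := by
  have h1 := (frame_hasFDerivAt hU hF hx).const_mul (((F x)⁻¹ : SU3) : Mat)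
  have h2 : ∀ i j, HasDerivAt
      (fun t : ℝ => ((((F x)⁻¹ : SU3) : Mat) * (F (x + t • X) : Mat)) i j) (mcForm F x X i j) 0 := by
    intro i j
    exact ((entryCLM i j).hasFDerivAt.comp x h1).hasLineDerivAt X
  have h0 : (((F x)⁻¹ : SU3) : Mat) * (F (x + (0 : ℝ) • X) : Mat) = 1 := by
    rw [zero_smul, add_zero, SU3.inv_mul]
  have hdet : ∀ t : ℝ, ((((F x)⁻¹ : SU3) : Mat) * (F (x + t • X) : Mat)).det = 1 := by
    intro t
    rw [Matrix.det_mul, (Matrix.mem_specialUnitaryGroup_iff.1 (F x)⁻¹.2).2,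
      (Matrix.mem_specialUnitaryGroup_iff.1 (F (x + t • X)).2).2, one_mul]
  generalize mcForm F x X = T at *
  generalize hG : (fun t : ℝ => (((F x)⁻¹ : SU3) : Mat) * (F (x + t • X) : Mat)) = G at *
  have hG' : ∀ t : ℝ, (((F x)⁻¹ : SU3) : Mat) * (F (x + t • X) : Mat) = G t :=
    fun t => congrFun hG t
  simp only [hG'] at h2 h0 hdet
  simp only [Matrix.det_fin_three] at hdet
  have h3 := (((((((h2 0 0).mul (h2 1 1)).mul (h2 2 2)).sub
    (((h2 0 0).mul (h2 1 2)).mul (h2 2 1))).sub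
    (((h2 0 1).mul (h2 1 0)).mul (h2 2 2))).add
    (((h2 0 1).mul (h2 1 2)).mul (h2 2 0))).add
    (((h2 0 2).mul (h2 1 0)).mul (h2 2 1))).sub
    (((h2 0 2).mul (h2 1 1)).mul (h2 2 0))
  have h4 := (h3.congr_of_eventuallyEq
    (Filter.Eventually.of_forall fun t => (hdet t).symm)).unique (hasDerivAt_const 0 (1 : ℂ))
  simp [h0] at h4
  rw [Matrix.trace_fin_three]
  linear_combination h4

theorem contDiffOn_inv (hF : ContDiffOn ℝ ∞ (fun y => (F y : Mat)) U) :
    ContDiffOn ℝ ∞ (fun y => (((F y)⁻¹ : SU3) : Mat)) U :=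
  starCLM.contDiff.comp_contDiffOn hF

theorem contDiffOn_fderiv_apply {G : Type*} [NormedAddCommGroup G] [NormedSpace ℝ G] {f : E → G}
    (hU : IsOpen U) (hf : ContDiffOn ℝ ∞ f U) (X : E) :
    ContDiffOn ℝ ∞ (fun y => fderiv ℝ f y X) U :=
  (hf.fderiv_of_isOpen hU (by simp)).clm_apply contDiffOn_const

theorem contDiffOn_mcForm (hU : IsOpen U) (hF : ContDiffOn ℝ ∞ (fun y => (F y : Mat)) U) (X : E) :
    ContDiffOn ℝ ∞ (fun y => mcForm F y X) U :=
  (contDiffOn_inv hF).mul (contDiffOn_fderiv_apply hU hF X)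

theorem two_le_infty : (2 : WithTop ℕ∞) ≤ ∞ := WithTop.coe_le_coe.2 le_top

theorem fderiv_fderiv_comm {G : Type*} [NormedAddCommGroup G] [NormedSpace ℝ G] {f : E → G}
    (hU : IsOpen U) (hf : ContDiffOn ℝ ∞ f U) (hx : x ∈ U) (X Y : E) :
    fderiv ℝ (fun y => fderiv ℝ f y Y) x X = fderiv ℝ (fun y => fderiv ℝ f y X) x Y := by
  have h1 : ContDiffAt ℝ ∞ f x := hf.contDiffAt (hU.mem_nhds hx)
  have h2 : IsSymmSndFDerivAt ℝ f x := h1.isSymmSndFDerivAt (by simpa using two_le_infty)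
  have h3 : DifferentiableAt ℝ (fderiv ℝ f) x :=
    (h1.fderiv_right (m := 1) (by rw [one_add_one_eq_two]; exact two_le_infty)).differentiableAt (by simp)
  rw [fderiv_clm_apply h3 (differentiableAt_const _), fderiv_clm_apply h3 (differentiableAt_const _)]
  simpa using h2 X Y

/-- Since `F⁻¹` is the adjoint of `F`, its derivative along `X` is `-θ(X) F⁻¹`. The remaining term
is a second derivative of `F`, symmetric in `X` and `Y`, so it drops out on antisymmetrizing. -/
theorem fderiv_mcForm (hU : IsOpen U) (hF : ContDiffOn ℝ ∞ (fun y => (F y : Mat)) U)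
    (hx : x ∈ U) (X Y : E) : fderiv ℝ (fun y => mcForm F y Y) x X =
      -(mcForm F x X * mcForm F x Y) + (((F x)⁻¹ : SU3) : Mat) *
        fderiv ℝ (fun y => fderiv ℝ (fun y => (F y : Mat)) y Y) x X := by
  have h1 := frame_hasFDerivAt hU hF hx
  have h2 : HasFDerivAt (fun y => (((F y)⁻¹ : SU3) : Mat))
      (starCLM.comp (fderiv ℝ (fun y => (F y : Mat)) x)) x := starCLM.hasFDerivAt.comp x h1
  have h3 : HasFDerivAt (fun y => fderiv ℝ (fun y => (F y : Mat)) y Y)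
      (fderiv ℝ (fun y => fderiv ℝ (fun y => (F y : Mat)) y Y) x) x :=
    (((contDiffOn_fderiv_apply hU hF Y).contDiffAt (hU.mem_nhds hx)).differentiableAt
      (by simp)).hasFDerivAt
  have h4 : fderiv ℝ (fun y => mcForm F y Y) x X = (((F x)⁻¹ : SU3) : Mat) *
      fderiv ℝ (fun y => fderiv ℝ (fun y => (F y : Mat)) y Y) x X +
      star (fderiv ℝ (fun y => (F y : Mat)) x X) * fderiv ℝ (fun y => (F y : Mat)) x Y :=
    DFunLike.congr_fun (h2.mul' h3).fderiv X
  rw [h4, fderiv_eq_mul_mcForm F x X, StarMul.star_mul, star_mcForm hU hF hx, Matrix.mul_assoc,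
    ← SU3.inv_coe]
  rw [add_comm, Matrix.neg_mul]
  rfl

/-- The Maurer-Cartan equation. -/
theorem maurerCartan (hU : IsOpen U) (hF : ContDiffOn ℝ ∞ (fun y => (F y : Mat)) U)
    (hx : x ∈ U) (X Y : E) : fderiv ℝ (fun y => mcForm F y Y) x X =
      fderiv ℝ (fun y => mcForm F y X) x Y +
        (mcForm F x Y * mcForm F x X - mcForm F x X * mcForm F x Y) := by
  rw [fderiv_mcForm hU hF hx X Y, fderiv_mcForm hU hF hx Y X]
  have h : fderiv ℝ (fun y => fderiv ℝ (fun y => (F y : Mat)) y Y) x X =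
    fderiv ℝ (fun y => fderiv ℝ (fun y => (F y : Mat)) y X) x Y := fderiv_fderiv_comm hU hF hx X Y
  rw [h]
  abel

end MaurerCartan


/-! ### The algebra of primitive maps -/

theorem SU3.Ad_inv_Ad (g : SU3) (X : Mat) : Ad g⁻¹ (Ad g X) = X := by
  rw [← Ad_mul, inv_mul_cancel, Ad]
  simp

theorem gHat_Ad {k : SU3} (hk : k ∈ K1) {j : ℕ} {X : Mat} (hX : X ∈ gHat j) : Ad k X ∈ gHat j := by
  refine ⟨?_, ?_⟩
  · rw [Ad, Matrix.trace_mul_comm, ← Matrix.mul_assoc, SU3.inv_mul, Matrix.one_mul]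
    exact hX.1
  · rw [sigmaLie_Ad hk, hX.2, Ad, Ad, Matrix.mul_smul, Matrix.smul_mul]

/-- The fibre of the bundle is defined with an arbitrary `g` over the point. As `ĝ_j` is stable
under `Ad K_1`, membership can be tested in any given frame. -/
theorem Ad_mem_gBundle_iff (g : SU3) (j : ℕ) (X : Mat) :
    Ad g X ∈ gBundle j (orbit g) ↔ X ∈ gHat j := by
  refine ⟨?_, fun h => ⟨g, rfl, X, h, rfl⟩⟩
  rintro ⟨h, e, Y, hY, hXY⟩
  have h1 : X = Ad (g⁻¹ * h) Y := by
    rw [Ad_mul, ← hXY, SU3.Ad_inv_Ad]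
  rw [h1]
  exact gHat_Ad (orbit_eq e.symm) hY

theorem Ad_injective (g : SU3) : Function.Injective (Ad g) :=
  Function.LeftInverse.injective (SU3.Ad_inv_Ad g)

theorem Ad_sub (g : SU3) (X Y : Mat) : Ad g (X - Y) = Ad g X - Ad g Y := by
  simp only [Ad, Matrix.mul_sub, Matrix.sub_mul]

theorem Ad_smul (g : SU3) (c : ℂ) (X : Mat) : Ad g (c • X) = c • Ad g X := by
  simp only [Ad, Matrix.mul_smul, Matrix.smul_mul]

/-- The values on `∂/∂x` of the forms `F⁻¹ dF` of frames of primitive maps. -/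
def primX (a1 a2 b1 b2 k : ℝ) : Mat :=
  !![0, ⟨-a1, 0⟩, ⟨-a2, 0⟩; ⟨a1, 0⟩, ⟨0, b1⟩, ⟨-k, b2⟩; ⟨a2, 0⟩, ⟨k, b2⟩, ⟨0, -b1⟩]

/-- The values on `∂/∂y` of the forms `F⁻¹ dF` of frames of primitive maps. -/
def primY (a1 a2 b1 b2 l : ℝ) : Mat :=
  !![0, ⟨a2, 0⟩, ⟨-a1, 0⟩; ⟨-a2, 0⟩, ⟨0, b2⟩, ⟨-l, -b1⟩; ⟨a1, 0⟩, ⟨l, -b1⟩, ⟨0, -b2⟩]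

/-- `A - i B` lies in `ĝ_0 ⊕ ĝ_1`, with `A` and `B` in `su_3`. -/
def IsPrimPair (A B : Mat) : Prop :=
  A = primX (A 1 0).re (A 2 0).re (A 1 1).im (A 1 2).im (A 2 1).re ∧
  B = primY (A 1 0).re (A 2 0).re (A 1 1).im (A 1 2).im (B 2 1).re

theorem IsPrimPair.exists_eq {A B : Mat} (h : IsPrimPair A B) :
    ∃ a1 a2 b1 b2 k l : ℝ, A = primX a1 a2 b1 b2 k ∧ B = primY a1 a2 b1 b2 l :=
  ⟨_, _, _, _, _, _, h.1, h.2⟩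

theorem projP_primX (a1 a2 b1 b2 k : ℝ) : projP (primX a1 a2 b1 b2 k) = primX a1 a2 b1 b2 0 := by
  rw [projP_eq]
  ext i j
  fin_cases i <;> fin_cases j <;> apply Complex.ext <;> simp [primX]

theorem projP_primY (a1 a2 b1 b2 l : ℝ) : projP (primY a1 a2 b1 b2 l) = primY a1 a2 b1 b2 0 := by
  rw [projP_eq]
  ext i j
  fin_cases i <;> fin_cases j <;> apply Complex.ext <;> simp [primY]

theorem IsPrimPair.mem_gHat {A B : Mat} (h : IsPrimPair A B) :
    (1 / 2 : ℂ) • (projP A - Complex.I • projP B) ∈ gHat 1 := by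
  obtain ⟨a1, a2, b1, b2, k, l, rfl, rfl⟩ := h.exists_eq
  rw [mem_gHat_one_iff, projP_primX, projP_primY]
  refine ⟨⟨a1 / 2, a2 / 2⟩, ⟨b2 / 2, b1 / 2⟩, ?_⟩
  ext i j
  simp only [Matrix.smul_apply, Matrix.sub_apply]
  fin_cases i <;> fin_cases j <;> apply Complex.ext <;> simp [primX, primY, g1Mat] <;> ring

set_option maxHeartbeats 1000000 in
-- As `A` and `B` are skew-Hermitian, `A - iB` determines both of them; comparing its entries with
-- those of `ĝ_1` leaves free only the real lower off-diagonal entries, which `projP` discards.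
theorem isPrimPair_of_mem {A B : Mat} (hA : star A = -A) (hB : star B = -B)
    (h : (1 / 2 : ℂ) • (projP A - Complex.I • projP B) ∈ gHat 1) : IsPrimPair A B := by
  have hA' := skew_entries hA
  have hB' := skew_entries hB
  obtain ⟨a, b, hab⟩ := (mem_gHat_one_iff _).1 h
  rw [projP_eq, projP_eq] at hab
  have e := fun i j => congrFun (congrFun hab i) j
  have r := fun i j => congrArg Complex.re (e i j)
  have m := fun i j => congrArg Complex.im (e i j)
  have r00 := r 0 0
  have m00 := m 0 0
  have r01 := r 0 1
  have m01 := m 0 1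
  have r02 := r 0 2
  have m02 := m 0 2
  have r10 := r 1 0
  have m10 := m 1 0
  have r20 := r 2 0
  have m20 := m 2 0
  have r11 := r 1 1
  have m11 := m 1 1
  have r12 := r 1 2
  have m12 := m 1 2
  have r22 := r 2 2
  have m22 := m 2 2
  simp [g1Mat] at r00 m00 r01 m01 r02 m02 r10 m10 r20 m20 r11 m11 r12 m12 r22 m22
  have a00 := hA' 0 0
  have a01 := hA' 0 1
  have a02 := hA' 0 2
  have a11 := hA' 1 1
  have a12 := hA' 1 2
  have a22 := hA' 2 2
  have b00 := hB' 0 0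
  have b01 := hB' 0 1
  have b02 := hB' 0 2
  have b11 := hB' 1 1
  have b12 := hB' 1 2
  have b22 := hB' 2 2
  clear hA hB hA' hB' h hab e r m
  constructor
  · ext i j
    fin_cases i <;> fin_cases j <;> apply Complex.ext <;> simp [primX] <;> linarith
  · ext i j
    fin_cases i <;> fin_cases j <;> apply Complex.ext <;> simp [primY] <;> linarith

section Algebra

variable {A B Ax Ay Bx By : Mat}

/-- The entries of the Maurer-Cartan equation of a frame of a primitive map. -/
theorem primPair_mc {a1 a2 b1 b2 k l a1x a2x b1x b2x lx a1y a2y b1y b2y ky : ℝ}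
    (mc : primY a1x a2x b1x b2x lx = primX a1y a2y b1y b2y ky +
      (primY a1 a2 b1 b2 l * primX a1 a2 b1 b2 k - primX a1 a2 b1 b2 k * primY a1 a2 b1 b2 l)) :
    (a2x + a1y = l * a2 - k * a1 ∧ a1x - a2y = l * a1 + k * a2) ∧
      b2x - b1y = -2 * (l * b2 + k * b1) ∧ b1x + b2y = 2 * (k * b2 - l * b1) := by
  have e := fun i j => congrFun (congrFun mc i) j
  simp only [Matrix.add_apply, Matrix.sub_apply, Matrix.mul_apply, Fin.sum_univ_three] at e
  -- For `α = a1 + i a2` and `β = b2 + i b1` the first pair of equations is `(∂x + i∂y)α = (l -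
  -- ik)α`, and the second is `(∂x + i∂y)β = -2(l - ik)β`.
  have r10 := congrArg Complex.re (e 1 0)
  have r20 := congrArg Complex.re (e 2 0)
  have m11 := congrArg Complex.im (e 1 1)
  have m12 := congrArg Complex.im (e 1 2)
  simp [primX, primY] at r10 r20 m11 m12
  refine ⟨⟨?_, ?_⟩, ?_, ?_⟩ <;> linarith

/-- The divergence of the form `F⁻¹ dF` of a frame of a primitive map. -/
theorem IsPrimPair.qform_div (h : IsPrimPair A B) (hx : IsPrimPair Ax Bx) (hy : IsPrimPair Ay By)
    (mc : Bx = Ay + (B * A - A * B)) {H : Mat} (hH : star H = -H) (a b c d : ℝ) :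
    qform a b c d (Ax + By) H =
      qform a b c d A (A * H - H * A) + qform a b c d B (B * H - H * B) := by
  have hH' := skew_entries hH
  obtain ⟨a1, a2, b1, b2, k, l, rfl, rfl⟩ := h.exists_eq
  obtain ⟨a1x, a2x, b1x, b2x, kx, lx, rfl, rfl⟩ := hx.exists_eq
  obtain ⟨a1y, a2y, b1y, b2y, ky, ly, rfl, rfl⟩ := hy.exists_eq
  obtain ⟨⟨e1, e2⟩, e3, e4⟩ := primPair_mc mc
  clear h hx hy mc
  have h00 : (H 0 0).re = 0 := by linarith [(hH' 0 0).1]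
  have h11 : (H 1 1).re = 0 := by linarith [(hH' 1 1).1]
  have h22 : (H 2 2).re = 0 := by linarith [(hH' 2 2).1]
  obtain ⟨-, h01⟩ := hH' 0 1
  obtain ⟨-, h02⟩ := hH' 0 2
  obtain ⟨h12, h12'⟩ := hH' 1 2
  simp only [qform, Matrix.add_apply, Matrix.sub_apply, Matrix.mul_apply, Fin.sum_univ_three]
  simp [primX, primY]
  simp only [h00, h11, h22, h01, h02, h12, h12']
  -- `A`, `B` and `Ax + By` have no component in the blocks weighted by `c` and `d`, so only the
  -- `∂̄`-equations weighted by `a` and `b` remain.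
  linear_combination a * (H 1 0).re * e2 + a * (H 2 0).re * e1 +
    b * ((H 1 1).im - (H 2 2).im) / 2 * e4 + b * (H 2 1).im * e3

/-- For `f = F e₁` the Laplacian is `F` applied to this column, so its shape means that `Δf` is a
real multiple of `f`. -/
theorem IsPrimPair.div_col (h : IsPrimPair A B) (hx : IsPrimPair Ax Bx) (hy : IsPrimPair Ay By)
    (mc : Bx = Ay + (B * A - A * B)) (i : Fin 3) :
    (A * A + B * B + Ax + By) i 0 =
      (![((-2 * ((A 1 0).re ^ 2 + (A 2 0).re ^ 2) : ℝ) : ℂ), 0, 0] : Fin 3 → ℂ) i := by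
  obtain ⟨a1, a2, b1, b2, k, l, rfl, rfl⟩ := h.exists_eq
  obtain ⟨a1x, a2x, b1x, b2x, kx, lx, rfl, rfl⟩ := hx.exists_eq
  obtain ⟨a1y, a2y, b1y, b2y, ky, ly, rfl, rfl⟩ := hy.exists_eq
  obtain ⟨⟨e1, e2⟩, e3, e4⟩ := primPair_mc mc
  clear h hx hy mc
  simp only [Matrix.add_apply, Matrix.mul_apply, Fin.sum_univ_three]
  fin_cases i <;> apply Complex.ext <;> simp [primX, primY, pow_two]
  · ring
  · linarith
  · linarith

/-- This is `(∂x + i∂y)(α²β) = 0`: the zero-order coefficients of the equations for `α` and `β` are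
`c` and `-2c`, and they cancel in the product. -/
theorem IsPrimPair.dbar (h : IsPrimPair A B) (hx : IsPrimPair Ax Bx) (hy : IsPrimPair Ay By)
    (mc : Bx = Ay + (B * A - A * B)) :
    let α : ℂ := ⟨(A 1 0).re, (A 2 0).re⟩
    let β : ℂ := ⟨(A 1 2).im, (A 1 1).im⟩
    let αx : ℂ := ⟨(Ax 1 0).re, (Ax 2 0).re⟩
    let βx : ℂ := ⟨(Ax 1 2).im, (Ax 1 1).im⟩
    let αy : ℂ := ⟨(Ay 1 0).re, (Ay 2 0).re⟩
    let βy : ℂ := ⟨(Ay 1 2).im, (Ay 1 1).im⟩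
    (2 * α * αx * β + α ^ 2 * βx) + Complex.I * (2 * α * αy * β + α ^ 2 * βy) = 0 := by
  obtain ⟨a1, a2, b1, b2, k, l, rfl, rfl⟩ := h.exists_eq
  obtain ⟨a1x, a2x, b1x, b2x, kx, lx, rfl, rfl⟩ := hx.exists_eq
  obtain ⟨a1y, a2y, b1y, b2y, ky, ly, rfl, rfl⟩ := hy.exists_eq
  obtain ⟨⟨e1, e2⟩, e3, e4⟩ := primPair_mc mc
  clear h hx hy mc
  intro α β αx βx αy βy
  apply Complex.ext
  · simp [α, β, αx, βx, αy, βy, pow_two, primX]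
    linear_combination 2 * (a1 * b2 - a2 * b1) * e2 - 2 * (a1 * b1 + a2 * b2) * e1 +
      (a1 ^ 2 - a2 ^ 2) * e3 - 2 * a1 * a2 * e4
  · simp [α, β, αx, βx, αy, βy, pow_two, primX]
    linear_combination 2 * (a1 * b2 - a2 * b1) * e1 + 2 * (a1 * b1 + a2 * b2) * e2 +
      (a1 ^ 2 - a2 ^ 2) * e4 + 2 * a1 * a2 * e3

end Algebra


/-! ### Differentials and metrics computed in frames -/

section Frames

variable {E : Type*} [NormedAddCommGroup E] [NormedSpace ℝ E]

/-- `F` is a smooth frame of `u` on the open set `U`. -/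
structure FrameOn (u : E → FL1) (F : E → SU3) (U : Set E) : Prop where
  isOpen : IsOpen U
  contDiffOn : ContDiffOn ℝ ∞ (fun y => (F y : Mat)) U
  orbit_eq : ∀ y ∈ U, orbit (F y) = u y

theorem IsFrameAt.exists_frameOn {u : E → FL1} {F : E → SU3} {x : E} (h : IsFrameAt u F x) :
    ∃ U, x ∈ U ∧ FrameOn u F U :=
  let ⟨U, h1, h2, h3, h4⟩ := h
  ⟨U, h2, h1, h3, h4⟩

theorem FrameOn.isFrameAt {u : E → FL1} {F : E → SU3} {U : Set E} (h : FrameOn u F U) {x : E}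
    (hx : x ∈ U) : IsFrameAt u F x := ⟨U, h.isOpen, hx, h.contDiffOn, h.orbit_eq⟩

theorem FrameOn.differential {u : E → FL1} {F : E → SU3} {U : Set E} (h : FrameOn u F U) {x : E}
    (hx : x ∈ U) (X : E) : differential u x X = Ad (F x) (projP (mcForm F x X)) :=
  differential_eq (h.isFrameAt hx) X

theorem SmoothOn.exists_frameOn {u : E → FL1} {s : Set E} (h : SmoothOn u s) {x : E} (hx : x ∈ s) :
    ∃ F U, x ∈ U ∧ FrameOn u F U :=
  let ⟨F, hF⟩ := h x hx
  ⟨F, hF.exists_frameOn⟩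

/-- The inner product of two partial derivatives of a map into `FL1`. -/
def metricPair (B : InvariantMetric) (u : E → FL1) (x X Y : E) : ℝ :=
  B.inner (u x) (differential u x X) (differential u x Y)

theorem FrameOn.metricPair {B : InvariantMetric} {a b c d : ℝ}
    (hB : ∀ X Y : Mat, star X = -X → X.trace = 0 → star Y = -Y → Y.trace = 0 →
      B.form (projP X) (projP Y) = qform a b c d X Y)
    {u : E → FL1} {F : E → SU3} {U : Set E} (h : FrameOn u F U) {x : E} (hx : x ∈ U) (X Y : E) :
    metricPair B u x X Y = qform a b c d (mcForm F x X) (mcForm F x Y) := by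
  have hs := star_mcForm h.isOpen h.contDiffOn hx
  have ht := trace_mcForm h.isOpen h.contDiffOn hx
  have hm : ∀ X, projP (mcForm F x X) ∈ pHat := by
    intro X
    rw [projP_eq_pMat (hs X) (ht X)]
    exact pMat_mem _
  rw [SLCone.metricPair, h.differential hx, h.differential hx, ← h.orbit_eq x hx,
    B.inner_eq _ (hm X) (hm Y), hB _ _ (hs X) (ht X) (hs Y) (ht Y)]

/-- The real part of a matrix entry as a continuous linear map. -/
def reEntryCLM (i j : Fin 3) : Mat →L[ℝ] ℝ := Complex.reCLM.comp (entryCLM i j)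

/-- The imaginary part of a matrix entry as a continuous linear map. -/
def imEntryCLM (i j : Fin 3) : Mat →L[ℝ] ℝ := Complex.imCLM.comp (entryCLM i j)

theorem contDiffOn_re {f : E → Mat} {U : Set E} (hf : ContDiffOn ℝ ∞ f U) (i j : Fin 3) :
    ContDiffOn ℝ ∞ (fun x => (f x i j).re) U := (reEntryCLM i j).contDiff.comp_contDiffOn hf

theorem contDiffOn_im {f : E → Mat} {U : Set E} (hf : ContDiffOn ℝ ∞ f U) (i j : Fin 3) :
    ContDiffOn ℝ ∞ (fun x => (f x i j).im) U := (imEntryCLM i j).contDiff.comp_contDiffOn hf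

theorem contDiffOn_qform (a b c d : ℝ) {f g : E → Mat} {U : Set E} (hf : ContDiffOn ℝ ∞ f U)
    (hg : ContDiffOn ℝ ∞ g U) : ContDiffOn ℝ ∞ (fun x => qform a b c d (f x) (g x)) U := by
  have hfr := contDiffOn_re hf
  have hgr := contDiffOn_re hg
  have hfi := contDiffOn_im hf
  have hgi := contDiffOn_im hg
  exact (((contDiffOn_const.mul (((hfr 1 0).mul (hgr 1 0)).add ((hfr 2 0).mul (hgr 2 0)))).add
    (contDiffOn_const.mul (((hfi 1 0).mul (hgi 1 0)).add ((hfi 2 0).mul (hgi 2 0))))).add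
    (contDiffOn_const.mul (((((hfi 1 1).sub (hfi 2 2)).mul ((hgi 1 1).sub (hgi 2 2))).div_const
      4).add ((hfi 1 2).mul (hgi 1 2))))).add (contDiffOn_const.mul ((hfi 0 0).mul (hgi 0 0)))

theorem hasLineDerivAt_re {f : E → Mat} {x : E} (hf : DifferentiableAt ℝ f x) (X : E)
    (i j : Fin 3) : HasDerivAt (fun t : ℝ => (f (x + t • X) i j).re) (fderiv ℝ f x X i j).re 0 :=
  ((reEntryCLM i j).hasFDerivAt.comp x hf.hasFDerivAt).hasLineDerivAt X

theorem hasLineDerivAt_im {f : E → Mat} {x : E} (hf : DifferentiableAt ℝ f x) (X : E)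
    (i j : Fin 3) : HasDerivAt (fun t : ℝ => (f (x + t • X) i j).im) (fderiv ℝ f x X i j).im 0 :=
  ((imEntryCLM i j).hasFDerivAt.comp x hf.hasFDerivAt).hasLineDerivAt X

theorem fderiv_qform (a b c d : ℝ) {f g : E → Mat} {x : E} {U : Set E} (hU : IsOpen U)
    (hx : x ∈ U) (hf : ContDiffOn ℝ ∞ f U) (hg : ContDiffOn ℝ ∞ g U) (X : E) :
    fderiv ℝ (fun x => qform a b c d (f x) (g x)) x X =
      qform a b c d (f x) (fderiv ℝ g x X) + qform a b c d (fderiv ℝ f x X) (g x) := by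
  have hf' := (hf.contDiffAt (hU.mem_nhds hx)).differentiableAt (by simp)
  have hg' := (hg.contDiffAt (hU.mem_nhds hx)).differentiableAt (by simp)
  have h1 := ((((contDiffOn_qform a b c d hf hg).contDiffAt (hU.mem_nhds hx)).differentiableAt
    (by simp)).hasFDerivAt).hasLineDerivAt X
  have hfr := hasLineDerivAt_re hf' X
  have hgr := hasLineDerivAt_re hg' X
  have hfi := hasLineDerivAt_im hf' X
  have hgi := hasLineDerivAt_im hg' X
  have h2 := (((((((hfr 1 0).mul (hgr 1 0)).add ((hfr 2 0).mul (hgr 2 0)))).const_mul a).add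
    ((((hfi 1 0).mul (hgi 1 0)).add ((hfi 2 0).mul (hgi 2 0))).const_mul c)).add
    (((((((hfi 1 1).sub (hfi 2 2)).mul ((hgi 1 1).sub (hgi 2 2))).div_const
      4).add ((hfi 1 2).mul (hgi 1 2)))).const_mul b)).add (((hfi 0 0).mul (hgi 0 0)).const_mul d)
  refine (HasDerivAt.unique h1 h2).trans ?_
  simp only [qform, zero_smul, add_zero, Pi.sub_apply]
  ring

theorem qform_comm (a b c d : ℝ) (X Y : Mat) : qform a b c d X Y = qform a b c d Y X := by
  simp only [qform]
  ring

theorem contDiffOn_metricPair (B : InvariantMetric) {u : E → FL1} {s : Set E}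
    (hu : SmoothOn u s) (X Y : E) : ContDiffOn ℝ ∞ (fun x => metricPair B u x X Y) s := by
  obtain ⟨a, b, c, d, hB⟩ := B.exists_qform
  intro x hx
  obtain ⟨F, U, hxU, hF⟩ := hu.exists_frameOn hx
  refine ContDiffAt.contDiffWithinAt (ContDiffAt.congr_of_eventuallyEq
    ((contDiffOn_qform a b c d (contDiffOn_mcForm hF.isOpen hF.contDiffOn X)
      (contDiffOn_mcForm hF.isOpen hF.contDiffOn Y)).contDiffAt (hF.isOpen.mem_nhds hxU)) ?_)
  filter_upwards [hF.isOpen.mem_nhds hxU] with y hy using hF.metricPair hB hy X Y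

end Frames

theorem PrimitiveOn.isPrimPair {u : ℂ → FL1} {Ω : Set ℂ} (hu : PrimitiveOn u Ω) {F : ℂ → SU3}
    {U : Set ℂ} (hF : FrameOn u F U) {z : ℂ} (hz : z ∈ U) (hz' : z ∈ Ω) :
    IsPrimPair (mcForm F z 1) (mcForm F z Complex.I) := by
  have h := (hu.2 z hz').2
  rw [hF.differential hz, hF.differential hz, ← hF.orbit_eq z hz, ← Ad_smul, ← Ad_sub, ← Ad_smul,
    Ad_mem_gBundle_iff] at h
  exact isPrimPair_of_mem (star_mcForm hF.isOpen hF.contDiffOn hz _)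
    (star_mcForm hF.isOpen hF.contDiffOn hz _) h

/-- The projection onto the matrices `primX`. -/
def primXMap : Mat →ₗ[ℝ] Mat where
  toFun A := primX (A 1 0).re (A 2 0).re (A 1 1).im (A 1 2).im (A 2 1).re
  map_add' A B := by
    ext i j
    simp only [Matrix.add_apply]
    fin_cases i <;> fin_cases j <;> apply Complex.ext <;> simp [primX] <;> ring
  map_smul' r A := by
    ext i j
    simp only [Matrix.smul_apply]
    fin_cases i <;> fin_cases j <;> apply Complex.ext <;> simp [primX]

/-- The projection onto the matrices `primY`. -/
def primYMap : Mat × Mat →ₗ[ℝ] Mat where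
  toFun A := primY (A.1 1 0).re (A.1 2 0).re (A.1 1 1).im (A.1 1 2).im (A.2 2 1).re
  map_add' A B := by
    ext i j
    simp only [Prod.fst_add, Prod.snd_add, Matrix.add_apply]
    fin_cases i <;> fin_cases j <;> apply Complex.ext <;> simp [primY] <;> ring
  map_smul' r A := by
    ext i j
    simp only [Prod.smul_fst, Prod.smul_snd, Matrix.smul_apply]
    fin_cases i <;> fin_cases j <;> apply Complex.ext <;> simp [primY]

/-- The condition says that the pair is reproduced by the fixed linear maps `primXMap` and
`primYMap`, and these commute with differentiation. -/
theorem isPrimPair_fderiv {E : Type*} [NormedAddCommGroup E] [NormedSpace ℝ E] {A B : E → Mat}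
    {z : E} (hA : DifferentiableAt ℝ A z) (hB : DifferentiableAt ℝ B z)
    (h : ∀ᶠ y in nhds z, IsPrimPair (A y) (B y)) (v : E) :
    IsPrimPair (fderiv ℝ A z v) (fderiv ℝ B z v) := by
  constructor
  · have h1 : A =ᶠ[nhds z] fun y => primXMap.toContinuousLinearMap (A y) := by
      filter_upwards [h] with y hy using hy.1
    have h2 := (primXMap.toContinuousLinearMap.hasFDerivAt.comp z hA.hasFDerivAt).congr_of_eventuallyEq
      h1
    exact DFunLike.congr_fun h2.fderiv v
  · have h1 : B =ᶠ[nhds z] fun y => primYMap.toContinuousLinearMap (A y, B y) := by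
      filter_upwards [h] with y hy using hy.2
    have h2 := (primYMap.toContinuousLinearMap.hasFDerivAt.comp z
      (hA.hasFDerivAt.prodMk hB.hasFDerivAt)).congr_of_eventuallyEq h1
    exact DFunLike.congr_fun h2.fderiv v


/-! ### Integrals of divergences -/

theorem integral_fderiv_eq_zero {P : ℂ → ℝ} (hP : ContDiff ℝ 1 P) (hc : HasCompactSupport P)
    (v : ℂ) : ∫ z, fderiv ℝ P z v = 0 := by
  have hcont : Continuous fun z => fderiv ℝ P z v :=
    (hP.continuous_fderiv (by simp)).clm_apply continuous_const
  have h := integral_mul_fderiv_eq_neg_fderiv_mul_of_integrable (E := ℂ)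
    (μ := MeasureTheory.volume) (f := fun _ : ℂ => (1 : ℝ)) (g := P) (v := v)
    (by simp)
    (by simpa using hcont.integrable_of_hasCompactSupport (hc.fderiv_apply (𝕜 := ℝ) v))
    (by simpa using hP.continuous.integrable_of_hasCompactSupport hc)
    (fun x _ => differentiableAt_const _)
    (fun x _ => (hP.differentiable (by simp)) x)
  simpa using h

/-- Nothing is known of `P` outside `Ω`. Its extension by zero from `K` is `C¹`, because it equals
`P` on the open set `Ω` and zero on the complement of `K`, and these two cover the plane. -/
theorem setIntegral_fderiv_eq_zero {P : ℂ → ℝ} {Ω K : Set ℂ} (hΩ : IsOpen Ω)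
    (hP : ContDiffOn ℝ ∞ P Ω) (hK : IsCompact K) (hKΩ : K ⊆ Ω) (h0 : ∀ z ∈ Ω \ K, P z = 0)
    (v : ℂ) : ∫ z in K, fderiv ℝ P z v = 0 := by
  classical
  set Q : ℂ → ℝ := K.indicator P with hQ
  have hQΩ : ∀ z ∈ Ω, Q z = P z := by
    intro z hz
    by_cases hzK : z ∈ K
    · rw [hQ, Set.indicator_of_mem hzK]
    · rw [hQ, Set.indicator_of_notMem hzK, h0 z ⟨hz, hzK⟩]
  have hQK : ∀ z ∈ Kᶜ, Q z = 0 := fun z hz => Set.indicator_of_notMem hz _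
  have hQd : ContDiff ℝ 1 Q := by
    rw [contDiff_iff_contDiffAt]
    intro z
    by_cases hz : z ∈ Ω
    · refine (((hP.contDiffAt (hΩ.mem_nhds hz)).of_le (by simp)).congr_of_eventuallyEq ?_)
      filter_upwards [hΩ.mem_nhds hz] with y hy using hQΩ y hy
    · have hzK : z ∈ Kᶜ := fun h => hz (hKΩ h)
      refine ContDiffAt.congr_of_eventuallyEq (f := fun _ => (0 : ℝ)) contDiffAt_const ?_
      filter_upwards [hK.isClosed.isOpen_compl.mem_nhds hzK] with y hy using hQK y hy
  have hQc : HasCompactSupport Q := HasCompactSupport.intro hK fun z hz => hQK z hz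
  have h1 : ∀ z ∈ K, fderiv ℝ P z v = fderiv ℝ Q z v := by
    intro z hz
    have : P =ᶠ[nhds z] Q := by
      filter_upwards [hΩ.mem_nhds (hKΩ hz)] with y hy using (hQΩ y hy).symm
    rw [this.fderiv_eq]
  rw [MeasureTheory.setIntegral_congr_fun hK.measurableSet h1,
    MeasureTheory.setIntegral_eq_integral_of_forall_compl_eq_zero, integral_fderiv_eq_zero hQd hQc]
  intro z hz
  have : Q =ᶠ[nhds z] fun _ => 0 := by
    filter_upwards [hK.isClosed.isOpen_compl.mem_nhds hz] with y hy using hQK y hy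
  rw [this.fderiv_eq]
  simp

/-- Differentiation under the integral over a compact set. -/
theorem hasDerivAt_setIntegral {e : ℝ × ℂ → ℝ} {Ω K : Set ℂ} (hΩ : IsOpen Ω)
    (he : ContDiffOn ℝ ∞ e (Set.univ ×ˢ Ω)) (hK : IsCompact K) (hKΩ : K ⊆ Ω) :
    HasDerivAt (fun t => ∫ z in K, e (t, z)) (∫ z in K, fderiv ℝ e (0, z) (1, 0)) 0 := by
  have hO : IsOpen (Set.univ ×ˢ Ω : Set (ℝ × ℂ)) := isOpen_univ.prod hΩ
  have hd : ContinuousOn (fun p : ℝ × ℂ => fderiv ℝ e p (1, 0)) (Set.univ ×ˢ Ω) :=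
    (contDiffOn_fderiv_apply hO he _).continuousOn
  have hsub : Set.Icc (-1 : ℝ) 1 ×ˢ K ⊆ Set.univ ×ˢ Ω := Set.prod_mono (Set.subset_univ _) hKΩ
  obtain ⟨C, hC⟩ := (isCompact_Icc.prod hK).exists_bound_of_continuousOn (hd.mono hsub)
  have hslice : ∀ t : ℝ, ContinuousOn (fun z : ℂ => ((t, z) : ℝ × ℂ)) K :=
    fun t => (Continuous.prodMk_right t).continuousOn
  have hmem : ∀ t : ℝ, ∀ z ∈ K, ((t, z) : ℝ × ℂ) ∈ (Set.univ ×ˢ Ω : Set (ℝ × ℂ)) :=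
    fun t z hz => ⟨trivial, hKΩ hz⟩
  have hcont : ∀ t : ℝ, ContinuousOn (fun z : ℂ => e (t, z)) K :=
    fun t => he.continuousOn.comp (hslice t) (hmem t)
  have hcont' : ContinuousOn (fun z : ℂ => fderiv ℝ e (0, z) (1, 0)) K :=
    hd.comp (hslice 0) (hmem 0)
  refine (hasDerivAt_integral_of_dominated_loc_of_deriv_le
    (F := fun t z => e (t, z)) (F' := fun t z => fderiv ℝ e (t, z) (1, 0))
    (μ := MeasureTheory.volume.restrict K) (bound := fun _ => C) (s := Set.Icc (-1) 1)
    (Icc_mem_nhds (by norm_num) (by norm_num)) ?_ ?_ ?_ ?_ ?_ ?_).2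
  · exact Filter.Eventually.of_forall fun t =>
      (hcont t).aestronglyMeasurable hK.measurableSet
  · exact (hcont 0).integrableOn_compact hK
  · exact hcont'.aestronglyMeasurable hK.measurableSet
  · refine (MeasureTheory.ae_restrict_iff' hK.measurableSet).2 (Filter.Eventually.of_forall ?_)
    intro z hz t ht
    exact hC (t, z) ⟨ht, hz⟩
  · have : MeasureTheory.IsFiniteMeasure (MeasureTheory.volume.restrict K) :=
      ⟨by simpa using hK.measure_lt_top⟩
    exact MeasureTheory.integrable_const C
  · refine (MeasureTheory.ae_restrict_iff' hK.measurableSet).2 (Filter.Eventually.of_forall ?_)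
    intro z hz t _
    have h1 : HasFDerivAt e (fderiv ℝ e (t, z)) (t, z) :=
      ((he.contDiffAt (hO.mem_nhds (hmem t z hz))).differentiableAt (by simp)).hasFDerivAt
    have h2 : HasDerivAt (fun s : ℝ => ((s, z) : ℝ × ℂ)) (1, 0) t :=
      (hasDerivAt_id t).prodMk (hasDerivAt_const t z)
    exact h1.comp_hasDerivAt t h2

/-! ### Variations -/

theorem mcForm_slice {F : ℝ × ℂ → SU3} {U : Set (ℝ × ℂ)} (hU : IsOpen U)
    (hF : ContDiffOn ℝ ∞ (fun y => (F y : Mat)) U) {t : ℝ} {z : ℂ} (hz : (t, z) ∈ U) (v : ℂ) :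
    mcForm (fun y => F (t, y)) z v = mcForm F (t, z) (0, v) := by
  have h2 : HasFDerivAt (fun y : ℂ => ((t, y) : ℝ × ℂ)) (ContinuousLinearMap.inr ℝ ℝ ℂ) z :=
    hasFDerivAt_prodMk_right t z
  have h3 := ((frame_hasFDerivAt hU hF hz).comp z h2).fderiv
  have h4 : fderiv ℝ (fun y : ℂ => (F (t, y) : Mat)) z v =
    fderiv ℝ (fun y => (F y : Mat)) (t, z) (0, v) := DFunLike.congr_fun h3 v
  rw [mcForm, h4]
  rfl

theorem fderiv_slice {G : Type*} [NormedAddCommGroup G] [NormedSpace ℝ G] {f : ℝ × ℂ → G} {t : ℝ}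
    {z : ℂ} (hf : DifferentiableAt ℝ f (t, z)) (v : ℂ) :
    fderiv ℝ (fun y => f (t, y)) z v = fderiv ℝ f (t, z) (0, v) := by
  have h2 : HasFDerivAt (fun y : ℂ => ((t, y) : ℝ × ℂ)) (ContinuousLinearMap.inr ℝ ℝ ℂ) z :=
    hasFDerivAt_prodMk_right t z
  exact DFunLike.congr_fun (hf.hasFDerivAt.comp z h2).fderiv v

theorem FrameOn.slice {Ψ : ℝ → ℂ → FL1} {F : ℝ × ℂ → SU3} {U : Set (ℝ × ℂ)}
    (hF : FrameOn (fun p : ℝ × ℂ => Ψ p.1 p.2) F U) (t : ℝ) :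
    FrameOn (Ψ t) (fun y => F (t, y)) {y | (t, y) ∈ U} where
  isOpen := hF.isOpen.preimage (Continuous.prodMk_right t)
  contDiffOn := hF.contDiffOn.comp (contDiff_prodMk_right t).contDiffOn fun _ h => h
  orbit_eq y hy := hF.orbit_eq (t, y) hy

theorem energyDensity_eq (B : InvariantMetric) {Ψ : ℝ → ℂ → FL1} {t : ℝ} {z : ℂ}
    {F : ℝ × ℂ → SU3} {U : Set (ℝ × ℂ)} (hF : FrameOn (fun p : ℝ × ℂ => Ψ p.1 p.2) F U)
    (hz : (t, z) ∈ U) : energyDensity B (Ψ t) z =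
      (metricPair B (fun p : ℝ × ℂ => Ψ p.1 p.2) (t, z) (0, 1) (0, 1) +
        metricPair B (fun p : ℝ × ℂ => Ψ p.1 p.2) (t, z) (0, Complex.I) (0, Complex.I)) / 2 := by
  have h1 : ∀ v, differential (Ψ t) z v =
      differential (fun p : ℝ × ℂ => Ψ p.1 p.2) (t, z) (0, v) := by
    intro v
    rw [hF.differential hz, (hF.slice t).differential hz, mcForm_slice hF.isOpen hF.contDiffOn hz]
  simp only [energyDensity, metricPair, h1]

/-- The first variation formula for a primitive map. -/
theorem PrimitiveOn.fderiv_energy (B : InvariantMetric) {u : ℂ → FL1} {Ω : Set ℂ} (hΩ : IsOpen Ω)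
    (hu : PrimitiveOn u Ω) {Ψ : ℝ → ℂ → FL1}
    (hs : SmoothOn (fun p : ℝ × ℂ => Ψ p.1 p.2) (Set.univ ×ˢ Ω)) (h0 : ∀ z ∈ Ω, Ψ 0 z = u z)
    {z : ℂ} (hz : z ∈ Ω) :
    fderiv ℝ (fun p : ℝ × ℂ => (metricPair B (fun p : ℝ × ℂ => Ψ p.1 p.2) p (0, 1) (0, 1) +
        metricPair B (fun p : ℝ × ℂ => Ψ p.1 p.2) p (0, Complex.I) (0, Complex.I)) / 2)
        (0, z) (1, 0) =
      fderiv ℝ (fun y => metricPair B (fun p : ℝ × ℂ => Ψ p.1 p.2) (0, y) (0, 1) (1, 0)) z 1 +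
      fderiv ℝ (fun y => metricPair B (fun p : ℝ × ℂ => Ψ p.1 p.2) (0, y) (0, Complex.I) (1, 0))
        z Complex.I := by
  set Φ : ℝ × ℂ → FL1 := fun p => Ψ p.1 p.2 with hΦ
  obtain ⟨a, b, c, d, hB⟩ := B.exists_qform
  have hO : IsOpen (Set.univ ×ˢ Ω : Set (ℝ × ℂ)) := isOpen_univ.prod hΩ
  have hm : ((0, z) : ℝ × ℂ) ∈ (Set.univ ×ˢ Ω : Set (ℝ × ℂ)) := ⟨trivial, hz⟩
  obtain ⟨F, U, hzU, hF⟩ := hs.exists_frameOn hm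
  have hd : ∀ X Y, DifferentiableAt ℝ (fun p => metricPair B Φ p X Y) (0, z) := fun X Y =>
    ((contDiffOn_metricPair B hs X Y).contDiffAt (hO.mem_nhds hm)).differentiableAt (by simp)
  have hθ := fun X => contDiffOn_mcForm hF.isOpen hF.contDiffOn X
  have hθd : ∀ X, DifferentiableAt ℝ (fun p => mcForm F p X) (0, z) := fun X =>
    ((hθ X).contDiffAt (hF.isOpen.mem_nhds hzU)).differentiableAt (by simp)
  have hmp : ∀ X Y V, fderiv ℝ (fun p => metricPair B Φ p X Y) (0, z) V =
      qform a b c d (mcForm F (0, z) X) (fderiv ℝ (fun p => mcForm F p Y) (0, z) V) +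
      qform a b c d (fderiv ℝ (fun p => mcForm F p X) (0, z) V) (mcForm F (0, z) Y) := by
    intro X Y V
    have h1 : (fun p => metricPair B Φ p X Y) =ᶠ[nhds (0, z)]
        fun p => qform a b c d (mcForm F p X) (mcForm F p Y) := by
      filter_upwards [hF.isOpen.mem_nhds hzU] with p hp using hF.metricPair hB hp X Y
    rw [h1.fderiv_eq, fderiv_qform a b c d hF.isOpen hzU (hθ X) (hθ Y)]
  -- the frame of `u`
  have hslice : FrameOn u (fun y => F (0, y)) ({y | (0, y) ∈ U} ∩ Ω) :=
    ⟨(hF.slice 0).isOpen.inter hΩ, (hF.slice 0).contDiffOn.mono Set.inter_subset_left,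
      fun y hy => ((hF.slice 0).orbit_eq y hy.1).trans (h0 y hy.2)⟩
  have hprim : ∀ y, (0, y) ∈ U → y ∈ Ω →
      IsPrimPair (mcForm F (0, y) (0, 1)) (mcForm F (0, y) (0, Complex.I)) := by
    intro y hy hy'
    have := hu.isPrimPair hslice ⟨hy, hy'⟩ hy'
    rwa [mcForm_slice hF.isOpen hF.contDiffOn hy, mcForm_slice hF.isOpen hF.contDiffOn hy] at this
  have hev : ∀ᶠ y in nhds z,
      IsPrimPair (mcForm F (0, y) (0, 1)) (mcForm F (0, y) (0, Complex.I)) := by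
    filter_upwards [hslice.isOpen.mem_nhds ⟨hzU, hz⟩] with y hy using hprim y hy.1 hy.2
  have hsd : ∀ X, DifferentiableAt ℝ (fun y : ℂ => mcForm F (0, y) X) z := fun X =>
    (hθd X).comp z (hasFDerivAt_prodMk_right (0 : ℝ) z).differentiableAt
  have hD : ∀ v : ℂ, IsPrimPair (fderiv ℝ (fun p => mcForm F p (0, 1)) (0, z) (0, v))
      (fderiv ℝ (fun p => mcForm F p (0, Complex.I)) (0, z) (0, v)) := by
    intro v
    have h1 := isPrimPair_fderiv (hsd _) (hsd _) hev v
    have h2 : ∀ X, fderiv ℝ (fun y => mcForm F (0, y) X) z v =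
      fderiv ℝ (fun p => mcForm F p X) (0, z) (0, v) := fun X => fderiv_slice (hθd X) v
    rwa [h2, h2] at h1
  have hmc := maurerCartan hF.isOpen hF.contDiffOn hzU
  have key := (hprim z hzU hz).qform_div (hD 1) (hD Complex.I) (hmc (0, 1) (0, Complex.I))
    (star_mcForm hF.isOpen hF.contDiffOn hzU (1, 0)) a b c d
  have hE : fderiv ℝ (fun p : ℝ × ℂ => (metricPair B Φ p (0, 1) (0, 1) +
        metricPair B Φ p (0, Complex.I) (0, Complex.I)) / 2) (0, z) (1, 0) =
      (fderiv ℝ (fun p => metricPair B Φ p (0, 1) (0, 1)) (0, z) (1, 0) +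
        fderiv ℝ (fun p => metricPair B Φ p (0, Complex.I) (0, Complex.I)) (0, z) (1, 0)) / 2 := by
    have h1 := (((hd (0, 1) (0, 1)).hasFDerivAt.add
      (hd (0, Complex.I) (0, Complex.I)).hasFDerivAt).mul_const (2⁻¹ : ℝ)).fderiv
    have h2 := DFunLike.congr_fun h1 (1, 0)
    simp only [div_eq_mul_inv]
    refine Eq.trans h2 ?_
    simp
    ring
  -- With `H = θ(∂t)`, Maurer-Cartan gives `∂t θ(∂x) = ∂x H + [θ(∂x), H]` and likewise for `y`. By
  -- the product rule the terms `∂x H`, `∂y H` make up the divergence, except for the pairing of `H`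
  -- with `∂x θ(∂x) + ∂y θ(∂y)`; `key` cancels it against the brackets.
  rw [hE, fderiv_slice (hd _ _), fderiv_slice (hd _ _), hmp, hmp, hmp, hmp, hmc (1, 0) (0, 1),
    hmc (1, 0) (0, Complex.I)]
  have hadd : ∀ X Y Z, qform a b c d (X + Y) Z = qform a b c d X Z + qform a b c d Y Z :=
    fun X Y Z => by simp [qform]; ring
  rw [hadd] at key
  have hcomm := qform_comm a b c d
  generalize mcForm F (0, z) (0, 1) = θx at *
  generalize mcForm F (0, z) (0, Complex.I) = θy at *
  generalize mcForm F (0, z) (1, 0) = H at *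
  have hadd' : ∀ X Y Z, qform a b c d X (Y + Z) = qform a b c d X Y + qform a b c d X Z :=
    fun X Y Z => by rw [hcomm, hadd, hcomm Y, hcomm Z]
  simp only [hadd, hadd']
  linear_combination (1 / 2) * hcomm (fderiv ℝ (fun p => mcForm F p (1, 0)) (0, z) (0, 1)) θx +
    (1 / 2) * hcomm (fderiv ℝ (fun p => mcForm F p (1, 0)) (0, z) (0, Complex.I)) θy +
    (1 / 2) * hcomm (θx * H - H * θx) θx + (1 / 2) * hcomm (θy * H - H * θy) θy - key

theorem Ad_zero (g : SU3) : Ad g 0 = 0 := by simp [Ad]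

theorem projP_zero : projP 0 = 0 := by simp [projP]

/-- At `t = 0` the derivative of the energy density is the divergence of the pairing of `du` with
the variation field. That pairing vanishes off `K`, so the integral over `K` is zero. -/
theorem PrimitiveOn.harmonicOn (B : InvariantMetric) {u : ℂ → FL1} {Ω : Set ℂ} (hΩ : IsOpen Ω)
    (hu : PrimitiveOn u Ω) : HarmonicOn B u Ω := by
  refine ⟨hu.1, fun Ψ K hK hKΩ hs h0 hfix => ?_⟩
  set Φ : ℝ × ℂ → FL1 := fun p => Ψ p.1 p.2 with hΦ
  set e : ℝ × ℂ → ℝ := fun p => (metricPair B Φ p (0, 1) (0, 1) +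
        metricPair B Φ p (0, Complex.I) (0, Complex.I)) / 2 with he
  have hmp := fun X Y => contDiffOn_metricPair B hs X Y
  have hes : ContDiffOn ℝ ∞ e (Set.univ ×ˢ Ω) :=
    ((hmp (0, 1) (0, 1)).add (hmp (0, Complex.I) (0, Complex.I))).div_const 2
  have henergy : ∀ t, ∫ z in K, energyDensity B (Ψ t) z = ∫ z in K, e (t, z) := by
    intro t
    refine MeasureTheory.setIntegral_congr_fun hK.measurableSet fun z hz => ?_
    obtain ⟨F, U, hzU, hF⟩ := hs.exists_frameOn (x := (t, z)) ⟨trivial, hKΩ hz⟩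
    exact energyDensity_eq B hF hzU
  simp only [henergy]
  have hsm : ∀ X Y, ContDiffOn ℝ ∞ (fun y : ℂ => metricPair B Φ (0, y) X Y) Ω := fun X Y =>
    (hmp X Y).comp (contDiff_prodMk_right (0 : ℝ)).contDiffOn fun y hy => ⟨trivial, hy⟩
  have hzero : ∀ X, ∀ z ∈ Ω \ K, metricPair B Φ (0, z) X (1, 0) = 0 := by
    intro X z hz
    -- Off `K` the variation is constant in `t`, so a frame of `u`, extended constantly in `t`, is a
    -- frame of it, and its form vanishes on `∂t`.
    obtain ⟨G, V, hzV, hG⟩ := hu.1.exists_frameOn hz.1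
    have hopen : IsOpen (V ∩ (Ω \ K)) :=
      hG.isOpen.inter (hΩ.sdiff hK.isClosed)
    have hFr : FrameOn Φ (fun p => G p.2) (Set.univ ×ˢ (V ∩ (Ω \ K))) :=
      ⟨isOpen_univ.prod hopen,
        hG.contDiffOn.comp contDiff_snd.contDiffOn fun p hp => hp.2.1,
        fun p hp => (hG.orbit_eq _ hp.2.1).trans (hfix p.1 p.2 hp.2.2).symm⟩
    have hmem : ((0, z) : ℝ × ℂ) ∈ (Set.univ ×ˢ (V ∩ (Ω \ K)) : Set (ℝ × ℂ)) :=
      ⟨trivial, hzV, hz⟩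
    have hd : fderiv ℝ (fun p : ℝ × ℂ => (G p.2 : Mat)) (0, z) (1, 0) = 0 := by
      have h1 : HasFDerivAt (fun p : ℝ × ℂ => (G p.2 : Mat)) _ (0, z) :=
        HasFDerivAt.comp (g := fun y => (G y : Mat)) (f := Prod.snd) (0, z)
          (frame_hasFDerivAt hG.isOpen hG.contDiffOn hzV) (hasFDerivAt_snd (𝕜 := ℝ) (p := ((0, z) : ℝ × ℂ)))
      rw [h1.fderiv]
      exact map_zero (fderiv ℝ (fun y => (G y : Mat)) z)
    have hm0 : mcForm (fun p : ℝ × ℂ => G p.2) (0, z) (1, 0) = 0 := by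
      rw [mcForm, hd, Matrix.mul_zero]
    rw [metricPair, hFr.differential hmem (1, 0), hm0, projP_zero, Ad_zero, InvariantMetric.inner,
      Ad_zero, map_zero]
  have hval : ∫ z in K, fderiv ℝ e (0, z) (1, 0) = 0 := by
    have h1 : ∀ z ∈ K, fderiv ℝ e (0, z) (1, 0) =
        fderiv ℝ (fun y => metricPair B Φ (0, y) (0, 1) (1, 0)) z 1 +
        fderiv ℝ (fun y => metricPair B Φ (0, y) (0, Complex.I) (1, 0)) z Complex.I :=
      fun z hz => hu.fderiv_energy B hΩ hs h0 (hKΩ hz)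
    have hint : ∀ X v, MeasureTheory.IntegrableOn
        (fun z => fderiv ℝ (fun y => metricPair B Φ (0, y) X (1, 0)) z v) K := fun X v =>
      (((contDiffOn_fderiv_apply hΩ (hsm X (1, 0)) v).continuousOn.mono hKΩ).integrableOn_compact hK)
    rw [MeasureTheory.setIntegral_congr_fun hK.measurableSet h1,
      MeasureTheory.integral_add (hint _ _) (hint _ _),
      setIntegral_fderiv_eq_zero hΩ (hsm _ _) hK hKΩ (hzero _),
      setIntegral_fderiv_eq_zero hΩ (hsm _ _) hK hKΩ (hzero _), add_zero]
  have := hasDerivAt_setIntegral hΩ hes hK hKΩ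
  rwa [hval] at this


/-! ### Orthonormal frames of special Lagrangian planes -/

theorem rdot_eq (a b : C3) : rdot a b = ∑ i, ((a i).re * (b i).re + (a i).im * (b i).im) := by
  simp [rdot, PiLp.inner_apply]
  simp [Fin.sum_univ_three]
  ring

theorem rdot_comm (a b : C3) : rdot a b = rdot b a := by
  simp only [rdot_eq, mul_comm]

theorem rdot_add_left (a b c : C3) : rdot (a + b) c = rdot a c + rdot b c := by
  simp [rdot]

theorem rdot_smul_left (r : ℝ) (a b : C3) : rdot (r • a) b = r * rdot a b := by
  simp only [rdot_eq, PiLp.smul_apply, Complex.smul_re, Complex.smul_im, smul_eq_mul,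
    Finset.mul_sum]
  exact Finset.sum_congr rfl fun i _ => by ring

theorem rdot_smul_right (r : ℝ) (a b : C3) : rdot a (r • b) = r * rdot a b := by
  rw [rdot_comm, rdot_smul_left, rdot_comm]

theorem rdot_add_right (a b c : C3) : rdot a (b + c) = rdot a b + rdot a c := by
  rw [rdot_comm, rdot_add_left, rdot_comm b, rdot_comm c]

theorem rdot_self (a : C3) : rdot a a = ‖a‖ ^ 2 := by
  have h := inner_self_eq_norm_sq_to_K (𝕜 := ℂ) a
  rw [rdot, h]
  norm_cast

theorem rdot_sum_sum (v w : Fin 3 → C3) (a b : Fin 3 → ℝ) :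
    rdot (∑ i, a i • v i) (∑ j, b j • w j) = ∑ i, ∑ j, a i * b j * rdot (v i) (w j) := by
  simp only [Fin.sum_univ_three, rdot_add_left, rdot_add_right, rdot_smul_left, rdot_smul_right]
  ring

theorem inner_col (g : SU3) (i j : Fin 3) :
    inner ℂ (col g i) (col g j) = if i = j then (1 : ℂ) else 0 := by
  have := congrFun (congrFun (SU3.star_mul g) i) j
  rw [Matrix.mul_apply, Matrix.one_apply] at this
  rw [← this, PiLp.inner_apply]
  refine Finset.sum_congr rfl fun l _ => ?_
  rw [Matrix.star_apply]
  simp [col, mul_comm]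

theorem rdot_col (g : SU3) (i j : Fin 3) : rdot (col g i) (col g j) = if i = j then 1 else 0 := by
  rw [rdot, inner_col]
  split <;> simp

/-- Two orthonormal bases of one plane differ by an orthogonal matrix, and its determinant is
positive because both are oriented; so it lies in `SO_3`, hence in `SU_3`. -/
theorem exists_SU3_of_orthonormal {V : OrientedPlane} (hV : V ∈ SL) {v : Fin 3 → C3}
    (hv : V.IsWedge v) (ho : ∀ i j, rdot (v i) (v j) = if i = j then 1 else 0) :
    ∃ h : SU3, ∀ j, col h j = v j := by
  obtain ⟨g, hg⟩ := hV
  obtain ⟨A, hA, hAv⟩ := hg.exists_mul hv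
  have hAA : Aᵀ * A = 1 := by
    ext i j
    have := ho i j
    rw [hAv, hAv, rdot_sum_sum] at this
    simp only [rdot_col] at this
    rw [Matrix.one_apply, ← this, Matrix.mul_apply]
    simp [Matrix.transpose_apply]
  have hd : A.det = 1 := by
    have h1 := congrArg Matrix.det hAA
    rw [Matrix.det_mul, Matrix.det_transpose, Matrix.det_one] at h1
    nlinarith
  exact ⟨g * ofSO3 A hAA hd, fun j => (col_mul_ofRealMat _ A j).trans (hAv j).symm⟩

theorem col_mul (g X : Mat) (j : Fin 3) : col (g * X) j = ∑ i, X i j • col g i := by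
  ext l
  simp [col, Matrix.mul_apply, mul_comm]

/-- Turns knowledge of the columns of `dF` into knowledge of the entries of `F⁻¹dF`. -/
theorem SU3.entry_eq_inner (g : SU3) (X : Mat) (i j : Fin 3) :
    inner ℂ (col g i) (col ((g : Mat) * X) j) = X i j := by
  rw [col_mul, inner_sum]
  simp [inner_smul_right, inner_col]

/-- The columns of a matrix as continuous real-linear maps. -/
def colCLM (j : Fin 3) : Mat →L[ℝ] C3 := LinearMap.toContinuousLinearMap
  { toFun := fun X => col X j
    map_add' := fun _ _ => rfl
    map_smul' := fun _ _ => rfl }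

section Columns

variable {E : Type*} [NormedAddCommGroup E] [NormedSpace ℝ E] {F : E → SU3} {U : Set E}

theorem contDiffOn_col (hF : ContDiffOn ℝ ∞ (fun y => (F y : Mat)) U) (j : Fin 3) :
    ContDiffOn ℝ ∞ (fun y => col (F y) j) U := (colCLM j).contDiff.comp_contDiffOn hF

theorem fderiv_col (hU : IsOpen U) (hF : ContDiffOn ℝ ∞ (fun y => (F y : Mat)) U) {x : E}
    (hx : x ∈ U) (j : Fin 3) (X : E) :
    fderiv ℝ (fun y => col (F y) j) x X = col ((F x : Mat) * mcForm F x X) j := by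
  rw [← fderiv_eq_mul_mcForm]
  exact DFunLike.congr_fun ((colCLM j).hasFDerivAt.comp x (frame_hasFDerivAt hU hF hx)).fderiv X

theorem contDiffOn_of_col {G : E → Mat} (h : ∀ j, ContDiffOn ℝ ∞ (fun y => col (G y) j) U) :
    ContDiffOn ℝ ∞ G U := by
  have h1 : ∀ i j, ContDiffOn ℝ ∞ (fun y => G y i j) U := fun i j =>
    (EuclideanSpace.proj (𝕜 := ℂ) i).restrictScalars ℝ |>.contDiff.comp_contDiffOn (h j)
  have h2 : G = fun y => ∑ i, ∑ j, G y i j • Matrix.single i j (1 : ℂ) := by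
    funext y
    conv_lhs => rw [Matrix.matrix_eq_sum_single (G y)]
    refine Finset.sum_congr rfl fun i _ => Finset.sum_congr rfl fun j _ => ?_
    simp
  rw [h2]
  exact ContDiffOn.sum fun i _ => ContDiffOn.sum fun j _ => (h1 i j).smul contDiffOn_const

end Columns

/-! ### From links of special Lagrangian cones to primitive maps -/

/-- A conformal immersion of an open set into `S⁵` with special Lagrangian cone. -/
structure IsLink (u : ℂ → C3) (Ω : Set ℂ) : Prop where
  isOpen : IsOpen Ω
  contDiffOn : ContDiffOn ℝ ∞ u Ω
  norm_eq : ∀ z ∈ Ω, ‖u z‖ = 1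
  immersionAt : ∀ z ∈ Ω, ImmersionAt u z
  weaklyConformalAt : ∀ z ∈ Ω, WeaklyConformalAt u z
  exists_wedge : ∀ z ∈ Ω, ∃ V ∈ SL, V.IsWedge ![u z, dx u z, dy u z]

theorem rdot_fderiv_self {u : ℂ → C3} {Ω : Set ℂ} (hΩ : IsOpen Ω) (hu : ContDiffOn ℝ ∞ u Ω)
    (h1 : ∀ z ∈ Ω, ‖u z‖ = 1) {z : ℂ} (hz : z ∈ Ω) (v : ℂ) : rdot (u z) (fderiv ℝ u z v) = 0 := by
  have hd : DifferentiableAt ℝ u z :=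
    (hu.contDiffAt (hΩ.mem_nhds hz)).differentiableAt (by simp)
  have hre : ∀ i, HasDerivAt (fun t : ℝ => (u (z + t • v) i).re) (fderiv ℝ u z v i).re 0 := fun i =>
    ((Complex.reCLM.comp ((EuclideanSpace.proj (𝕜 := ℂ) i).restrictScalars ℝ)).hasFDerivAt.comp z
      hd.hasFDerivAt).hasLineDerivAt v
  have him : ∀ i, HasDerivAt (fun t : ℝ => (u (z + t • v) i).im) (fderiv ℝ u z v i).im 0 := fun i =>
    ((Complex.imCLM.comp ((EuclideanSpace.proj (𝕜 := ℂ) i).restrictScalars ℝ)).hasFDerivAt.comp z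
      hd.hasFDerivAt).hasLineDerivAt v
  have h2 : HasDerivAt (fun t : ℝ => ∑ i, ((u (z + t • v) i).re * (u (z + t • v) i).re +
      (u (z + t • v) i).im * (u (z + t • v) i).im)) _ 0 :=
    HasDerivAt.fun_sum fun i _ => ((hre i).mul (hre i)).add ((him i).mul (him i))
  have hev : (fun t : ℝ => ∑ i, ((u (z + t • v) i).re * (u (z + t • v) i).re +
      (u (z + t • v) i).im * (u (z + t • v) i).im)) =ᶠ[nhds 0] fun _ => 1 := by
    have hc : Continuous fun t : ℝ => z + t • v := by fun_prop
    filter_upwards [(hΩ.preimage hc).mem_nhds (show (0 : ℝ) ∈ _ by simpa using hz)] with t ht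
    rw [← rdot_eq, rdot_self, h1 _ ht, one_pow]
  have h3 := h2.unique ((hasDerivAt_const (0 : ℝ) (1 : ℝ)).congr_of_eventuallyEq hev)
  rw [rdot_eq]
  simp [Fin.sum_univ_three] at h3 ⊢
  linarith

open Classical in
/-- The frame with prescribed columns, if they form an element of `SU_3`. -/
def frameOfCols (v : ℂ → Fin 3 → C3) (z : ℂ) : SU3 :=
  if h : ∃ g : SU3, ∀ j, col g j = v z j then h.choose else 1

/-- The columns are `u`, `u_x / r`, `u_y / r` with `r = |u_x|`. They are orthonormal by conformality
and `|u| = 1`, and they span the special Lagrangian tangent plane of the cone. -/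
theorem IsLink.exists_frame {u : ℂ → C3} {Ω : Set ℂ} (h : IsLink u Ω) :
    ∃ F : ℂ → SU3, ContDiffOn ℝ ∞ (fun y => (F y : Mat)) Ω ∧ (∀ z ∈ Ω, col (F z) 0 = u z) ∧
      ∃ r : ℂ → ℝ, ∀ z ∈ Ω, 0 < r z ∧ dx u z = r z • col (F z) 1 ∧ dy u z = r z • col (F z) 2 := by
  have hx : ContDiffOn ℝ ∞ (dx u) Ω := contDiffOn_fderiv_apply h.isOpen h.contDiffOn _
  have hy : ContDiffOn ℝ ∞ (dy u) Ω := contDiffOn_fderiv_apply h.isOpen h.contDiffOn _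
  have hx0 : ∀ z ∈ Ω, dx u z ≠ 0 := fun z hz => (h.immersionAt z hz).ne_zero 0
  have hpos : ∀ z ∈ Ω, 0 < ‖dx u z‖ := fun z hz => norm_pos_iff.2 (hx0 z hz)
  let v : ℂ → Fin 3 → C3 := fun z => ![u z, ‖dx u z‖⁻¹ • dx u z, ‖dx u z‖⁻¹ • dy u z]
  have hv : ∀ z ∈ Ω, ∃ g : SU3, ∀ j, col g j = v z j := by
    intro z hz
    obtain ⟨V, hV, hw⟩ := h.exists_wedge z hz
    have hp := hpos z hz
    have hp0 := hp.ne'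
    have hw' : V.IsWedge (v z) := by
      refine hw.of_mul (A := !![1, 0, 0; 0, ‖dx u z‖⁻¹, 0; 0, 0, ‖dx u z‖⁻¹]) ?_ ?_
      · rw [Matrix.det_fin_three]
        simpa using mul_pos (inv_pos.2 hp) (inv_pos.2 hp)
      · intro j
        fin_cases j <;> simp [v, Fin.sum_univ_three]
    have e0 : rdot (u z) (u z) = 1 := by rw [rdot_self, h.norm_eq z hz, one_pow]
    have e1 : rdot (u z) (dx u z) = 0 := rdot_fderiv_self h.isOpen h.contDiffOn h.norm_eq hz _
    have e2 : rdot (u z) (dy u z) = 0 := rdot_fderiv_self h.isOpen h.contDiffOn h.norm_eq hz _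
    have e3 : rdot (dx u z) (dx u z) = ‖dx u z‖ ^ 2 := rdot_self _
    have e4 := (h.weaklyConformalAt z hz).2
    have e5 : rdot (dy u z) (dy u z) = ‖dx u z‖ ^ 2 := by
      rw [← (h.weaklyConformalAt z hz).1, e3]
    refine exists_SU3_of_orthonormal hV hw' fun i j => ?_
    fin_cases i <;> fin_cases j <;>
      simp [v, rdot_smul_left, rdot_smul_right, e0, e1, e2, e3, e4, e5,
        rdot_comm (dx u z) (u z), rdot_comm (dy u z) (u z), rdot_comm (dy u z) (dx u z)] <;>
      grind
  have hcol : ∀ z ∈ Ω, ∀ j, col (frameOfCols v z) j = v z j := by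
    intro z hz
    rw [frameOfCols, dif_pos (hv z hz)]
    exact (hv z hz).choose_spec
  have hn : ContDiffOn ℝ ∞ (fun z => ‖dx u z‖⁻¹) Ω := by
    have h1 : ContDiffOn ℝ ∞ (fun z => ‖dx u z‖) Ω := hx.norm ℂ hx0
    exact h1.inv fun z hz => (hpos z hz).ne'
  refine ⟨frameOfCols v, contDiffOn_of_col fun j => ?_, fun z hz => hcol z hz 0,
    fun z => ‖dx u z‖, fun z hz => ⟨hpos z hz, ?_, ?_⟩⟩
  · refine ContDiffOn.congr ?_ fun z hz => hcol z hz j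
    fin_cases j
    · exact h.contDiffOn
    · exact hn.smul hx
    · exact hn.smul hy
  · rw [hcol z hz 1]
    simp [v, smul_smul, (hpos z hz).ne']
  · rw [hcol z hz 2]
    simp [v, smul_smul, (hpos z hz).ne']

theorem mcForm_smul_add (F : ℂ → SU3) (z v : ℂ) :
    mcForm F z v = v.re • mcForm F z 1 + v.im • mcForm F z Complex.I := by
  have h : v = v.re • (1 : ℂ) + v.im • Complex.I := by
    simp [Complex.re_add_im]
  have h2 : fderiv ℝ (fun y => (F y : Mat)) z v = v.re • fderiv ℝ (fun y => (F y : Mat)) z 1 +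
      v.im • fderiv ℝ (fun y => (F y : Mat)) z Complex.I := by
    conv_lhs => rw [h]
    rw [map_add, map_smul, map_smul]
  rw [mcForm, h2, Matrix.mul_add, Matrix.mul_smul, Matrix.mul_smul]
  rfl

theorem fderiv_entry_im_eq_zero {A : ℂ → Mat} {z : ℂ} (hA : DifferentiableAt ℝ A z) {i j : Fin 3}
    (h : ∀ᶠ y in nhds z, (A y i j).im = 0) (v : ℂ) : (fderiv ℝ A z v i j).im = 0 := by
  have h1 := ((imEntryCLM i j).hasFDerivAt.comp z hA.hasFDerivAt).fderiv
  have h2 : (fun y => imEntryCLM i j (A y)) =ᶠ[nhds z] fun _ => 0 := h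
  have h3 := DFunLike.congr_fun h1 v
  refine Eq.trans h3.symm ?_
  change fderiv ℝ (fun y => imEntryCLM i j (A y)) z v = 0
  rw [h2.fderiv_eq]
  simp

/-- The first columns of `θ(∂x)` and `θ(∂y)` are `(0, r, 0)` and `(0, 0, r)`. Being real, they
contribute no derivative to the imaginary part of the Maurer-Cartan equation, which leaves `Im
θ(∂y)_{i1} = Im θ(∂x)_{i2}` after division by `r`: the second fundamental form is symmetric. The
trace of `θ` vanishes, so this form is trace-free, and that is minimality. -/
theorem primitiveOn_of_frame {u : ℂ → C3} {Ω : Set ℂ} (hΩ : IsOpen Ω) {F : ℂ → SU3}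
    (hF : ContDiffOn ℝ ∞ (fun y => (F y : Mat)) Ω) (h0 : ∀ z ∈ Ω, col (F z) 0 = u z) {r : ℂ → ℝ}
    (hr : ∀ z ∈ Ω, 0 < r z ∧ dx u z = r z • col (F z) 1 ∧ dy u z = r z • col (F z) 2)
    {w : ℂ → FL1} (hw : ∀ z ∈ Ω, orbit (F z) = w z) : PrimitiveOn w Ω := by
  have hFr : FrameOn w F Ω := ⟨hΩ, hF, hw⟩
  have hder : ∀ z ∈ Ω, ∀ v, fderiv ℝ u z v = col ((F z : Mat) * mcForm F z v) 0 := by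
    intro z hz v
    rw [← fderiv_col hΩ hF hz]
    have : u =ᶠ[nhds z] fun y => col (F y) 0 := by
      filter_upwards [hΩ.mem_nhds hz] with y hy using (h0 y hy).symm
    rw [this.fderiv_eq]
  have hx : ∀ z ∈ Ω, ∀ i, mcForm F z 1 i 0 = if i = 1 then (r z : ℂ) else 0 := by
    intro z hz i
    refine (SU3.entry_eq_inner (F z) _ i 0).symm.trans ?_
    rw [← hder z hz]
    change inner ℂ _ (dx u z) = _
    rw [(hr z hz).2.1]
    change inner ℂ _ ((r z : ℂ) • col (F z) 1) = _
    rw [inner_smul_right, inner_col]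
    simp
  have hy : ∀ z ∈ Ω, ∀ i, mcForm F z Complex.I i 0 = if i = 2 then (r z : ℂ) else 0 := by
    intro z hz i
    refine (SU3.entry_eq_inner (F z) _ i 0).symm.trans ?_
    rw [← hder z hz]
    change inner ℂ _ (dy u z) = _
    rw [(hr z hz).2.2]
    change inner ℂ _ ((r z : ℂ) • col (F z) 2) = _
    rw [inner_smul_right, inner_col]
    simp
  have hθd : ∀ z ∈ Ω, ∀ X, DifferentiableAt ℝ (fun p => mcForm F p X) z := fun z hz X =>
    ((contDiffOn_mcForm hΩ hF X).contDiffAt (hΩ.mem_nhds hz)).differentiableAt (by simp)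
  have hprim : ∀ z ∈ Ω, IsPrimPair (mcForm F z 1) (mcForm F z Complex.I) := by
    intro z hz
    have hx' := hx z hz
    have hy' := hy z hz
    have mc := maurerCartan hΩ hF hz 1 Complex.I
    have d1 : ∀ i, (fderiv ℝ (fun p => mcForm F p Complex.I) z 1 i 0).im = 0 := by
      intro i
      refine fderiv_entry_im_eq_zero (hθd z hz _) ?_ _
      filter_upwards [hΩ.mem_nhds hz] with y hy''
      rw [hy y hy'']
      split <;> simp
    have d2 : ∀ i, (fderiv ℝ (fun p => mcForm F p 1) z Complex.I i 0).im = 0 := by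
      intro i
      refine fderiv_entry_im_eq_zero (hθd z hz _) ?_ _
      filter_upwards [hΩ.mem_nhds hz] with y hy''
      rw [hx y hy'']
      split <;> simp
    have sA := skew_entries (star_mcForm hΩ hF hz 1)
    have sB := skew_entries (star_mcForm hΩ hF hz Complex.I)
    have tA := trace_mcForm hΩ hF hz 1
    have tB := trace_mcForm hΩ hF hz Complex.I
    have hp := (hr z hz).1
    generalize fderiv ℝ (fun p => mcForm F p Complex.I) z 1 = D1 at *
    generalize fderiv ℝ (fun p => mcForm F p 1) z Complex.I = D2 at *
    generalize mcForm F z 1 = A at *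
    generalize mcForm F z Complex.I = B at *
    generalize r z = s at *
    have e := fun i => congrArg Complex.im (congrFun (congrFun mc i) 0)
    have e1 := e 1
    have e2 := e 2
    simp [Matrix.mul_apply, hx', hy', d1, d2] at e1 e2
    have q1 : (B 1 1).im = (A 1 2).im := by nlinarith
    have q2 : (B 2 1).im = (A 2 2).im := by nlinarith
    rw [Matrix.trace_fin_three] at tA tB
    have tA' := congrArg Complex.im tA
    have tB' := congrArg Complex.im tB
    have a0 := hx' 0
    have a1 := hx' 1
    have a2 := hx' 2
    have b0 := hy' 0
    have b1 := hy' 1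
    have b2 := hy' 2
    simp at a0 a1 a2 b0 b1 b2
    simp [a0, b0] at tA' tB'
    have a01 := sA 0 1
    have a02 := sA 0 2
    have a11 := sA 1 1
    have a12 := sA 1 2
    have a22 := sA 2 2
    have b01 := sB 0 1
    have b02 := sB 0 2
    have b11 := sB 1 1
    have b12 := sB 1 2
    have b22 := sB 2 2
    simp [a1, a2, b1, b2] at a01 a02 b01 b02
    clear mc e e1 e2 sA sB hx' hy' hder hx hy hθd
    constructor
    · ext i j
      fin_cases i <;> fin_cases j <;> apply Complex.ext <;>
        simp [primX, a0, a1, a2] <;> linarith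
    · ext i j
      fin_cases i <;> fin_cases j <;> apply Complex.ext <;>
        simp [primY, a1, a2, b0, b1, b2] <;> linarith
  refine ⟨fun z hz => ⟨F, hFr.isFrameAt hz⟩, fun z hz => ⟨fun v v' hvv => ?_, ?_⟩⟩
  -- The first column of `θ(v)` is `(0, r Re v, r Im v)` and survives `projP`, so it alone
  -- determines `v`.
  · rw [hFr.differential hz, hFr.differential hz] at hvv
    have h1 := Ad_injective _ hvv
    rw [projP_eq, projP_eq, mcForm_smul_add F z v, mcForm_smul_add F z v'] at h1
    have e1 := congrFun (congrFun h1 1) 0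
    have e2 := congrFun (congrFun h1 2) 0
    have hp : (r z : ℂ) ≠ 0 := by exact_mod_cast (hr z hz).1.ne'
    simp [hx z hz, hy z hz, hp] at e1 e2
    exact Complex.ext e1 e2
  · rw [hFr.differential hz, hFr.differential hz, ← hw z hz, ← Ad_smul, ← Ad_sub, ← Ad_smul,
      Ad_mem_gBundle_iff]
    exact (hprim z hz).mem_gHat


/-! ### The Gauss lift on a Riemann surface -/

theorem hasFDerivAt_coneMap {u : ℂ → C3} {z : ℂ} (hu : DifferentiableAt ℝ u z) (r s : ℝ) (v : ℂ) :
    fderiv ℝ (coneMap u) (r, z) (s, v) = r • fderiv ℝ u z v + s • u z := by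
  have h1 : HasFDerivAt (fun p : ℝ × ℂ => p.1) (ContinuousLinearMap.fst ℝ ℝ ℂ) (r, z) :=
    hasFDerivAt_fst
  have h2 : HasFDerivAt (fun p : ℝ × ℂ => u p.2)
      ((fderiv ℝ u z).comp (ContinuousLinearMap.snd ℝ ℝ ℂ)) (r, z) :=
    HasFDerivAt.comp (g := u) (f := Prod.snd) (r, z) hu.hasFDerivAt hasFDerivAt_snd
  have h3 := DFunLike.congr_fun (h1.smul h2).fderiv (s, v)
  refine Eq.trans h3 ?_
  simp

theorem isWedge_of_link_frame {V : OrientedPlane} {F : SU3} {r : ℝ} (hr : 0 < r)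
    {v : Fin 3 → C3} (hV : V.IsWedge (col F)) (h0 : v 0 = col F 0) (h1 : v 1 = r • col F 1)
    (h2 : v 2 = r • col F 2) : V.IsWedge v := by
  refine hV.of_mul (A := !![1, 0, 0; 0, r, 0; 0, 0, r]) ?_ ?_
  · rw [Matrix.det_fin_three]
    simpa using mul_pos hr hr
  · intro j
    fin_cases j <;> simp [Fin.sum_univ_three, h0, h1, h2]

section Surface

variable {M : Type*} [TopologicalSpace M] [ChartedSpace ℂ M]

theorem IsConformalImmersion.isLink {f : M → C3} (hf : IsConformalImmersion f)
    (hc : IsSpecialLagrangianCone f) {φ : OpenPartialHomeomorph M ℂ} (hφ : φ ∈ atlas ℂ M) :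
    IsLink (f ∘ φ.symm) φ.target where
  isOpen := φ.open_target
  contDiffOn := (hf.2 φ hφ).1
  norm_eq z _ := hf.1 _
  immersionAt z hz := ((hf.2 φ hφ).2 z hz).1
  weaklyConformalAt z hz := ((hf.2 φ hφ).2 z hz).2
  exists_wedge z hz := by
    obtain ⟨V, hV, hw⟩ := hc φ hφ z hz 1 one_pos
    have hd : DifferentiableAt ℝ (f ∘ φ.symm) z :=
      ((hf.2 φ hφ).1.contDiffAt (φ.open_target.mem_nhds hz)).differentiableAt (by simp)
    refine ⟨V, hV, ?_⟩
    rw [IsGaussPlane, hasFDerivAt_coneMap hd, hasFDerivAt_coneMap hd, hasFDerivAt_coneMap hd] at hw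
    simpa [dx, dy] using hw

theorem IsGaussLift.unique {f : M → C3} {ψ ψ' : M → FL1} (h : IsGaussLift f ψ)
    (h' : IsGaussLift f ψ') : ψ = ψ' := by
  funext p
  refine FL1.ext ((h.1 p).trans (h'.1 p).symm) ?_
  have hp := (chartAt ℂ p).map_source (mem_chart_source ℂ p)
  have h1 := h.2 _ (chart_mem_atlas ℂ p) _ hp
  have h2 := h'.2 _ (chart_mem_atlas ℂ p) _ hp
  rw [(chartAt ℂ p).left_inv (mem_chart_source ℂ p)] at h1 h2
  exact h1.unique h2

variable [IsManifold (modelWithCornersSelf ℂ ℂ) ω M]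

theorem differentiableAt_transition {φ φ' : OpenPartialHomeomorph M ℂ} (hφ : φ ∈ atlas ℂ M)
    (hφ' : φ' ∈ atlas ℂ M) {p : M} (hp : p ∈ φ.source) (hp' : p ∈ φ'.source) :
    DifferentiableAt ℂ (φ ∘ φ'.symm) (φ' p) := by
  have h1 := (contDiffGroupoid ω (modelWithCornersSelf ℂ ℂ)).compatible hφ' hφ
  rw [contDiffGroupoid, mem_groupoid_of_pregroupoid] at h1
  have h2 : ContDiffOn ℂ ω (φ ∘ φ'.symm) (φ'.symm.trans φ).source := by
    simpa [contDiffPregroupoid] using h1.1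
  have h3 : φ' p ∈ (φ'.symm.trans φ).source := by
    simp [hp, hp']
  exact (h2.contDiffAt ((φ'.symm.trans φ).open_source.mem_nhds h3)).differentiableAt (by simp)

/-- Transition maps are holomorphic, so their real differential is multiplication by a complex
number. Both the orientation of `f_x ∧ f_y` and the vanishing of `df` are compared between charts
through it. -/
theorem fderiv_chart_change {G : Type*} [NormedAddCommGroup G] [NormedSpace ℝ G] {f : M → G}
    {φ φ' : OpenPartialHomeomorph M ℂ} (hφ : φ ∈ atlas ℂ M)
    (hφ' : φ' ∈ atlas ℂ M) {p : M} (hp : p ∈ φ.source) (hp' : p ∈ φ'.source)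
    (hf : DifferentiableAt ℝ (f ∘ φ.symm) (φ p)) :
    ∃ c : ℂ, ∀ v, fderiv ℝ (f ∘ φ'.symm) (φ' p) v = fderiv ℝ (f ∘ φ.symm) (φ p) (c * v) := by
  have h1 := differentiableAt_transition hφ hφ' hp hp'
  have h2 := h1.hasFDerivAt.restrictScalars ℝ
  have hp0 : (φ ∘ φ'.symm) (φ' p) = φ p := by simp [hp']
  have h3 : HasFDerivAt (f ∘ φ.symm) (fderiv ℝ (f ∘ φ.symm) (φ p)) ((φ ∘ φ'.symm) (φ' p)) := by
    rw [hp0]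
    exact hf.hasFDerivAt
  have h4 := h3.comp (φ' p) h2
  have hev : f ∘ φ'.symm =ᶠ[nhds (φ' p)] (f ∘ φ.symm) ∘ (φ ∘ φ'.symm) := by
    have hopen : IsOpen (φ'.symm.trans φ).source := (φ'.symm.trans φ).open_source
    have hmem : φ' p ∈ (φ'.symm.trans φ).source := by simp [hp, hp']
    filter_upwards [hopen.mem_nhds hmem] with y hy
    have hy' : φ'.symm y ∈ φ.source := by
      have := hy
      simp only [OpenPartialHomeomorph.trans_source, Set.mem_inter_iff, Set.mem_preimage] at this
      exact this.2
    simp [φ.left_inv hy']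
  refine ⟨fderiv ℂ (φ ∘ φ'.symm) (φ' p) 1, fun v => ?_⟩
  rw [(h4.congr_of_eventuallyEq hev).fderiv]
  have h5 : fderiv ℂ (φ ∘ φ'.symm) (φ' p) v = fderiv ℂ (φ ∘ φ'.symm) (φ' p) 1 * v := by
    have := map_smul (fderiv ℂ (φ ∘ φ'.symm) (φ' p)) v 1
    rw [smul_eq_mul, mul_one, smul_eq_mul] at this
    rw [this, mul_comm]
  change fderiv ℝ (f ∘ φ.symm) (φ p) (fderiv ℂ (φ ∘ φ'.symm) (φ' p) v) = _
  rw [h5]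

/-- Frames exist chart by chart and need not agree, but their orbits do: a change of chart acts on
`(f_x, f_y)` by a matrix of determinant `|c|²`, so the oriented plane is the same. -/
theorem exists_gaussLift {f : M → C3} (hf : IsConformalImmersion f)
    (hc : IsSpecialLagrangianCone f) :
    ∃ ψ : M → FL1, IsGaussLift f ψ ∧ IsPrimitive ψ := by
  choose! F hF hF0 r hr using fun (φ : OpenPartialHomeomorph M ℂ) (hφ : φ ∈ atlas ℂ M) =>
    (hf.isLink hc hφ).exists_frame
  have hwedge : ∀ φ ∈ atlas ℂ M, ∀ z ∈ φ.target, (orbit (F φ z)).toPlane.IsWedge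
      ![f (φ.symm z), dx (f ∘ φ.symm) z, dy (f ∘ φ.symm) z] := by
    intro φ hφ z hz
    obtain ⟨h1, h2, h3⟩ := hr φ hφ z hz
    exact isWedge_of_link_frame h1 (orbit_isWedge _) (hF0 φ hφ z hz).symm h2 h3
  let ψ : M → FL1 := fun p => orbit (F (chartAt ℂ p) (chartAt ℂ p p))
  have hlift : IsGaussLift f ψ := by
    constructor
    · intro p
      have hp := (chartAt ℂ p).map_source (mem_chart_source ℂ p)
      have := hF0 _ (chart_mem_atlas ℂ p) _ hp
      rw [Function.comp_apply, (chartAt ℂ p).left_inv (mem_chart_source ℂ p)] at this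
      exact this
    · intro φ' hφ' z hz
      obtain ⟨p, hp', rfl⟩ : ∃ p ∈ φ'.source, φ' p = z :=
        ⟨φ'.symm z, φ'.map_target hz, φ'.right_inv hz⟩
      rw [φ'.left_inv hp']
      have hφ := chart_mem_atlas ℂ p
      have hp := mem_chart_source ℂ p
      have hps := (chartAt ℂ p).map_source hp
      have h1 := hwedge _ hφ _ hps
      rw [(chartAt ℂ p).left_inv hp] at h1
      have hd : DifferentiableAt ℝ (f ∘ (chartAt ℂ p).symm) (chartAt ℂ p p) :=
        ((hf.2 _ hφ).1.contDiffAt ((chartAt ℂ p).open_target.mem_nhds hps)).differentiableAt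
          (by simp)
      obtain ⟨c, hc⟩ := fderiv_chart_change hφ hφ' hp hp' hd
      have hx : dx (f ∘ φ'.symm) (φ' p) = c.re • dx (f ∘ (chartAt ℂ p).symm) (chartAt ℂ p p) +
          c.im • dy (f ∘ (chartAt ℂ p).symm) (chartAt ℂ p p) := by
        rw [dx, hc, dx, dy, ← map_smul, ← map_smul, ← map_add]
        congr 1
        simp [Complex.re_add_im]
      have hy : dy (f ∘ φ'.symm) (φ' p) = (-c.im) • dx (f ∘ (chartAt ℂ p).symm) (chartAt ℂ p p) +
          c.re • dy (f ∘ (chartAt ℂ p).symm) (chartAt ℂ p p) := by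
        rw [dy, hc, dx, dy, ← map_smul, ← map_smul, ← map_add]
        congr 1
        apply Complex.ext <;> simp
      -- `c` is not zero because `f` is an immersion in the second chart as well.
      have hc0 : 0 < c.re * c.re + c.im * c.im := by
        rw [← Complex.normSq_apply, Complex.normSq_pos]
        rintro rfl
        exact ((hf.2 φ' hφ').2 _ hz).1.ne_zero 0 (by simpa using hx)
      refine h1.of_mul (A := !![1, 0, 0; 0, c.re, -c.im; 0, c.im, c.re]) ?_ ?_
      · rw [Matrix.det_fin_three]
        simpa using hc0
      · intro j
        fin_cases j
        · simp [Fin.sum_univ_three]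
        · simp [Fin.sum_univ_three, hx]
        · simp [Fin.sum_univ_three, hy]
  refine ⟨ψ, hlift, fun φ hφ => primitiveOn_of_frame φ.open_target (hF φ hφ) (hF0 φ hφ)
    (hr φ hφ) fun z hz => FL1.ext ?_ ?_⟩
  · exact (hF0 φ hφ z hz).trans (hlift.1 _).symm
  · exact (hwedge φ hφ z hz).unique (hlift.2 φ hφ z hz)

theorem existsUnique_gaussLift {f : M → C3} (hf : IsConformalImmersion f)
    (hc : IsSpecialLagrangianCone f) :
    ∃! ψ : M → FL1, IsGaussLift f ψ ∧ IsPrimitive ψ ∧ ∀ B : InvariantMetric, IsHarmonic B ψ := by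
  obtain ⟨ψ, h1, h2⟩ := exists_gaussLift hf hc
  exact ⟨ψ, ⟨h1, h2, fun B φ hφ => (h2 φ hφ).harmonicOn B φ.open_target⟩,
    fun ψ' h' => h'.1.unique h1⟩

end Surface


/-! ### From primitive maps to minimal Legendrian surfaces -/

theorem col_mul_of_entries (g : SU3) {X : Mat} {a b c : ℝ} (h0 : X 0 0 = a) (h1 : X 1 0 = b)
    (h2 : X 2 0 = c) : col ((g : Mat) * X) 0 = a • col g 0 + b • col g 1 + c • col g 2 := by
  rw [col_mul, Fin.sum_univ_three, h0, h1, h2]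
  rfl

theorem IsPrimPair.col_fst {A B : Mat} (h : IsPrimPair A B) (g : SU3) :
    col ((g : Mat) * A) 0 = (A 1 0).re • col g 1 + (A 2 0).re • col g 2 := by
  obtain ⟨a1, a2, b1, b2, k, l, rfl, rfl⟩ := h.exists_eq
  rw [col_mul_of_entries g (a := 0) (b := a1) (c := a2) (by simp [primX]) rfl rfl]
  simp [primX]

theorem IsPrimPair.col_snd {A B : Mat} (h : IsPrimPair A B) (g : SU3) :
    col ((g : Mat) * B) 0 = (-(A 2 0).re) • col g 1 + (A 1 0).re • col g 2 := by
  obtain ⟨a1, a2, b1, b2, k, l, rfl, rfl⟩ := h.exists_eq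
  rw [col_mul_of_entries g (a := 0) (b := -a2) (c := a1) (by simp [primY]) rfl rfl]
  simp [primX]

theorem rdot_I_smul_col (g : SU3) {j : Fin 3} (hj : j ≠ 0) :
    rdot (Complex.I • col g 0) (col g j) = 0 := by
  rw [rdot, inner_smul_left, inner_col, if_neg hj.symm]
  simp

section Projection

variable {u : ℂ → FL1} {f : ℂ → C3} {F : ℂ → SU3} {U : Set ℂ}

/-- A primitive map on `U` with a frame `F` and its projection `f` to `S⁵`. -/
structure IsFramedPrimitive (u : ℂ → FL1) (f : ℂ → C3) (F : ℂ → SU3) (U : Set ℂ) : Prop where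
  frameOn : FrameOn u F U
  primitiveOn : PrimitiveOn u U
  toSphere : ∀ z ∈ U, f z = (u z).toSphere

namespace IsFramedPrimitive

variable (h : IsFramedPrimitive u f F U)
include h

theorem isOpen : IsOpen U := h.frameOn.isOpen

theorem isPrimPair {z : ℂ} (hz : z ∈ U) : IsPrimPair (mcForm F z 1) (mcForm F z Complex.I) :=
  h.primitiveOn.isPrimPair h.frameOn hz hz

theorem eq_col {z : ℂ} (hz : z ∈ U) : f z = col (F z) 0 := by
  rw [h.toSphere z hz, ← h.frameOn.orbit_eq z hz, orbit_toSphere]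

theorem contDiffOn : ContDiffOn ℝ ∞ f U :=
  (contDiffOn_col h.frameOn.contDiffOn 0).congr fun _ hz => h.eq_col hz

theorem fderiv_eq {z : ℂ} (hz : z ∈ U) (v : ℂ) :
    fderiv ℝ f z v = col ((F z : Mat) * mcForm F z v) 0 := by
  rw [← fderiv_col h.isOpen h.frameOn.contDiffOn hz]
  have : f =ᶠ[nhds z] fun y => col (F y) 0 := by
    filter_upwards [h.isOpen.mem_nhds hz] with y hy using h.eq_col hy
  rw [this.fderiv_eq]

theorem dx_eq {z : ℂ} (hz : z ∈ U) : dx f z =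
    (mcForm F z 1 1 0).re • col (F z) 1 + (mcForm F z 1 2 0).re • col (F z) 2 := by
  rw [dx, h.fderiv_eq hz, (h.isPrimPair hz).col_fst]

theorem dy_eq {z : ℂ} (hz : z ∈ U) : dy f z =
    (-(mcForm F z 1 2 0).re) • col (F z) 1 + (mcForm F z 1 1 0).re • col (F z) 2 := by
  rw [dy, h.fderiv_eq hz, (h.isPrimPair hz).col_snd]

theorem weaklyConformalAt {z : ℂ} (hz : z ∈ U) : WeaklyConformalAt f z := by
  rw [WeaklyConformalAt, h.dx_eq hz, h.dy_eq hz]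
  simp only [rdot_add_left, rdot_add_right, rdot_smul_left, rdot_smul_right, rdot_col]
  constructor
  · simp
    ring
  · simp
    ring

theorem legendrianAt {z : ℂ} (hz : z ∈ U) : LegendrianAt f z := by
  rw [LegendrianAt, h.dx_eq hz, h.dy_eq hz, h.eq_col hz]
  simp only [rdot_add_right, rdot_smul_right, rdot_I_smul_col (F z) (show (1 : Fin 3) ≠ 0 by simp),
    rdot_I_smul_col (F z) (show (2 : Fin 3) ≠ 0 by simp)]
  simp

theorem differentiableAt_mcForm {z : ℂ} (hz : z ∈ U) (v : ℂ) :
    DifferentiableAt ℝ (fun y => mcForm F y v) z :=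
  ((contDiffOn_mcForm h.isOpen h.frameOn.contDiffOn v).contDiffAt
    (h.isOpen.mem_nhds hz)).differentiableAt (by simp)

theorem isPrimPair_fderiv {z : ℂ} (hz : z ∈ U) (v : ℂ) :
    IsPrimPair (fderiv ℝ (fun y => mcForm F y 1) z v)
      (fderiv ℝ (fun y => mcForm F y Complex.I) z v) := by
  refine SLCone.isPrimPair_fderiv (h.differentiableAt_mcForm hz _)
    (h.differentiableAt_mcForm hz _) ?_ v
  filter_upwards [h.isOpen.mem_nhds hz] with y hy using h.isPrimPair hy

theorem maurerCartan {z : ℂ} (hz : z ∈ U) :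
    fderiv ℝ (fun y => mcForm F y Complex.I) z 1 = fderiv ℝ (fun y => mcForm F y 1) z Complex.I +
      (mcForm F z Complex.I * mcForm F z 1 - mcForm F z 1 * mcForm F z Complex.I) :=
  SLCone.maurerCartan h.isOpen h.frameOn.contDiffOn hz 1 Complex.I

theorem fderiv_fderiv_eq {z : ℂ} (hz : z ∈ U) (v : ℂ) :
    fderiv ℝ (fun y => fderiv ℝ f y v) z v = col ((F z : Mat) *
      (mcForm F z v * mcForm F z v + fderiv ℝ (fun y => mcForm F y v) z v)) 0 := by
  have h1 : (fun y => fderiv ℝ f y v) =ᶠ[nhds z]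
      fun y => colCLM 0 ((F y : Mat) * mcForm F y v) := by
    filter_upwards [h.isOpen.mem_nhds hz] with y hy using h.fderiv_eq hy v
  have h2 := (frame_hasFDerivAt h.isOpen h.frameOn.contDiffOn hz).mul'
    (h.differentiableAt_mcForm hz v).hasFDerivAt
  have h3 := DFunLike.congr_fun ((colCLM 0).hasFDerivAt.comp z h2).fderiv v
  rw [h1.fderiv_eq]
  refine Eq.trans h3 ?_
  change col ((F z : Mat) * fderiv ℝ (fun y => mcForm F y v) z v +
    fderiv ℝ (fun y => (F y : Mat)) z v * mcForm F z v) 0 = _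
  rw [fderiv_eq_mul_mcForm, Matrix.mul_add, Matrix.mul_assoc, add_comm]

/-- The factor is `-|df|²`, as it must be for a harmonic map into the unit sphere. -/
theorem laplacian_eq {z : ℂ} (hz : z ∈ U) : dx (dx f) z + dy (dy f) z =
    (-2 * ((mcForm F z 1 1 0).re ^ 2 + (mcForm F z 1 2 0).re ^ 2)) • f z := by
  have h1 : dx (dx f) z = _ := h.fderiv_fderiv_eq hz 1
  have h2 : dy (dy f) z = _ := h.fderiv_fderiv_eq hz Complex.I
  have h3 := (h.isPrimPair hz).div_col (h.isPrimPair_fderiv hz 1)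
    (h.isPrimPair_fderiv hz Complex.I) (h.maurerCartan hz)
  have h4 : ∀ X Y : Mat, col ((F z : Mat) * X) 0 + col ((F z : Mat) * Y) 0 =
      col ((F z : Mat) * (X + Y)) 0 := by
    intro X Y
    rw [Matrix.mul_add]
    rfl
  rw [h1, h2, h4, h.eq_col hz]
  have e : mcForm F z 1 * mcForm F z 1 + fderiv ℝ (fun y => mcForm F y 1) z 1 +
      (mcForm F z Complex.I * mcForm F z Complex.I +
        fderiv ℝ (fun y => mcForm F y Complex.I) z Complex.I) =
      mcForm F z 1 * mcForm F z 1 + mcForm F z Complex.I * mcForm F z Complex.I +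
        fderiv ℝ (fun y => mcForm F y 1) z 1 +
        fderiv ℝ (fun y => mcForm F y Complex.I) z Complex.I := by abel
  rw [e, col_mul_of_entries (F z) (h3 0) (b := 0) (c := 0) ((h3 1).trans (by simp))
    ((h3 2).trans (by simp))]
  simp

theorem sphereHarmonicAt {z : ℂ} (hz : z ∈ U) : SphereHarmonicAt f z := by
  rw [SphereHarmonicAt, h.laplacian_eq hz]
  exact Submodule.smul_mem _ _ (Submodule.mem_span_singleton_self _)

/-- By conformality the trace of the Hessian is the conformal factor times the Laplacian, which is
radial. -/
theorem zeroMeanCurvatureAt {z : ℂ} (hz : z ∈ U) : ZeroMeanCurvatureAt f z := by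
  obtain ⟨h1, h2⟩ := h.weaklyConformalAt hz
  have e : rdot (dy f z) (dy f z) • dx (dx f) z - (2 * rdot (dx f z) (dy f z)) • dx (dy f) z +
      rdot (dx f z) (dx f z) • dy (dy f) z =
      rdot (dx f z) (dx f z) • (dx (dx f) z + dy (dy f) z) := by
    rw [h2, h1, mul_zero, zero_smul, sub_zero, smul_add]
  rw [ZeroMeanCurvatureAt, e, h.laplacian_eq hz]
  exact Submodule.smul_mem _ _ (Submodule.smul_mem _ _ (Submodule.subset_span (by simp)))

theorem fderiv_eq_zero_iff {z : ℂ} (hz : z ∈ U) :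
    fderiv ℝ f z = 0 ↔ (⟨(mcForm F z 1 1 0).re, (mcForm F z 1 2 0).re⟩ : ℂ) = 0 := by
  rw [Complex.ext_iff]
  constructor
  · intro h0
    have h1 : dx f z = 0 := by rw [dx, h0]; rfl
    have h2 : rdot (dx f z) (dx f z) = 0 := by rw [h1]; simp [rdot]
    rw [h.dx_eq hz] at h2
    simp only [rdot_add_left, rdot_add_right, rdot_smul_left, rdot_smul_right, rdot_col] at h2
    simp at h2
    constructor
    · change (mcForm F z 1 1 0).re = 0
      nlinarith [mul_self_nonneg (mcForm F z 1 1 0).re, mul_self_nonneg (mcForm F z 1 2 0).re]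
    · change (mcForm F z 1 2 0).re = 0
      nlinarith [mul_self_nonneg (mcForm F z 1 1 0).re, mul_self_nonneg (mcForm F z 1 2 0).re]
  · rintro ⟨h1, h2⟩
    have h1' : (mcForm F z 1 1 0).re = 0 := h1
    have h2' : (mcForm F z 1 2 0).re = 0 := h2
    have hx := h.dx_eq hz
    have hy := h.dy_eq hz
    simp only [h1', h2', neg_zero, zero_smul, add_zero, dx, dy] at hx hy
    ext1 v
    have hv : v = v.re • (1 : ℂ) + v.im • Complex.I := by simp [Complex.re_add_im]
    rw [hv, map_add, map_smul, map_smul, hx, hy]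
    simp

/-- The derivatives of the cone are `F e₁`, `r f_x` and `r f_y`, and their matrix in the columns of
`F` has determinant `r²|α|²`, positive where `df` does not vanish. -/
theorem isGaussPlane {z : ℂ} (hz : z ∈ U) (h0 : fderiv ℝ f z ≠ 0) {r : ℝ} (hr : 0 < r) :
    IsGaussPlane (coneMap f) (r, z) (u z).toPlane := by
  have hd : DifferentiableAt ℝ f z :=
    (h.contDiffOn.contDiffAt (h.isOpen.mem_nhds hz)).differentiableAt (by simp)
  rw [Ne, h.fderiv_eq_zero_iff hz] at h0
  have hx := h.dx_eq hz
  have hy := h.dy_eq hz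
  have hf := h.eq_col hz
  have hpos := Complex.normSq_pos.2 h0
  rw [Complex.normSq_mk] at hpos
  rw [IsGaussPlane, hasFDerivAt_coneMap hd, hasFDerivAt_coneMap hd, hasFDerivAt_coneMap hd,
    ← h.frameOn.orbit_eq z hz]
  have hx' : fderiv ℝ f z 1 = _ := hx
  have hy' : fderiv ℝ f z Complex.I = _ := hy
  generalize (mcForm F z 1 1 0).re = a at *
  generalize (mcForm F z 1 2 0).re = b at *
  refine (orbit_isWedge (F z)).of_mul
    (A := !![1, 0, 0; 0, r * a, -(r * b); 0, r * b, r * a]) ?_ ?_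
  · have : Matrix.det !![1, 0, 0; 0, r * a, -(r * b); 0, r * b, r * a] =
        (r * r) * (a * a + b * b) := by
      simp [Matrix.det_fin_three]
      ring
    rw [this]
    positivity
  · intro j
    fin_cases j
    · simp [Fin.sum_univ_three, hf]
    · simp [Fin.sum_univ_three, hx', smul_smul]
    · simp [Fin.sum_univ_three, hy', smul_smul]

theorem immersionAt {z : ℂ} (hz : z ∈ U) (h0 : fderiv ℝ f z ≠ 0) : ImmersionAt f z := by
  have hd : DifferentiableAt ℝ f z :=
    (h.contDiffOn.contDiffAt (h.isOpen.mem_nhds hz)).differentiableAt (by simp)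
  obtain ⟨h1, -⟩ := h.isGaussPlane hz h0 one_pos
  rw [hasFDerivAt_coneMap hd, hasFDerivAt_coneMap hd, hasFDerivAt_coneMap hd] at h1
  have h2 := h1.comp (![1, 2] : Fin 2 → Fin 3) (by decide)
  have e : ![dx f z, dy f z] =
      ![f z, (1 : ℝ) • fderiv ℝ f z 1, (1 : ℝ) • fderiv ℝ f z Complex.I] ∘ ![1, 2] := by
    funext j
    fin_cases j <;> simp [dx, dy]
  rw [ImmersionAt, e]
  simpa using h2

end IsFramedPrimitive

end Projection


/-! ### The holomorphic cubic `α²β` and the zeros of `df` -/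

/-- The first coefficient of `F⁻¹ dF(∂/∂x)` for a frame `F` of a primitive map. -/
def fstCoeff : Mat →L[ℝ] ℂ := LinearMap.toContinuousLinearMap
  { toFun := fun A => ⟨(A 1 0).re, (A 2 0).re⟩
    map_add' := fun A B => by apply Complex.ext <;> simp
    map_smul' := fun r A => by apply Complex.ext <;> simp }

/-- The second coefficient of `F⁻¹ dF(∂/∂x)` for a frame `F` of a primitive map. -/
def sndCoeff : Mat →L[ℝ] ℂ := LinearMap.toContinuousLinearMap
  { toFun := fun A => ⟨(A 1 2).im, (A 1 1).im⟩
    map_add' := fun A B => by apply Complex.ext <;> simp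
    map_smul' := fun r A => by apply Complex.ext <;> simp }

theorem fstCoeff_apply (A : Mat) : fstCoeff A = ⟨(A 1 0).re, (A 2 0).re⟩ := rfl

theorem sndCoeff_apply (A : Mat) : sndCoeff A = ⟨(A 1 2).im, (A 1 1).im⟩ := rfl

namespace IsFramedPrimitive

variable {u : ℂ → FL1} {f : ℂ → C3} {F : ℂ → SU3} {U : Set ℂ} (h : IsFramedPrimitive u f F U)
include h

/-- If both coefficients vanished, the `𝔭`-part of `θ(∂x)` would be zero and the primitive map would
not be an immersion. -/
theorem coeff_ne_zero {z : ℂ} (hz : z ∈ U) :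
    fstCoeff (mcForm F z 1) ≠ 0 ∨ sndCoeff (mcForm F z 1) ≠ 0 := by
  by_contra! h0
  obtain ⟨h1, h2⟩ := h0
  rw [fstCoeff_apply, Complex.ext_iff] at h1
  rw [sndCoeff_apply, Complex.ext_iff] at h2
  have h3 : projP (mcForm F z 1) = 0 := by
    have e1 : (mcForm F z 1 1 0).re = 0 := h1.1
    have e2 : (mcForm F z 1 2 0).re = 0 := h1.2
    have e3 : (mcForm F z 1 1 2).im = 0 := h2.1
    have e4 : (mcForm F z 1 1 1).im = 0 := h2.2
    rw [(h.isPrimPair hz).1, projP_primX, e1, e2, e3, e4]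
    ext i j
    fin_cases i <;> fin_cases j <;> apply Complex.ext <;> simp [primX]
  refine one_ne_zero ((h.primitiveOn.2 z hz).1 (a₁ := (1 : ℂ)) (a₂ := 0) ?_)
  rw [h.frameOn.differential hz, h.frameOn.differential hz, h3]
  simp [mcForm, projP_zero]

/-- The cubic differential `α² β` of a primitive map is holomorphic. -/
theorem differentiableOn_cubic : DifferentiableOn ℂ
    (fun z => fstCoeff (mcForm F z 1) ^ 2 * sndCoeff (mcForm F z 1)) U := by
  intro z hz
  have hA := (h.differentiableAt_mcForm hz 1).hasFDerivAt
  have hα := fstCoeff.hasFDerivAt.comp z hA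
  have hβ := sndCoeff.hasFDerivAt.comp z hA
  have hH : HasFDerivAt (fun z => fstCoeff (mcForm F z 1) ^ 2 * sndCoeff (mcForm F z 1)) _ z :=
    (hα.pow 2).mul hβ
  refine (differentiableAt_complex_iff_differentiableAt_real.2
    ⟨hH.differentiableAt, ?_⟩).differentiableWithinAt
  have hd := (h.isPrimPair hz).dbar (h.isPrimPair_fderiv hz 1)
    (h.isPrimPair_fderiv hz Complex.I) (h.maurerCartan hz)
  have e : ∀ v : ℂ, fderiv ℝ (fun z => fstCoeff (mcForm F z 1) ^ 2 * sndCoeff (mcForm F z 1)) z v =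
      2 * fstCoeff (mcForm F z 1) * fstCoeff (fderiv ℝ (fun y => mcForm F y 1) z v) *
        sndCoeff (mcForm F z 1) +
      fstCoeff (mcForm F z 1) ^ 2 * sndCoeff (fderiv ℝ (fun y => mcForm F y 1) z v) := by
    intro v
    refine (DFunLike.congr_fun hH.fderiv v).trans ?_
    change fstCoeff (mcForm F z 1) ^ 2 * sndCoeff (fderiv ℝ (fun y => mcForm F y 1) z v) +
      sndCoeff (mcForm F z 1) * ((2 • fstCoeff (mcForm F z 1) ^ 1) *
        fstCoeff (fderiv ℝ (fun y => mcForm F y 1) z v)) = _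
    rw [two_nsmul]
    ring
  simp only [← fstCoeff_apply, ← sndCoeff_apply] at hd
  rw [e, e, smul_eq_mul]
  -- `hd` is `D_x + i D_y = 0` for the partial derivatives of `α²β`; times `-i` it is the
  -- Cauchy-Riemann equation `D_y = i D_x`.
  linear_combination (-Complex.I) * hd +
    (2 * fstCoeff (mcForm F z 1) * fstCoeff (fderiv ℝ (fun y => mcForm F y 1) z Complex.I) *
        sndCoeff (mcForm F z 1) +
      fstCoeff (mcForm F z 1) ^ 2 * sndCoeff (fderiv ℝ (fun y => mcForm F y 1) z Complex.I)) *
      Complex.I_mul_I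

theorem continuousOn_coeff (L : Mat →L[ℝ] ℂ) : ContinuousOn (fun z => L (mcForm F z 1)) U :=
  L.continuous.comp_continuousOn fun _ hz =>
    (h.differentiableAt_mcForm hz 1).continuousAt.continuousWithinAt

theorem fderiv_eq_zero_iff_fstCoeff {z : ℂ} (hz : z ∈ U) :
    fderiv ℝ f z = 0 ↔ fstCoeff (mcForm F z 1) = 0 := h.fderiv_eq_zero_iff hz

/-- Zeros of `α` are zeros of the analytic function `α²β`, so they are isolated unless it vanishes
identically nearby. That case is settled by topology, since `α` and `β` have no common zero. -/
theorem eventually_fderiv {z : ℂ} (hz : z ∈ U) :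
    (∀ᶠ y in nhds z, fderiv ℝ f y = 0) ∨ ∀ᶠ y in nhdsWithin z {z}ᶜ, fderiv ℝ f y ≠ 0 := by
  have hU := h.isOpen.mem_nhds hz
  rcases (h.differentiableOn_cubic.analyticAt hU).eventually_eq_zero_or_eventually_ne_zero
    with h0 | h0
  · obtain ⟨r, hr, hball⟩ := Metric.mem_nhds_iff.1 (h0.and hU)
    have hsub : Metric.ball z r ⊆ U := fun y hy => (hball hy).2
    have hopen : ∀ L : Mat →L[ℝ] ℂ,
        IsOpen (Metric.ball z r ∩ (fun y => L (mcForm F y 1)) ⁻¹' {0}ᶜ) := fun L =>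
      ((h.continuousOn_coeff L).mono hsub).isOpen_inter_preimage Metric.isOpen_ball
        isOpen_compl_singleton
    have hdisj : Disjoint (Metric.ball z r ∩ (fun y => fstCoeff (mcForm F y 1)) ⁻¹' {0}ᶜ)
        (Metric.ball z r ∩ (fun y => sndCoeff (mcForm F y 1)) ⁻¹' {0}ᶜ) := by
      rw [Set.disjoint_left]
      rintro y ⟨hy, hy1⟩ ⟨-, hy2⟩
      exact mul_ne_zero (pow_ne_zero 2 hy1) hy2 (hball hy).1
    have hcover : Metric.ball z r ⊆
        (Metric.ball z r ∩ (fun y => fstCoeff (mcForm F y 1)) ⁻¹' {0}ᶜ) ∪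
        (Metric.ball z r ∩ (fun y => sndCoeff (mcForm F y 1)) ⁻¹' {0}ᶜ) := fun y hy =>
      (h.coeff_ne_zero (hsub hy)).imp (fun h => ⟨hy, h⟩) fun h => ⟨hy, h⟩
    -- A connected ball covered by the disjoint open sets `α ≠ 0` and `β ≠ 0` lies in one of them:
    -- either `α` has no zero on the ball, or `α` is identically zero there.
    rcases (convex_ball z r).isPreconnected.subset_or_subset (hopen _) (hopen _) hdisj hcover
      with h1 | h1
    · right
      filter_upwards [nhdsWithin_le_nhds (Metric.ball_mem_nhds z hr)] with y hy
      rw [Ne, h.fderiv_eq_zero_iff_fstCoeff (hsub hy)]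
      exact (h1 hy).2
    · left
      filter_upwards [Metric.ball_mem_nhds z hr] with y hy
      rw [h.fderiv_eq_zero_iff_fstCoeff (hsub hy)]
      by_contra h2
      exact Set.disjoint_left.1 hdisj ⟨hy, h2⟩ (h1 hy)
  · right
    filter_upwards [h0, nhdsWithin_le_nhds hU] with y hy hyU
    rw [Ne, h.fderiv_eq_zero_iff_fstCoeff hyU]
    rintro h1
    exact hy (by simp [h1])

end IsFramedPrimitive


/-! ### Passage to the surface -/

theorem FrameOn.mono {E : Type*} [NormedAddCommGroup E] [NormedSpace ℝ E] {u : E → FL1}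
    {F : E → SU3} {U V : Set E} (h : FrameOn u F U) (hV : IsOpen V) (hVU : V ⊆ U) :
    FrameOn u F V :=
  ⟨hV, h.contDiffOn.mono hVU, fun y hy => h.orbit_eq y (hVU hy)⟩

theorem PrimitiveOn.mono {u : ℂ → FL1} {U V : Set ℂ} (h : PrimitiveOn u U) (hVU : V ⊆ U) :
    PrimitiveOn u V :=
  ⟨fun y hy => h.1 y (hVU hy), fun y hy => h.2 y (hVU hy)⟩

section Surface

variable {M : Type*} [TopologicalSpace M] [ChartedSpace ℂ M] {ψ : M → FL1} {f : M → C3}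

theorem IsPrimitive.exists_isFramedPrimitive (hψ : IsPrimitive ψ)
    (hf : ∀ p, f p = (ψ p).toSphere) {φ : OpenPartialHomeomorph M ℂ} (hφ : φ ∈ atlas ℂ M) {z : ℂ}
    (hz : z ∈ φ.target) :
    ∃ F U, z ∈ U ∧ IsFramedPrimitive (ψ ∘ φ.symm) (f ∘ φ.symm) F U := by
  obtain ⟨F, U, hzU, hF⟩ := (hψ φ hφ).1.exists_frameOn hz
  exact ⟨F, U ∩ φ.target, ⟨hzU, hz⟩, hF.mono (hF.isOpen.inter φ.open_target)
    Set.inter_subset_left, (hψ φ hφ).mono Set.inter_subset_right, fun z _ => hf _⟩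

theorem IsPrimitive.inCharts (hψ : IsPrimitive ψ) (hf : ∀ p, f p = (ψ p).toSphere) :
    InCharts (fun u Ω => ContDiffOn ℝ ∞ u Ω ∧ ∀ z ∈ Ω,
      WeaklyConformalAt u z ∧ LegendrianAt u z ∧ SphereHarmonicAt u z) f := by
  intro φ hφ
  constructor
  · intro z hz
    obtain ⟨F, U, hzU, h⟩ := hψ.exists_isFramedPrimitive hf hφ hz
    exact (h.contDiffOn.contDiffAt (h.isOpen.mem_nhds hzU)).contDiffWithinAt
  · intro z hz
    obtain ⟨F, U, hzU, h⟩ := hψ.exists_isFramedPrimitive hf hφ hz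
    exact ⟨h.weaklyConformalAt hzU, h.legendrianAt hzU, h.sphereHarmonicAt hzU⟩

theorem IsPrimitive.isGaussPlane (hψ : IsPrimitive ψ) (hf : ∀ p, f p = (ψ p).toSphere)
    {φ : OpenPartialHomeomorph M ℂ} (hφ : φ ∈ atlas ℂ M) {z : ℂ} (hz : z ∈ φ.target)
    (hc : φ.symm z ∉ criticalSet f) :
    ImmersionAt (f ∘ φ.symm) z ∧ ZeroMeanCurvatureAt (f ∘ φ.symm) z ∧
      (ψ (φ.symm z)).toPlane ∈ SL ∧
      ∀ r : ℝ, 0 < r → IsGaussPlane (coneMap (f ∘ φ.symm)) (r, z) (ψ (φ.symm z)).toPlane := by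
  obtain ⟨F, U, hzU, h⟩ := hψ.exists_isFramedPrimitive hf hφ hz
  have h0 : fderiv ℝ (f ∘ φ.symm) z ≠ 0 := fun h0 =>
    hc ⟨φ, hφ, φ.map_target hz, by rwa [φ.right_inv hz]⟩
  exact ⟨h.immersionAt hzU h0, h.zeroMeanCurvatureAt hzU, (ψ (φ.symm z)).2.2.1,
    fun r hr => h.isGaussPlane hzU h0 hr⟩

variable [IsManifold (modelWithCornersSelf ℂ ℂ) ω M]

/-- The critical set asks only for some chart in which the differential vanishes; by the chain rule
any chart at the point will do. -/
theorem mem_criticalSet_iff {φ : OpenPartialHomeomorph M ℂ} (hφ : φ ∈ atlas ℂ M)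
    (hf : InCharts (ContDiffOn ℝ ∞) f) {p : M} (hp : p ∈ φ.source) :
    p ∈ criticalSet f ↔ fderiv ℝ (f ∘ φ.symm) (φ p) = 0 := by
  refine ⟨?_, fun h => ⟨φ, hφ, hp, h⟩⟩
  rintro ⟨φ', hφ', hp', h0⟩
  obtain ⟨c, hc⟩ := fderiv_chart_change hφ' hφ hp' hp (((hf φ' hφ').contDiffAt
    (φ'.open_target.mem_nhds (φ'.map_source hp'))).differentiableAt (by simp))
  ext1 v
  rw [hc, h0]
  rfl

theorem IsPrimitive.eventually_criticalSet (hψ : IsPrimitive ψ)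
    (hf : ∀ p, f p = (ψ p).toSphere) (p : M) :
    (∀ᶠ q in nhds p, q ∈ criticalSet f) ∨ ∀ᶠ q in nhds p, q ∈ criticalSet f → q = p := by
  have hφ := chart_mem_atlas ℂ p
  have hp := mem_chart_source ℂ p
  have hpt := (chartAt ℂ p).map_source hp
  have hs := (chartAt ℂ p).open_source.mem_nhds hp
  have hcont := (chartAt ℂ p).continuousAt hp
  have hsm : InCharts (ContDiffOn ℝ ∞) f := fun φ hφ => (hψ.inCharts hf φ hφ).1
  obtain ⟨F, U, hzU, h⟩ := hψ.exists_isFramedPrimitive hf hφ hpt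
  refine (h.eventually_fderiv hzU).imp (fun h0 => ?_) fun h0 => ?_
  · filter_upwards [hcont.eventually h0, hs] with q hq hqs
    rwa [mem_criticalSet_iff hφ hsm hqs]
  · rw [eventually_nhdsWithin_iff] at h0
    filter_upwards [hcont.eventually h0, hs] with q hq hqs hqc
    rw [mem_criticalSet_iff hφ hsm hqs] at hqc
    by_contra hne
    exact hq (fun he => hne ((chartAt ℂ p).injOn hqs hp he)) hqc

theorem eventually_eq_of_eventually_criticalSet (hf : InCharts (ContDiffOn ℝ ∞) f) {p : M}
    (h : ∀ᶠ q in nhds p, q ∈ criticalSet f) : ∀ᶠ q in nhds p, f q = f p := by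
  have hφ := chart_mem_atlas ℂ p
  have hp := mem_chart_source ℂ p
  have hpt := (chartAt ℂ p).map_source hp
  have h1 : ∀ᶠ y in nhds (chartAt ℂ p p), y ∈ (chartAt ℂ p).target ∧
      (chartAt ℂ p).symm y ∈ criticalSet f := by
    refine Filter.Eventually.and ((chartAt ℂ p).open_target.mem_nhds hpt)
      (((chartAt ℂ p).continuousAt_symm hpt).eventually ?_)
    rwa [(chartAt ℂ p).left_inv hp]
  obtain ⟨r, hr, hball⟩ := Metric.mem_nhds_iff.1 h1
  have hconst : ∀ y ∈ Metric.ball (chartAt ℂ p p) r,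
      (f ∘ (chartAt ℂ p).symm) y = (f ∘ (chartAt ℂ p).symm) (chartAt ℂ p p) := by
    intro y hy
    refine Metric.isOpen_ball.is_const_of_fderiv_eq_zero (𝕜 := ℝ)
      (convex_ball _ r).isPreconnected (((hf _ hφ).differentiableOn (by simp)).mono
        fun y hy => (hball hy).1) (fun y hy => ?_) hy (Metric.mem_ball_self hr)
    obtain ⟨hy1, hy2⟩ := hball hy
    rw [mem_criticalSet_iff hφ hf ((chartAt ℂ p).map_target hy1),
      (chartAt ℂ p).right_inv hy1] at hy2
    exact hy2
  filter_upwards [((chartAt ℂ p).continuousAt hp).eventually (Metric.ball_mem_nhds _ hr),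
    (chartAt ℂ p).open_source.mem_nhds hp] with q hq hqs
  have := hconst _ hq
  rwa [Function.comp_apply, Function.comp_apply, (chartAt ℂ p).left_inv hqs,
    (chartAt ℂ p).left_inv hp] at this

/-- The interior of the critical set is open, and it is closed because a limit point of it cannot be
an isolated critical point. By connectedness it is empty, or it is the whole surface and `f` is
locally constant. -/
theorem IsPrimitive.const_or_isolated [ConnectedSpace M] (hψ : IsPrimitive ψ)
    (hf : ∀ p, f p = (ψ p).toSphere) :
    (∃ c, ∀ p, f p = c) ∨ ∀ p, ∃ U ∈ nhds p, U ∩ criticalSet f ⊆ {p} := by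
  have hclopen : IsClopen {p | ∀ᶠ q in nhds p, q ∈ criticalSet f} := by
    refine ⟨isClosed_of_closure_subset fun p hp => ?_, isOpen_setOfPred_eventually_nhds⟩
    refine (hψ.eventually_criticalSet hf p).elim id fun h => ?_
    obtain ⟨q, hq, hqA⟩ := mem_closure_iff_nhds.1 hp _ h
    rwa [hq hqA.self_of_nhds] at hqA
  rcases isClopen_iff.1 hclopen with h | h
  · right
    intro p
    refine (hψ.eventually_criticalSet hf p).elim (fun h0 => ?_) fun h0 =>
      ⟨_, h0, fun q hq => hq.1 hq.2⟩
    exact ((Set.ext_iff.1 h p).1 h0).elim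
  · left
    have hc : IsLocallyConstant f := (IsLocallyConstant.iff_eventually_eq f).2 fun p =>
      eventually_eq_of_eventually_criticalSet (fun φ hφ => (hψ.inCharts hf φ hφ).1)
        ((Set.ext_iff.1 h p).2 trivial)
    obtain ⟨p₀⟩ := (inferInstance : Nonempty M)
    exact ⟨f p₀, fun p => hc.apply_eq_of_preconnectedSpace p p₀⟩

end Surface

end SLCone

end

theorem mainTheorem2 {M : Type*} [TopologicalSpace M] [T2Space M] [ConnectedSpace M]
    [ChartedSpace ℂ M] [IsManifold (modelWithCornersSelf ℂ ℂ) ω M] :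
    -- `FL1` is the 6-symmetric space `SU_3 / K_1` of the outer automorphism `σ̂`
    (orderOf SLCone.sigmaHat = 6 ∧
      (∀ h : SLCone.SU3, SLCone.sigmaHat ≠ MulAut.conj h) ∧
      (∀ g : SLCone.SU3, SLCone.sigmaHat g = g ↔ g ∈ SLCone.K1) ∧
      Function.Surjective SLCone.orbit ∧
      (∀ g h : SLCone.SU3, SLCone.orbit g = SLCone.orbit h ↔ g⁻¹ * h ∈ SLCone.K1)) ∧
    -- the lift of the link of a special Lagrangian cone is primitive and harmonic
    (∀ f : M → SLCone.C3, SLCone.IsConformalImmersion f → SLCone.IsSpecialLagrangianCone f →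
      ∃! ψ : M → SLCone.FL1, SLCone.IsGaussLift f ψ ∧
        SLCone.IsPrimitive ψ ∧ ∀ B : SLCone.InvariantMetric, SLCone.IsHarmonic B ψ) ∧
    -- conversely, a primitive map projects to a minimal Legendrian surface and to the Gauss map
    -- of the special Lagrangian cone over it
    (∀ ψ : M → SLCone.FL1, SLCone.IsPrimitive ψ → ∀ f : M → SLCone.C3,
      (∀ p, f p = (ψ p).toSphere) →
      SLCone.InCharts (fun u Ω => ContDiffOn ℝ ∞ u Ω ∧ ∀ z ∈ Ω,
        SLCone.WeaklyConformalAt u z ∧ SLCone.LegendrianAt u z ∧ SLCone.SphereHarmonicAt u z) f ∧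
      (∀ φ ∈ atlas ℂ M, ∀ z ∈ φ.target, φ.symm z ∉ SLCone.criticalSet f →
        SLCone.ImmersionAt (f ∘ φ.symm) z ∧ SLCone.ZeroMeanCurvatureAt (f ∘ φ.symm) z ∧
        (ψ (φ.symm z)).toPlane ∈ SLCone.SL ∧
        ∀ r : ℝ, 0 < r → SLCone.IsGaussPlane (SLCone.coneMap (f ∘ φ.symm)) (r, z)
          (ψ (φ.symm z)).toPlane) ∧
      ((∃ c, ∀ p, f p = c) ∨
        ∀ p, ∃ U ∈ nhds p, U ∩ SLCone.criticalSet f ⊆ {p})) := by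
  exact ⟨⟨SLCone.orderOf_sigmaHat, SLCone.sigmaHat_ne_conj, SLCone.sigmaHat_fixed_iff,
    SLCone.orbit_surjective, SLCone.orbit_eq_iff⟩,
    fun f hf hc => SLCone.existsUnique_gaussLift hf hc,
    fun ψ hψ f hf => ⟨hψ.inCharts hf, fun φ hφ z hz hc => hψ.isGaussPlane hf hφ hz hc,
      hψ.const_or_isolated hf⟩⟩
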